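/- **Setting.** A rooted binary tree is a rooted tree in which every vertex has zero or two children. A *tanglegram* $(T,S,\phi)$ of size $n\ge 1$ consists of two rooted binary trees $T,S$ with leaves $t_1,\dots,t_n$ and $s_1,\dots,s_n$ and a permutation $\phi$ of $[n]$; its (between-tree) *edges* are the pairs $(t_i,s_{\phi(i)})$. A *layout* is a pair $(X,Y)$ of lists, where $X$ (resp. $Y$) is the top-to-bottom order of the leaves in a plane drawing of $T$ (resp. $S$), the order of the two children being free at each internal vertex. Edges $i,j$ *cross* if $t_i$ is above $t_j$ in $X$ and $s_{\phi(i)}$ is below $s_{\phi(j)}$ in $Y$, or vice versa. A tanglegram is *planar* if it has a layout without crossings. For $\emptyset\ne I\subseteq[n]$, $T_I$ is the minimal subtree of $T$ containing $\{t_i\}_{i\in I}$, with vertices having only one child suppressed; $S_{\phi(I)}$ is defined likewise, and $(T_I,S_{\phi(I)},\phi|_I)$ is the *subtanglegram induced by $I$*. Write $\mathrm{leaf}(u)$ for the leaves below $u$, and $x<u$ if $x$ is a proper descendant of $u$. A *flip* at $u$ reverses the sublist of the leaves below $u$; a *paired flip* at $(u,v)\in T\times S$ is a flip at $u$ and one at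 $v$; a *subtree switch* at an internal vertex $u$ interchanges the two blocks of leaves below its two children, keeping the order in each block. **Algorithm IteratedInsertion.** Input: a tanglegram $(T,S,\phi)$ of size $n$ and a nonempty $I\subseteq[n]$ such that $(T_I,S_{\phi(I)},\phi|_I)$ is planar. 1. (*ModifiedUntangle* on $(T_I,S_{\phi(I)},\phi|_I)$.) Start with the lists $X,Y$ consisting of the two roots, and $L=\emptyset$. Join $u\in X$ and $v\in Y$ if some leaf below $u$ is matched with some leaf below $v$. While $X\cup Y$ has an internal vertex, take one, $u$, of highest degree in this bipartite graph; if its degree is $1$, add to $L$ the pair consisting of $u$ and its neighbour; replace $u$ in its list by its children, in the order $u_1u_2$ if no neighbour of $u_2$ precedes the last neighbour of $u_1$ in the opposite list, and $u_2u_1$ otherwise. Put $M:=L$, $J:=I$. 2. While $J\ne[n]$: let $i=\min([n]\setminus J)$. Extend $(X,Y)$ to a layout of the subtanglegram induced by $J\cup\{i\}$ by placing $t_i$ just above the leaves below its sibling, and $s_{\phi(i)}$ likewise. Let $u_0,v_0$ be the parents of $t_i,s_{\phi(i)}$ in $T_{J\cup\{i\}},S_{\phi(J\cup\{i\})}$.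 Let $M_T=\{(u,v)\in M:u>t_i,\ v\not>s_{\phi(i)}\}$ and $M_S=\{(u,v)\in M:u\not>t_i,\ v>s_{\phi(i)}\}$, and remove both from $M$. For sets $A$ of leaves, let $E(A)$ be the set of edges in $J$ with an endpoint in $A$. "Optimizing" an operation with respect to $E(A)$ means performing it if edge $i$ currently crosses more than half of the edges in $E(A)$. * *Processing the chain $M_S$*: order $M_S=\{(u_j,v_j)\}_{j=1}^m$ so that $v_0<v_1<\dots<v_m$; for $j=m,\dots,1$ optimize the paired flip at $(u_j,v_j)$ with respect to $E(\mathrm{leaf}(v_j)\setminus\mathrm{leaf}(v_{j-1}))$. The chain $M_T$ is processed in the same way, with the roles of $T$ and $S$ (and $u_0$ and $v_0$) exchanged. * (a) If $M_S\neq\emptyset$ and $u_0>u_m$, where $(u_m,v_m)\in M_S$ has $v_m$ maximal: optimize the subtree switch at $u_0$ with respect to $E(\mathrm{leaf}(u_0)\setminus\mathrm{leaf}(u_m))$, process the chain $M_S$, and optimize the subtree switch at $v_0$ with respect to $E(\mathrm{leaf}(v_0)\setminus\{s_{\phi(i)}\})$. * (b) Otherwise, if $M_T\ne\emptyset$ and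 $v_0$ lies above the vertex paired with the maximal $u$ in $M_T$: the same with the roles of $T$ and $S$ exchanged. * (c) Otherwise: process the chains $M_T$ and then $M_S$. Let $E_u=E(\mathrm{leaf}(u_0)\setminus\{t_i\})$ and $E_v=E(\mathrm{leaf}(v_0)\setminus\{s_{\phi(i)}\})$. If $E_u\cap E_v=\emptyset$, optimize the subtree switch at $u_0$ with respect to $E_u$ and the one at $v_0$ with respect to $E_v$. Otherwise choose, among the four layouts obtained by performing or not performing the subtree switches at $u_0$ and $v_0$, one with the fewest crossings. Add $i$ to $J$. 3. Return $(X,Y)$. The algorithm is implemented, with a fixed choice among equally good options, as a program for a random access machine with instructions for constants, adding or subtracting $1$, reading and writing memory cells, comparing and branching, and bounded loops. Each instruction and each pass through a loop takes one unit of time; space is the number of memory cells accessed. The input consists of $n$, the children of the internal vertices of $T$ and $S$ (vertices numbered with the leaves first, then the internal vertices in postorder), $\phi$, and the characteristic function of $I$. **Theorem.** There is a constant $C$ such that for every $n$, every tanglegram $(T,S,\phi)$ of size $n$, and every nonempty $I\subseteq[n]$ such that $(T_I,S_{\phi(I)},\phi|_I)$ is planar, IteratedInsertion outputs a layout of $(T,S,\phi)$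 that restricts to a planar layout of $(T_I,S_{\phi(I)},\phi|_I)$, in time at most $Cn^3$ and space at most $Cn^2$. If moreover $|I|\ge 2$ or $I=[n]$, then this layout has at most $$\frac{(n-|I|)\,(n+|I|-5)}{2}$$ crossings. -/

import Mathlib

namespace Tangle

/-! ### Rooted binary trees, tanglegrams, layouts -/

/-- Rooted binary trees with labelled leaves: every vertex is a leaf or has two children.
The two children are stored in some order; layouts are free to draw them in either order. -/
inductive BinTree (α : Type) where
  | leaf (a : α) : BinTree α
  | node (l r : BinTree α) : BinTree α

namespace BinTree

variable {α : Type}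

/-- The leaves, listed in the stored order. -/
def leaves : BinTree α → List α
  | leaf a => [a]
  | node l r => l.leaves ++ r.leaves

/-- The number of internal vertices. -/
def internals : BinTree α → ℕ
  | leaf _ => 0
  | node l r => l.internals + r.internals + 1

/-- `t.IsLeafOrder X`: the list `X` is the top-to-bottom order of the leaves in a plane drawing
of `t`, that is, at every internal vertex one of the two children is drawn above the other. -/
def IsLeafOrder : BinTree α → List α → Prop
  | leaf a, X => X = [a]
  | node l r, X => ∃ A B, l.IsLeafOrder A ∧ r.IsLeafOrder B ∧ (X = A ++ B ∨ X = B ++ A)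

/-- The subtree induced by the leaves with label in `p`: the minimal subtree containing them, with
all internal vertices having only one child suppressed (`none` if there is no such leaf). -/
def induce (p : α → Prop) [DecidablePred p] : BinTree α → Option (BinTree α)
  | leaf a => if p a then some (leaf a) else none
  | node l r =>
    match l.induce p, r.induce p with
    | some l', some r' => some (node l' r')
    | some l', none => some l'
    | none, some r' => some r'
    | none, none => none

theorem leaves_induce (p : α → Prop) [DecidablePred p] (t : BinTree α) :
    ((t.induce p).map leaves).getD [] = t.leaves.filter (fun a => decide (p a)) := by
  induction t with
  | leaf a => by_cases h : p a <;> simp [induce, leaves, h]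
  | node l r hl hr =>
    simp only [induce, leaves, List.filter_append, ← hl, ← hr]
    cases l.induce p <;> cases r.induce p <;> simp [leaves]

theorem induce_isSome (p : α → Prop) [DecidablePred p] (t : BinTree α)
    (h : ∃ a ∈ t.leaves, p a) : (t.induce p).isSome := by
  obtain ⟨a, ha, hp⟩ := h
  have hm : a ∈ ((t.induce p).map leaves).getD [] := by
    rw [leaves_induce]; simp [ha, hp]
  cases hc : t.induce p with
  | none => simp [hc] at hm
  | some _ => rfl

theorem leaves_get_induce (p : α → Prop) [DecidablePred p] (t : BinTree α)
    (h : (t.induce p).isSome) :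
    ((t.induce p).get h).leaves = t.leaves.filter (fun a => decide (p a)) := by
  rw [← leaves_induce]
  obtain ⟨t', ht'⟩ := Option.isSome_iff_exists.mp h
  simp [ht']

end BinTree

/-- A tanglegram whose leaves are indexed by a subset of `[n]` in each of the two trees: the leaf
`t_i` of `T` is joined to the leaf `s_{φ(i)}` of `S`, for every leaf `t_i` of `T`.
Only the restriction of `φ` to the leaves of `T` plays a role. -/
structure Tanglegram (n : ℕ) where
  T : BinTree (Fin n)
  S : BinTree (Fin n)
  φ : Equiv.Perm (Fin n)
  nodup_T : T.leaves.Nodup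
  nodup_S : S.leaves.Nodup
  matched : ∀ i, i ∈ T.leaves ↔ φ i ∈ S.leaves

namespace Tanglegram

variable {n : ℕ}

/-- All of `[n]` is used, that is, the tanglegram has size `n`. -/
def Full (G : Tanglegram n) : Prop := ∀ i, i ∈ G.T.leaves

/-- The subtanglegram `(T_I, S_{φ(I)}, φ|_I)` induced by a nonempty set `I ⊆ [n]`. -/
def induced (G : Tanglegram n) (hG : G.Full) (I : Finset (Fin n)) (hI : I.Nonempty) :
    Tanglegram n where
  T := (G.T.induce (fun i => i ∈ I)).get
    (BinTree.induce_isSome _ _ (hI.elim fun i hi => ⟨i, hG i, hi⟩))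
  S := (G.S.induce (fun j => j ∈ I.image G.φ)).get
    (BinTree.induce_isSome _ _ (hI.elim fun i hi =>
      ⟨G.φ i, (G.matched i).1 (hG i), Finset.mem_image_of_mem _ hi⟩))
  φ := G.φ
  nodup_T := by rw [BinTree.leaves_get_induce]; exact G.nodup_T.filter _
  nodup_S := by rw [BinTree.leaves_get_induce]; exact G.nodup_S.filter _
  matched := by
    intro i
    rw [BinTree.leaves_get_induce, BinTree.leaves_get_induce]
    simp [G.matched i]

/-- `(X, Y)` is a layout of the tanglegram (given by its pair of leaf orders). -/
def IsLayout (G : Tanglegram n) (X Y : List (Fin n)) : Prop :=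
  G.T.IsLeafOrder X ∧ G.S.IsLeafOrder Y

/-- The number of crossings of a layout: the number of pairs of between-tree edges such that
`t_i` is above `t_j` and `s_{φ(i)}` is below `s_{φ(j)}`. -/
def crossings (G : Tanglegram n) (X Y : List (Fin n)) : ℕ :=
  ((Finset.univ : Finset (Fin n × Fin n)).filter fun e =>
    e.1 ∈ G.T.leaves ∧ e.2 ∈ G.T.leaves ∧
      X.idxOf e.1 < X.idxOf e.2 ∧ Y.idxOf (G.φ e.2) < Y.idxOf (G.φ e.1)).card

/-- Planar layouts are those without crossings. -/
def IsPlanarLayout (G : Tanglegram n) (X Y : List (Fin n)) : Prop :=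
  G.IsLayout X Y ∧ G.crossings X Y = 0

/-- A tanglegram is planar if its crossing number is zero. -/
def IsPlanar (G : Tanglegram n) : Prop := ∃ X Y, G.IsPlanarLayout X Y

end Tanglegram

/-! ### The machine model: a successor RAM

Memory cells and registers hold natural numbers. The instructions are: load a constant, add or
subtract one, read or write a memory cell, compare two registers and branch, and run a loop a
number of times that is known on entry. Each instruction, and each pass through a loop, takes one
unit of time. As only successors are computed, the numbers that occur are at most the input numbers
and program constants plus the running time, so that the unit cost is realistic.

Programs are parametrised by the type `V` of register contents, which they cannot inspect except
by the instructions. -/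

/-- The two sides of a tanglegram. -/
inductive Side where
  | T
  | S
  deriving DecidableEq

/-- The opposite side. -/
def Side.other : Side → Side
  | .T => .S
  | .S => .T

/-- The names of the arrays in memory. A memory cell is given by a name and two indices. -/
inductive Arr where
  | size
  | child (σ : Side) (second : Bool)
  | phi
  | inI
  | verts
  | edge (σ : Side)
  | desc (σ : Side)
  | red (σ : Side)
  | adj
  | lay (σ : Side)
  | len (σ : Side)
  | tmp
  | mate (σ : Side)
  | inM
  | inJ
  | chain (σ : Side)
  | pos (σ : Side)
  deriving DecidableEq

/-- Programs that leave a result of type `α`. -/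
inductive Prog (V : Type) : Type → Type 1 where
  | ret {α : Type} (a : α) : Prog V α
  | bind {α β : Type} (p : Prog V α) (f : α → Prog V β) : Prog V β
  | const (k : ℕ) : Prog V V
  | succ (x : V) : Prog V V
  | pred (x : V) : Prog V V
  | read (a : Arr) (i j : V) : Prog V V
  | write (a : Arr) (i j x : V) : Prog V Unit
  | ifLt {α : Type} (x y : V) (p q : Prog V α) : Prog V α
  | ifEq {α : Type} (x y : V) (p q : Prog V α) : Prog V α
  /-- `acc := x; for k = 0, …, m - 1 do acc := body k acc` -/
  | loop (m x : V) (body : V → V → Prog V V) : Prog V V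

instance (V : Type) : Monad (Prog V) where
  pure := Prog.ret
  bind := Prog.bind

/-- Memory contents, number of steps executed so far, and the cells accessed so far. -/
structure State where
  mem : Arr → ℕ → ℕ → ℕ
  time : ℕ
  used : Finset (Arr × ℕ × ℕ)

namespace State

/-- One unit of time passes. -/
def tick (s : State) : State := { s with time := s.time + 1 }

/-- The cell `a[i][j]` is accessed. -/
def touch (s : State) (a : Arr) (i j : ℕ) : State :=
  { s with used := insert (a, i, j) s.used }

/-- The cell `a[i][j]` is overwritten by `x`. -/
def store (s : State) (a : Arr) (i j x : ℕ) : State :=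
  { s with mem := fun a' i' j' => if a' = a ∧ i' = i ∧ j' = j then x else s.mem a' i' j' }

/-- The space used is the number of memory cells that have been read or written. -/
def space (s : State) : ℕ := s.used.card

end State

/-- Execution of programs. -/
def Prog.run {α : Type} : Prog ℕ α → State → α × State
  | .ret a, s => (a, s)
  | .bind p f, s => (f (p.run s).1).run (p.run s).2
  | .const k, s => (k, s.tick)
  | .succ x, s => (x + 1, s.tick)
  | .pred x, s => (x - 1, s.tick)
  | .read a i j, s => (s.mem a i j, (s.touch a i j).tick)
  | .write a i j x, s => ((), ((s.touch a i j).store a i j x).tick)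
  | .ifLt x y p q, s => if x < y then p.run s.tick else q.run s.tick
  | .ifEq x y p q, s => if x = y then p.run s.tick else q.run s.tick
  | .loop m x body, s =>
    (List.range m).foldl (fun r k => (body k r.1).run r.2.tick) (x, s.tick)

/-! ### Basic subroutines -/

section Program

open Prog

variable {V : Type}

/-- Read `a[i][0]`. -/
def rd (a : Arr) (i : V) : Prog V V := do
  let z ← const 0
  read a i z

/-- Write `a[i][0] := x`. -/
def wr (a : Arr) (i x : V) : Prog V Unit := do
  let z ← const 0
  write a i z x

/-- Read the variable `a[0][0]`. -/
def rdVar (a : Arr) : Prog V V := do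
  let z ← const 0
  read a z z

/-- Write the variable `a[0][0] := x`. -/
def wrVar (a : Arr) (x : V) : Prog V Unit := do
  let z ← const 0
  write a z z x

/-- Do nothing. -/
def skip : Prog V Unit := ret ()

/-- If `x ≠ 0` then `p` else `q`. -/
def ifNZ {α : Type} (x : V) (p q : Prog V α) : Prog V α := do
  let z ← const 0
  ifEq x z q p

/-- For `k = 0, …, m - 1` do `body k`. -/
def forUp (m : V) (body : V → Prog V Unit) : Prog V Unit := do
  let z ← const 0
  let _ ← loop m z (fun k acc => do
    body k
    ret acc)
  skip

/-- For `k = m - 1, …, 0` do `body k`. -/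
def forDown (m : V) (body : V → Prog V Unit) : Prog V Unit := do
  let _ ← loop m m (fun _ acc => do
    let k ← pred acc
    body k
    ret k)
  skip

/-- The number of `k < m` for which the test `p k` returns a nonzero number. -/
def count (m : V) (p : V → Prog V V) : Prog V V := do
  let z ← const 0
  loop m z (fun k acc => do
    let b ← p k
    ifNZ b (succ acc) (ret acc))

/-- The last `k < m` for which the test `p k` returns a nonzero number; `d` if there is none. -/
def lastSuch (m d : V) (p : V → Prog V V) : Prog V V :=
  loop m d (fun k acc => do
    let b ← p k
    ifNZ b (ret k) (ret acc))

/-- Conjunction of tests; the second one is not evaluated if the first one fails. -/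
def both (p q : Prog V V) : Prog V V := do
  let b ← p
  ifNZ b q (const 0)

/-- Disjunction of tests. -/
def either (p q : Prog V V) : Prog V V := do
  let b ← p
  ifNZ b (const 1) q

/-- Negation of a test. -/
def negate (p : Prog V V) : Prog V V := do
  let b ← p
  ifNZ b (const 0) (const 1)

/-- The test `x < y`. -/
def testLt (x y : V) : Prog V V := ifLt x y (const 1) (const 0)

/-- The test `x = y`. -/
def testEq (x y : V) : Prog V V := ifEq x y (const 1) (const 0)

/-! ### Preparation

Vertices are numbered so that the leaf with index `i` has number `i`, internal vertices have the
numbers `n, n + 1, …, 2 n - 2`, and every vertex has a larger number than its descendants.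
The number `0`, that of a leaf, also serves as a mark for "no internal vertex". -/

/-- Test whether `x ≤_σ v`, that is, `x` is `v` or a descendant of `v`. -/
def leq (σ : Side) (x v : V) : Prog V V := read (.desc σ) v x

/-- Test whether `x <_σ v`. -/
def lt (σ : Side) (x v : V) : Prog V V := both (leq σ x v) (negate (testEq x v))

/-- Test whether `v` has a descendant leaf that is an endpoint of an edge in `J`. -/
def meetsJ (σ : Side) (v : V) : Prog V V := do
  let n ← rdVar .size
  count n (fun j => both (rd .inJ j) (do
    let x ← rd (.edge σ) j
    leq σ x v))

/-- Number of vertices, endpoints of the edges, the descendant relation; `J := I`. -/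
def prepare : Prog V Unit := do
  let n ← rdVar .size
  let z ← const 0
  let m ← loop n z (fun _ acc => do
    let a ← succ acc
    succ a)
  let m ← pred m
  wrVar .verts m
  forUp n (fun i => do
    wr (.edge .T) i i
    let j ← rd .phi i
    wr (.edge .S) i j
    let b ← rd .inI i
    wr .inJ i b)
  let side (σ : Side) : Prog V Unit :=
    forUp m (fun v => forUp m (fun x => do
      let b ← either (testEq x v) (do
        ifLt v n (const 0) (do
          let c₁ ← rd (.child σ false) v
          let c₂ ← rd (.child σ true) v
          either (leq σ x c₁) (leq σ x c₂)))
      write (.desc σ) v x b))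
  side .T
  side .S

/-- Construction of the induced trees `T_J` and `S_{φ(J)}`: their vertices are numbered as in `T`
and `S`, and `red v` is the root of the part of the induced tree that lies below `v`. The children
of `u` in the induced tree are the vertices `red c` for the children `c` of `u`. -/
def induceTrees : Prog V Unit := do
  let n ← rdVar .size
  let m ← rdVar .verts
  let side (σ : Side) : Prog V Unit :=
    forUp m (fun v => ifLt v n (wr (.red σ) v v) (do
      let c₁ ← rd (.child σ false) v
      let c₂ ← rd (.child σ true) v
      let b₁ ← meetsJ σ c₁
      let b₂ ← meetsJ σ c₂
      ifNZ b₁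
        (ifNZ b₂
          (wr (.red σ) v v)
          (do
            let x ← rd (.red σ) c₁
            wr (.red σ) v x))
        (do
          let x ← rd (.red σ) c₂
          wr (.red σ) v x)))
  side .T
  side .S

/-! ### Untangling a planar tanglegram -/

/-- The Boolean table `P`: the entry `(u, v)` is set if and only if some descendant of `u` is
matched with some descendant of `v` by an edge in `J`. -/
def boolTable : Prog V Unit := do
  let n ← rdVar .size
  let m ← rdVar .verts
  forUp n (fun i => do
    let b ← rd .inJ i
    let j ← rd .phi i
    write .adj i j b)
  forUp m (fun u => forUp m (fun v =>
    ifLt u n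
      (ifLt v n skip (do
        let c₁ ← rd (.child .S false) v
        let c₂ ← rd (.child .S true) v
        let b ← either (read .adj u c₁) (read .adj u c₂)
        write .adj u v b))
      (do
        let c₁ ← rd (.child .T false) u
        let c₂ ← rd (.child .T true) u
        let b ← either (read .adj c₁ v) (read .adj c₂ v)
        write .adj u v b)))

/-- Test whether `P[u, v]` holds, where `u` is on side `σ` and `v` on the opposite side. -/
def adjacent (σ : Side) (u v : V) : Prog V V :=
  match σ with
  | .T => read .adj u v
  | .S => read .adj v u

/-- The degree of the vertex `u` on side `σ` in the bipartite graph `(X, E, Y)`. The edges `E` of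
this graph are the pairs in `X × Y` for which `P` holds. -/
def degree (σ : Side) (u : V) : Prog V V := do
  let l ← rdVar (.len σ.other)
  count l (fun k => do
    let v ← rd (.lay σ.other) k
    adjacent σ u v)

/-- Replace the entry at position `p` in the list on side `σ` by the two entries `a, b`. -/
def splice (σ : Side) (p a b : V) : Prog V Unit := do
  let l ← rdVar (.len σ)
  let z ← const 0
  let l' ← loop l z (fun k c => do
    let x ← rd (.lay σ) k
    ifEq k p
      (do
        wr .tmp c a
        let c ← succ c
        wr .tmp c b
        succ c)
      (do
        wr .tmp c x
        succ c))
  forUp l' (fun k => do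
    let x ← rd .tmp k
    wr (.lay σ) k x)
  wrVar (.len σ) l'

/-- Replace the vertex at position `p` in the list on side `σ` by its two children in the induced
tree, in the order found from `P`. -/
def refine (σ : Side) (p : V) : Prog V Unit := do
  let u ← rd (.lay σ) p
  let c₁ ← rd (.child σ false) u
  let c₂ ← rd (.child σ true) u
  let u₁ ← rd (.red σ) c₁
  let u₂ ← rd (.red σ) c₂
  let l ← rdVar (.len σ.other)
  let z ← const 0
  let k ← lastSuch l z (fun j => do
    let b ← rd (.lay σ.other) j
    adjacent σ u₁ b)
  let bad ← count l (fun j => both (testLt j k) (do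
    let b ← rd (.lay σ.other) j
    adjacent σ u₂ b))
  ifNZ bad (splice σ p u₂ u₁) (splice σ p u₁ u₂)

/-- If the vertex `u` on side `σ` has degree one, with neighbour `v`, then record the pair
consisting of `u` and `v`. Recorded pairs are given by the arrays `mate`, and the set `M` of pairs
by the array `inM`, indexed by the vertex in `T`. -/
def recordPair (σ : Side) (u : V) : Prog V Unit := do
  let d ← degree σ u
  let one ← const 1
  ifEq d one
    (do
      let l ← rdVar (.len σ.other)
      let z ← const 0
      let k ← lastSuch l z (fun k => do
        let v ← rd (.lay σ.other) k
        adjacent σ u v)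
      let v ← rd (.lay σ.other) k
      wr (.mate σ) u v
      wr (.mate σ.other) v u
      match σ with
      | .T => wr .inM u one
      | .S => wr .inM v one)
    skip

/-- A position of an internal vertex of highest degree in the list on side `σ`; the length of the
list if it has no internal vertex. -/
def bestPosition (σ : Side) : Prog V V := do
  let n ← rdVar .size
  let l ← rdVar (.len σ)
  loop l l (fun k acc => do
    let x ← rd (.lay σ) k
    ifLt x n (ret acc)
      (ifEq acc l (ret k) (do
        let d ← degree σ x
        let y ← rd (.lay σ) acc
        let d' ← degree σ y
        ifLt d' d (ret k) (ret acc))))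

/-- The vertex at position `p` on side `σ` is refined, after recording it in a pair if it has
degree one. -/
def untangleAt (σ : Side) (p : V) : Prog V Unit := do
  let u ← rd (.lay σ) p
  recordPair σ u
  refine σ p

/-- One pass through the while loop of `ModifiedUntangle`: an internal vertex of highest degree is
refined. If there is no internal vertex, nothing happens. -/
def untangleStep : Prog V Unit := do
  let lT ← rdVar (.len .T)
  let lS ← rdVar (.len .S)
  let p ← bestPosition .T
  let q ← bestPosition .S
  ifLt p lT
    (ifLt q lS
      (do
        let u ← rd (.lay .T) p
        let v ← rd (.lay .S) q
        let d ← degree .T u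
        let e ← degree .S v
        ifLt d e (untangleAt .S q) (untangleAt .T p))
      (untangleAt .T p))
    (ifLt q lS (untangleAt .S q) skip)

/-- `ModifiedUntangle`, applied to the subtanglegram induced by `J`. It computes a layout of this
subtanglegram and puts all recorded pairs into `M`. The while loop is run for twice the number of
vertices, which is more often than there are internal vertices. -/
def modifiedUntangle : Prog V Unit := do
  induceTrees
  boolTable
  let m ← rdVar .verts
  let r ← pred m
  let z ← const 0
  let one ← const 1
  let x ← rd (.red .T) r
  let y ← rd (.red .S) r
  wr (.lay .T) z x
  wr (.lay .S) z y
  wrVar (.len .T) one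
  wrVar (.len .S) one
  forUp m (fun _ => do
    untangleStep
    untangleStep)

/-! ### Operations on layouts -/

/-- Flip at the vertex `u` on side `σ`: in the list on this side, the order of the entries
below `u` is reversed. -/
def flip (σ : Side) (u : V) : Prog V Unit := do
  let l ← rdVar (.len σ)
  let z ← const 0
  let c ← loop l z (fun k c => do
    let x ← rd (.lay σ) k
    let b ← leq σ x u
    ifNZ b
      (do
        wr .tmp c x
        succ c)
      (ret c))
  let _ ← loop l c (fun k c => do
    let x ← rd (.lay σ) k
    let b ← leq σ x u
    ifNZ b
      (do
        let c ← pred c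
        let y ← rd .tmp c
        wr (.lay σ) k y
        ret c)
      (ret c))
  skip

/-- Subtree switch at the internal vertex `u` on side `σ`: a flip at `u` and flips at its children
(a flip at a child below which the list has at most one leaf has no effect). -/
def subtreeSwitch (σ : Side) (u : V) : Prog V Unit := do
  flip σ u
  let c₁ ← rd (.child σ false) u
  let c₂ ← rd (.child σ true) u
  flip σ c₁
  flip σ c₂

/-- Paired flip at the vertex `v` on side `σ` and the vertex with which it forms a pair. -/
def pairedFlip (σ : Side) (v : V) : Prog V Unit := do
  flip σ v
  let u ← rd (.mate σ) v
  flip σ.other u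

/-- Compute the positions of the leaves in the current layout. -/
def findPositions : Prog V Unit := do
  let side (σ : Side) : Prog V Unit := do
    let l ← rdVar (.len σ)
    forUp l (fun k => do
      let x ← rd (.lay σ) k
      wr (.pos σ) x k)
  side .T
  side .S

/-- Test whether the edges `i` and `j` cross, given the positions. -/
def cross (i j : V) : Prog V V := do
  let t ← rd (.edge .T) i
  let t' ← rd (.edge .T) j
  let s ← rd (.edge .S) i
  let s' ← rd (.edge .S) j
  let a ← rd (.pos .T) t
  let a' ← rd (.pos .T) t'
  let b ← rd (.pos .S) s
  let b' ← rd (.pos .S) s'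
  either (both (testLt a a') (testLt b' b)) (both (testLt a' a) (testLt b b'))

/-- Test whether `j` is in the set of edges in `J` with an endpoint in `leaf(a) ∖ leaf(b)` on
side `σ`. The edge that is being inserted is not in `J`. -/
def inE (σ : Side) (a b j : V) : Prog V V :=
  both (rd .inJ j) (do
    let x ← rd (.edge σ) j
    both (leq σ x a) (negate (leq σ x b)))

/-- Test whether the edge `i` crosses more than half of the edges in `J` with an endpoint in
`leaf(a) ∖ leaf(b)` on side `σ`. -/
def crossesMost (i : V) (σ : Side) (a b : V) : Prog V V := do
  findPositions
  let n ← rdVar .size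
  let c ← count n (fun j => both (inE σ a b j) (cross i j))
  let d ← count n (fun j => both (inE σ a b j) (negate (cross i j)))
  testLt d c

/-- Twice the number of crossings of the current layout of the subtanglegram induced by
`J ∪ {i}`. -/
def countCrossings (i : V) : Prog V V := do
  findPositions
  let n ← rdVar .size
  let z ← const 0
  loop n z (fun j acc => loop n acc (fun k acc => do
    let b ← both (either (rd .inJ j) (testEq j i))
      (both (either (rd .inJ k) (testEq k i)) (cross j k))
    ifNZ b (succ acc) (ret acc)))

/-! ### Insertion of an edge

In the following, `i` is the edge to be inserted, and `u₀`, `v₀` are the parents of `t_i`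
and `s_{φ(i)}`; they are given by the function `w` on the set of sides. The array `chain T` holds
the set of the `u` with `(u, v) ∈ M_T`, and `chain S` that of the `v` with `(u, v) ∈ M_S`. These
sets are linearly ordered by `<_T` and `<_S`, which is the order of the numbers of the vertices. -/

/-- The greatest vertex in `chain σ`; `0` if there is none. -/
def topOfChain (σ : Side) : Prog V V := do
  let m ← rdVar .verts
  let z ← const 0
  lastSuch m z (fun v => rd (.chain σ) v)

/-- For the vertices `v` in `chain σ`, from the greatest one downwards: make a paired flip if the
edge `i` crosses more than half of the edges with an endpoint in `leaf(v) ∖ leaf(v')`, where `v'` is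
the next smaller vertex in the chain, or `v₀` if `v` is the smallest one. -/
def flipChain (i : V) (σ : Side) (v₀ : V) : Prog V Unit := do
  let m ← rdVar .verts
  forDown m (fun v => do
    let b ← rd (.chain σ) v
    ifNZ b
      (do
        let v' ← lastSuch v v₀ (fun x => rd (.chain σ) x)
        let b ← crossesMost i σ v v'
        ifNZ b (pairedFlip σ v) skip)
      skip)

/-- Make a subtree switch at `u` on side `σ` if the edge `i` crosses more than half of the edges with
an endpoint in `leaf(u) ∖ leaf(x)`. -/
def switchIf (i : V) (σ : Side) (u x : V) : Prog V Unit := do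
  let b ← crossesMost i σ u x
  ifNZ b (subtreeSwitch σ u) skip

/-- The case in which `chain σ` is not empty and the vertex `w` on the opposite side is
above the mate of the greatest vertex of `chain σ`. For `σ = S` this is the case
`u₀ >_T u_{Smax}`, for `σ = T` the case `v₀ >_S v_{Tmax}`. -/
def insertionCaseAbove (i : V) (w : Side → V) (σ : Side) : Prog V Unit := do
  let v ← topOfChain σ
  let u ← rd (.mate σ) v
  switchIf i σ.other (w σ.other) u
  flipChain i σ (w σ)
  let x ← rd (.edge σ) i
  switchIf i σ (w σ) x

/-- The remaining case. If the sets of edges `E(u₀)` and `E(v₀)` are not disjoint, then the four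
layouts obtained by subtree switches at `u₀` and `v₀` are tried, in the order
`(X, Y)`, `(X', Y)`, `(X', Y')`, `(X, Y')`, and one with the fewest crossings is selected. -/
def insertionCaseOther (i : V) (w : Side → V) : Prog V Unit := do
  flipChain i .T (w .T)
  flipChain i .S (w .S)
  let t ← rd (.edge .T) i
  let s ← rd (.edge .S) i
  let n ← rdVar .size
  let c ← count n (fun j => both (inE .T (w .T) t j) (inE .S (w .S) s j))
  ifNZ c
    (do
      let c₁ ← countCrossings i
      subtreeSwitch .T (w .T)
      let c₂ ← countCrossings i
      subtreeSwitch .S (w .S)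
      let c₃ ← countCrossings i
      subtreeSwitch .T (w .T)
      let c₄ ← countCrossings i
      let leMin (x y y' y'' : V) : Prog V V :=
        both (negate (testLt y x)) (both (negate (testLt y' x)) (negate (testLt y'' x)))
      let b₁ ← leMin c₁ c₂ c₃ c₄
      let b₂ ← leMin c₂ c₁ c₃ c₄
      let b₃ ← leMin c₃ c₁ c₂ c₄
      ifNZ b₁ (subtreeSwitch .S (w .S))
        (ifNZ b₂
          (do
            subtreeSwitch .T (w .T)
            subtreeSwitch .S (w .S))
          (ifNZ b₃ (subtreeSwitch .T (w .T)) skip)))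
    (do
      switchIf i .T (w .T) t
      switchIf i .S (w .S) s)

/-- The parent on side `σ` of the endpoint of the edge `i` in the tree induced by `J ∪ {i}`, namely
the lowest vertex above this endpoint that has an endpoint of an edge in `J` below it. -/
def findParent (σ : Side) (i : V) : Prog V V := do
  let m ← rdVar .verts
  let x ← rd (.edge σ) i
  let z ← const 0
  loop m z (fun v acc => ifNZ acc (ret acc) (do
    let b ← both (lt σ x v) (meetsJ σ v)
    ifNZ b (ret v) (ret acc)))

/-- Extend the list on side `σ` by the endpoint of the edge `i`, which is placed just above the
leaves below its sibling. -/
def extendLayout (σ : Side) (u i : V) : Prog V Unit := do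
  let l ← rdVar (.len σ)
  let x ← rd (.edge σ) i
  let p ← loop l l (fun k acc => ifLt acc l (ret acc) (do
    let y ← rd (.lay σ) k
    let b ← leq σ y u
    ifNZ b (ret k) (ret acc)))
  let y ← rd (.lay σ) p
  splice σ p x y

/-- The sets `M_T` of the pairs `(u, v)` in `M` with `u >_T t_i` and `v ≯_S s_{φ(i)}`, and `M_S` of
the pairs with `u ≯_T t_i` and `v >_S s_{φ(i)}`, are found and removed from `M`. -/
def selectPairs (i : V) : Prog V Unit := do
  let m ← rdVar .verts
  let t ← rd (.edge .T) i
  let s ← rd (.edge .S) i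
  let z ← const 0
  let one ← const 1
  forUp m (fun v => do
    wr (.chain .T) v z
    wr (.chain .S) v z)
  forUp m (fun u => do
    let b ← rd .inM u
    ifNZ b
      (do
        let v ← rd (.mate .T) u
        let a ← lt .T t u
        let b ← lt .S s v
        ifNZ a
          (ifNZ b skip (do
            wr (.chain .T) u one
            wr .inM u z))
          (ifNZ b
            (do
              wr (.chain .S) v one
              wr .inM u z)
            skip))
      skip)

/-- Test for the case treated by `insertionCaseAbove`. -/
def isCaseAbove (w : Side → V) (σ : Side) : Prog V V := do
  let v ← topOfChain σ
  ifNZ v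
    (do
      let u ← rd (.mate σ) v
      lt σ.other u (w σ.other))
    (const 0)

/-- One pass through the while loop of `IteratedInsertion`: insertion of the edge `i`. -/
def insertEdge (i : V) : Prog V Unit := do
  let u₀ ← findParent .T i
  let v₀ ← findParent .S i
  extendLayout .T u₀ i
  extendLayout .S v₀ i
  selectPairs i
  let w : Side → V := fun σ => match σ with
    | .T => u₀
    | .S => v₀
  let b ← isCaseAbove w .S
  let b' ← isCaseAbove w .T
  ifNZ b (insertionCaseAbove i w .S)
    (ifNZ b' (insertionCaseAbove i w .T)
      (insertionCaseOther i w))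
  let one ← const 1
  wr .inJ i one

/-- The algorithm `IteratedInsertion`. -/
def iteratedInsertion : Prog V Unit := do
  prepare
  modifiedUntangle
  let n ← rdVar .size
  forUp n (fun i => do
    let b ← rd .inJ i
    ifNZ b skip (insertEdge i))

end Program

/-! ### Input and output -/

namespace BinTree

variable {n : ℕ}

/-- The number of the root of the tree, when its internal vertices are numbered in postorder,
beginning with `k`, and each leaf has its index as number. -/
def rootNumber : BinTree (Fin n) → ℕ → ℕ
  | leaf i, _ => i
  | node l r, k => k + l.internals + r.internals

/-- The list of the pairs of children of the internal vertices, in postorder. -/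
def childPairs : BinTree (Fin n) → ℕ → List (ℕ × ℕ)
  | leaf _, _ => []
  | node l r, k => l.childPairs k ++ r.childPairs (k + l.internals) ++
      [(l.rootNumber k, r.rootNumber (k + l.internals))]

end BinTree

/-- The tree on a side of the tanglegram. -/
def Tanglegram.side {n : ℕ} (G : Tanglegram n) : Side → BinTree (Fin n)
  | .T => G.T
  | .S => G.S

/-- The initial state: memory holds the number `n`, the children of each internal
vertex of the two trees, the function `φ`, and the characteristic function of the set `I`. All other
cells are zero. -/
def inputState {n : ℕ} (G : Tanglegram n) (I : Finset (Fin n)) : State where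
  mem := fun a i j =>
    if j ≠ 0 then 0 else
    match a with
    | .size => if i = 0 then n else 0
    | .child σ false => if n ≤ i then (((G.side σ).childPairs n).getD (i - n) (0, 0)).1 else 0
    | .child σ true => if n ≤ i then (((G.side σ).childPairs n).getD (i - n) (0, 0)).2 else 0
    | .phi => if h : i < n then (G.φ ⟨i, h⟩ : ℕ) else 0
    | .inI => if h : i < n then (if (⟨i, h⟩ : Fin n) ∈ I then 1 else 0) else 0
    | _ => 0
  time := 0
  used := ∅

/-- The list that is stored on the given side when the machine stops. -/
def State.output (s : State) (σ : Side) : List ℕ :=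
  (List.range (s.mem (.len σ) 0 0)).map (fun k => s.mem (.lay σ) k 0)

/-- The final state of `IteratedInsertion` on the input `(T, S, φ)`, `I`. -/
def finalState {n : ℕ} (G : Tanglegram n) (I : Finset (Fin n)) : State :=
  (iteratedInsertion.run (inputState G I)).2

end Tangle

/-! The bound is the sum of |J| - 2 over |J| = |I|, …, n - 1. It therefore suffices that the
insertion of an edge i leaves all crossings among the edges in J unchanged and that i ends up not
crossing at least two edges in J. Both follow by treating every operation as a toggle. A flip at v
toggles exactly the crossings of pairs of edges that both end below v (`LState.tr_flip`). For a pair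
(u, v) with the same edges of J below u and v, and i below only one of them, the two flips cancel on
J, and i is toggled against the edges below that vertex (`LState.tr_pairedFlip`). A subtree switch
at the parent of an endpoint of i likewise only toggles i against the edges below this parent
(`LState.tr_subtreeSwitch`). An optimization with respect to a nonempty set leaves some edge of the
set uncrossed (`exists_not_cross`).

Two uncrossed edges are found as follows. In cases (a) and (b) the lowest vertex of the chain is
treated last in the chain and yields an uncrossed edge outside the leaves below the parent; the
final switch at the parent yields one inside and does not affect the other. In case (c) with
disjoint sets, each switch yields one. If the sets meet, a small case analysis shows that one of the
four layouts has two uncrossed edges (`exists_two_not_cross`); its last case needs that every edge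
of J has another edge of J that it does not cross. This is the invariant `Partnered`, which holds
initially if |I| ≥ 2 and is preserved.

Untangling is correct because there always is a planar order of the edges in I that is compatible
with both lists (`Refined`). If the order chosen for the children of u contradicts this planar
order, then u has degree one. As u has highest degree, its neighbour then carries the same edges as
u, and the planar order can be reversed on this common block (`exists_refined`). The same argument
shows that the two vertices of a recorded pair carry the same edges (`neighbour_of_deg_one`).

Layouts are handled as lists in which the leaves below each vertex are consecutive. This is
equivalent to being a leaf order (`BinTree.isLeafOrder_of_convex`) and is stable under flips because
leaf sets are laminar.

The program is verified in a weakest-precondition calculus that also counts time and confines all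
accessed indices below 2n; soundness is `wp_sound`. Finitely many two-dimensional arrays then give
quadratic space. The most expensive items are linearly many steps of quadratic cost, in the
untangling and in the insertions. -/

namespace Tangle

/-! ### Program logic for the machine: results, running time and accessed cells -/

/-- Memory contents. -/
abbrev Mem := Arr → ℕ → ℕ → ℕ

/-- Overwriting one memory cell. -/
def upd (m : Mem) (a : Arr) (i j x : ℕ) : Mem :=
  fun a' i' j' => if a' = a ∧ i' = i ∧ j' = j then x else m a' i' j'

@[simp] theorem upd_self (m : Mem) (a : Arr) (i j x : ℕ) : upd m a i j x a i j = x := by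
  simp [upd]

theorem upd_ne (m : Mem) {a b : Arr} (i j x : ℕ) (h : b ≠ a) : upd m a i j x b = m b := by
  funext i' j'; simp [upd, h]

theorem upd_zero (m : Mem) (a : Arr) (i k x : ℕ) :
    upd m a i 0 x a k 0 = if k = i then x else m a k 0 := by
  simp [upd]

/-- Weakest precondition: starting from memory `m` at time `t`, all accessed cells have indices
below `N`, and `Q` holds for the result, the memory and the time at the end. -/
def wp (N : ℕ) {α : Type} : Prog ℕ α → Mem → ℕ → (α → Mem → ℕ → Prop) → Prop
  | .ret a, m, t, Q => Q a m t
  | .bind p f, m, t, Q => wp N p m t (fun a m t => wp N (f a) m t Q)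
  | .const k, m, t, Q => Q k m (t + 1)
  | .succ x, m, t, Q => Q (x + 1) m (t + 1)
  | .pred x, m, t, Q => Q (x - 1) m (t + 1)
  | .read a i j, m, t, Q => i < N ∧ j < N ∧ Q (m a i j) m (t + 1)
  | .write a i j x, m, t, Q => i < N ∧ j < N ∧ Q () (upd m a i j x) (t + 1)
  | .ifLt x y p q, m, t, Q => if x < y then wp N p m (t + 1) Q else wp N q m (t + 1) Q
  | .ifEq x y p q, m, t, Q => if x = y then wp N p m (t + 1) Q else wp N q m (t + 1) Q
  | .loop k x body, m, t, Q =>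
    (List.range k).foldr
      (fun j (K : ℕ → Mem → ℕ → Prop) acc m t => wp N (body j acc) m (t + 1) K) Q x m (t + 1)

/-- The rules for straight-line programs. -/
theorem wps (N : ℕ) (m : Mem) (t : ℕ) :
    (∀ {α β : Type} (p : Prog ℕ α) (f : α → Prog ℕ β) (Q : β → Mem → ℕ → Prop),
      wp N (p >>= f) m t Q = wp N p m t (fun a m t => wp N (f a) m t Q)) ∧
    (∀ {α : Type} (a : α) (Q : α → Mem → ℕ → Prop), wp N (.ret a) m t Q = Q a m t) ∧
    (∀ Q : Unit → Mem → ℕ → Prop, wp N skip m t Q = Q () m t) ∧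
    (∀ k Q, wp N (.const k) m t Q = Q k m (t + 1)) ∧
    (∀ k Q, wp N (.succ k) m t Q = Q (k + 1) m (t + 1)) ∧
    (∀ k Q, wp N (.pred k) m t Q = Q (k - 1) m (t + 1)) ∧
    (∀ a i j Q, wp N (.read a i j) m t Q = (i < N ∧ j < N ∧ Q (m a i j) m (t + 1))) ∧
    (∀ a i j x Q, wp N (.write a i j x) m t Q =
      (i < N ∧ j < N ∧ Q () (upd m a i j x) (t + 1))) ∧
    (∀ {α : Type} (x y : ℕ) (p q : Prog ℕ α) Q, wp N (.ifLt x y p q) m t Q =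
      if x < y then wp N p m (t + 1) Q else wp N q m (t + 1) Q) ∧
    (∀ {α : Type} (x y : ℕ) (p q : Prog ℕ α) Q, wp N (.ifEq x y p q) m t Q =
      if x = y then wp N p m (t + 1) Q else wp N q m (t + 1) Q) ∧
    (∀ {α : Type} (x : ℕ) (p q : Prog ℕ α) Q, wp N (ifNZ x p q) m t Q =
      if x = 0 then wp N q m (t + 2) Q else wp N p m (t + 2) Q) ∧
    (∀ a i Q, wp N (rd a i) m t Q = (i < N ∧ 0 < N ∧ Q (m a i 0) m (t + 2))) ∧
    (∀ a i x Q, wp N (wr a i x) m t Q = (i < N ∧ 0 < N ∧ Q () (upd m a i 0 x) (t + 2))) ∧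
    (∀ a Q, wp N (rdVar a) m t Q = (0 < N ∧ 0 < N ∧ Q (m a 0 0) m (t + 2))) ∧
    (∀ a x Q, wp N (wrVar a x) m t Q = (0 < N ∧ 0 < N ∧ Q () (upd m a 0 0 x) (t + 2))) := by
  refine ⟨?_, ?_, ?_, ?_, ?_, ?_, ?_, ?_, ?_, ?_, ?_, ?_, ?_, ?_, ?_⟩ <;> intros <;> rfl

/-- All cells in `u` have indices below `N`. -/
def InBox (N : ℕ) (u : Finset (Arr × ℕ × ℕ)) : Prop := ∀ c ∈ u, c.2.1 < N ∧ c.2.2 < N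

theorem InBox.touch {N : ℕ} {s : State} (h : InBox N s.used) {a : Arr} {i j : ℕ} (hi : i < N)
    (hj : j < N) : InBox N (s.touch a i j).used := by
  intro c hc
  simp only [State.touch, Finset.mem_insert] at hc
  rcases hc with rfl | hc
  exacts [⟨hi, hj⟩, h c hc]

/-- The bridge from the calculus to the machine. In the loop case, the continuations nested by
`foldr` are consumed by the passes of the `foldl` one at a time, so an inner induction on the list
of passes suffices. -/
theorem wp_sound {N : ℕ} {α : Type} (p : Prog ℕ α) : ∀ (s : State) (Q : α → Mem → ℕ → Prop),
    InBox N s.used → wp N p s.mem s.time Q →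
    InBox N (p.run s).2.used ∧ Q (p.run s).1 (p.run s).2.mem (p.run s).2.time := by
  induction p with
  | ret a => intro s Q hu h; exact ⟨hu, h⟩
  | bind p f ihp ihf =>
    intro s Q hu h
    obtain ⟨h1, h2⟩ := ihp s _ hu h
    exact ihf _ _ _ h1 h2
  | const k => intro s Q hu h; exact ⟨hu, h⟩
  | succ k => intro s Q hu h; exact ⟨hu, h⟩
  | pred k => intro s Q hu h; exact ⟨hu, h⟩
  | read a i j => intro s Q hu h; exact ⟨hu.touch h.1 h.2.1, h.2.2⟩
  | write a i j x => intro s Q hu h; exact ⟨hu.touch h.1 h.2.1, h.2.2⟩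
  | ifLt x y p q ihp ihq =>
    intro s Q hu h
    simp only [wp, Prog.run] at h ⊢
    split_ifs at h ⊢
    exacts [ihp s.tick Q hu h, ihq s.tick Q hu h]
  | ifEq x y p q ihp ihq =>
    intro s Q hu h
    simp only [wp, Prog.run] at h ⊢
    split_ifs at h ⊢
    exacts [ihp s.tick Q hu h, ihq s.tick Q hu h]
  | loop k x body ih =>
    intro s Q hu h
    simp only [wp, Prog.run] at h ⊢
    generalize List.range k = l at h ⊢
    have key : ∀ (l : List ℕ) (acc : ℕ) (s' : State), InBox N s'.used →
        l.foldr (fun j (K : ℕ → Mem → ℕ → Prop) acc m t => wp N (body j acc) m (t + 1) K) Q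
          acc s'.mem s'.time →
        InBox N (l.foldl (fun (r : ℕ × State) k => (body k r.1).run r.2.tick) (acc, s')).2.used ∧
        Q (l.foldl (fun (r : ℕ × State) k => (body k r.1).run r.2.tick) (acc, s')).1
          (l.foldl (fun (r : ℕ × State) k => (body k r.1).run r.2.tick) (acc, s')).2.mem
          (l.foldl (fun (r : ℕ × State) k => (body k r.1).run r.2.tick) (acc, s')).2.time := by
      intro l
      induction l with
      | nil => intro acc s' hu' h'; exact ⟨hu', h'⟩
      | cons j l ihl =>
        intro acc s' hu' h'
        obtain ⟨h1, h2⟩ := ih j acc s'.tick _ hu' h'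
        exact ihl _ _ h1 h2
    exact key l x s.tick hu h

theorem wp_mono {N : ℕ} {α : Type} (p : Prog ℕ α) : ∀ {m : Mem} {t : ℕ}
    {Q Q' : α → Mem → ℕ → Prop}, wp N p m t Q → (∀ a m' t', Q a m' t' → Q' a m' t') →
    wp N p m t Q' := by
  induction p with
  | ret a => intro m t Q Q' h hQ; exact hQ _ _ _ h
  | bind p f ihp ihf =>
    intro m t Q Q' h hQ
    exact ihp h fun a m' t' h' => ihf a h' hQ
  | const k => intro m t Q Q' h hQ; exact hQ _ _ _ h
  | succ k => intro m t Q Q' h hQ; exact hQ _ _ _ h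
  | pred k => intro m t Q Q' h hQ; exact hQ _ _ _ h
  | read a i j => intro m t Q Q' h hQ; exact ⟨h.1, h.2.1, hQ _ _ _ h.2.2⟩
  | write a i j x => intro m t Q Q' h hQ; exact ⟨h.1, h.2.1, hQ _ _ _ h.2.2⟩
  | ifLt x y p q ihp ihq =>
    intro m t Q Q' h hQ
    simp only [wp] at h ⊢
    split_ifs at h ⊢
    exacts [ihp h hQ, ihq h hQ]
  | ifEq x y p q ihp ihq =>
    intro m t Q Q' h hQ
    simp only [wp] at h ⊢
    split_ifs at h ⊢
    exacts [ihp h hQ, ihq h hQ]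
  | loop k x body ih =>
    intro m t Q Q' h hQ
    simp only [wp] at h ⊢
    generalize List.range k = l at h ⊢
    generalize t + 1 = t at h ⊢
    induction l generalizing x m t with
    | nil => exact hQ _ _ _ h
    | cons j l ihl =>
      exact ih j x h fun a m' t' h' => ihl _ _ h'

/-- `Tr N p m c P`: started in memory `m`, the program `p` takes at most `c` steps, accesses only
cells with indices below `N`, and `P` holds for its result and the final memory. -/
def Tr (N : ℕ) {α : Type} (p : Prog ℕ α) (m : Mem) (c : ℕ) (P : α → Mem → Prop) : Prop :=
  ∀ t, wp N p m t (fun a m' t' => P a m' ∧ t' ≤ t + c)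

theorem Tr.use {N : ℕ} {α : Type} {p : Prog ℕ α} {m : Mem} {c : ℕ} {P : α → Mem → Prop}
    (h : Tr N p m c P) {t : ℕ} {Q : α → Mem → ℕ → Prop}
    (hQ : ∀ a m' t', P a m' → t' ≤ t + c → Q a m' t') : wp N p m t Q :=
  wp_mono p (h t) fun a m' t' h' => hQ a m' t' h'.1 h'.2

theorem Tr.mono {N : ℕ} {α : Type} {p : Prog ℕ α} {m : Mem} {c c' : ℕ} {P P' : α → Mem → Prop}
    (h : Tr N p m c P) (hc : c ≤ c') (hP : ∀ a m', P a m' → P' a m') : Tr N p m c' P' :=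
  fun _ => h.use fun a m' t' h' ht => ⟨hP a m' h', by omega⟩

/-- Entering the loop costs one unit, and each pass costs one unit besides its body. -/
theorem wp_loop {N k x c : ℕ} {body : ℕ → ℕ → Prog ℕ ℕ} {m : Mem} (Inv : ℕ → ℕ → Mem → Prop)
    (h0 : Inv 0 x m)
    (hs : ∀ j acc m', j < k → Inv j acc m' →
      Tr N (body j acc) m' c (fun acc' m'' => Inv (j + 1) acc' m'')) :
    Tr N (.loop k x body) m (k * (c + 1) + 1) (Inv k) := by
  intro t
  simp only [wp]
  -- Induction on the number d of passes that remain after j passes; `List.range'` lets the starting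
  -- index vary.
  have key : ∀ (d j acc : ℕ) (m' : Mem) (t' : ℕ), j + d = k → Inv j acc m' →
      t' ≤ t + 1 + j * (c + 1) →
      (List.range' j d).foldr
        (fun j (K : ℕ → Mem → ℕ → Prop) acc m t => wp N (body j acc) m (t + 1) K)
        (fun a m' t' => Inv k a m' ∧ t' ≤ t + (k * (c + 1) + 1)) acc m' t' := by
    intro d
    induction d with
    | zero =>
      intro j acc m' t' hj hI ht
      obtain rfl : j = k := by omega
      exact ⟨hI, by omega⟩
    | succ d ih =>
      intro j acc m' t' hj hI ht
      rw [List.range'_succ, List.foldr_cons]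
      refine (hs j acc m' (by omega) hI).use fun a m'' t'' h' ht' => ?_
      refine ih (j + 1) a m'' t'' (by omega) h' ?_
      rw [Nat.succ_mul]; omega
  rw [List.range_eq_range']
  exact key k 0 x m (t + 1) (by omega) h0 (by omega)

theorem tr_forUp {N k c : ℕ} {body : ℕ → Prog ℕ Unit} {m : Mem} (Inv : ℕ → Mem → Prop)
    (h0 : Inv 0 m)
    (hs : ∀ j m', j < k → Inv j m' → Tr N (body j) m' c (fun _ m'' => Inv (j + 1) m'')) :
    Tr N (forUp k body) m (k * (c + 1) + 2) (fun _ m' => Inv k m') := by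
  intro t
  simp only [forUp, wps]
  refine (wp_loop (c := c) (fun j _ m => Inv j m) h0 ?_).use ?_
  · intro j acc m' hj hI t
    simp only [wps]
    exact (hs j m' hj hI).use fun a m'' t' h' ht => ⟨h', ht⟩
  · intro a m' t' h ht
    exact ⟨h, by omega⟩

theorem tr_forDown {N k c : ℕ} {body : ℕ → Prog ℕ Unit} {m : Mem} (Inv : ℕ → Mem → Prop)
    (h0 : Inv k m)
    (hs : ∀ j m', j < k → Inv (j + 1) m' → Tr N (body j) m' c (fun _ m'' => Inv j m'')) :
    Tr N (forDown k body) m (k * (c + 2) + 1) (fun _ m' => Inv 0 m') := by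
  intro t
  simp only [forDown, wps]
  -- After j passes the accumulator is k - j. A pass first decrements it, so the body runs with the
  -- index k - j - 1.
  refine (wp_loop (c := c + 1) (fun j a m => a = k - j ∧ Inv (k - j) m) ⟨rfl, h0⟩ ?_).use ?_
  · rintro j acc m' hj ⟨rfl, hI⟩ t
    simp only [wps]
    have e : k - j = (k - j - 1) + 1 := by omega
    rw [e] at hI
    refine (hs _ m' (by omega) hI).use fun a m'' t' h' ht => ⟨⟨by omega, ?_⟩, by omega⟩
    rwa [show k - (j + 1) = k - j - 1 by omega]
  · rintro a m' t' ⟨rfl, h⟩ ht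
    exact ⟨by simpa using h, by omega⟩

/-- The program `p` leaves the memory unchanged, and its result is nonzero if and only if `P`. -/
def Test (N : ℕ) (p : Prog ℕ ℕ) (m : Mem) (c : ℕ) (P : Prop) : Prop :=
  Tr N p m c (fun a m' => m' = m ∧ (a ≠ 0 ↔ P))

theorem Test.congr {N : ℕ} {p : Prog ℕ ℕ} {m : Mem} {c c' : ℕ} {P P' : Prop}
    (h : Test N p m c P) (hc : c ≤ c') (hP : P ↔ P') : Test N p m c' P' :=
  Tr.mono h hc fun _ _ h' => ⟨h'.1, h'.2.trans hP⟩

/-- The second test need only behave well if the first succeeds. Conditions such as membership in J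
thus become available where the second test reads positions. -/
theorem Test.both {N : ℕ} {p q : Prog ℕ ℕ} {m : Mem} {c d : ℕ} {P R : Prop}
    (hp : Test N p m c P) (hq : P → Test N q m d R) :
    Test N (both p q) m (c + d + 3) (P ∧ R) := by
  intro t
  simp only [Tangle.both, wps]
  refine Tr.use hp ?_
  rintro a m' t' ⟨rfl, h⟩ ht
  split_ifs with h0
  · exact ⟨⟨rfl, by have := h.not.1 (by simpa using h0); simp [this]⟩, by omega⟩
  · refine Tr.use (hq (h.1 h0)) ?_
    rintro b m' t'' ⟨rfl, h'⟩ ht'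
    exact ⟨⟨rfl, by rw [h']; simp [h.1 h0]⟩, by omega⟩

theorem Test.either {N : ℕ} {p q : Prog ℕ ℕ} {m : Mem} {c d : ℕ} {P R : Prop}
    (hp : Test N p m c P) (hq : Test N q m d R) :
    Test N (either p q) m (c + d + 3) (P ∨ R) := by
  intro t
  simp only [Tangle.either, wps]
  refine Tr.use hp ?_
  rintro a m' t' ⟨rfl, h⟩ ht
  split_ifs with h0
  · refine Tr.use hq ?_
    rintro b m' t'' ⟨rfl, h'⟩ ht'
    exact ⟨⟨rfl, by have := h.not.1 (by simpa using h0); rw [h']; simp [this]⟩, by omega⟩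
  · exact ⟨⟨rfl, by simp [h.1 h0]⟩, by omega⟩

theorem Test.negate {N : ℕ} {p : Prog ℕ ℕ} {m : Mem} {c : ℕ} {P : Prop}
    (hp : Test N p m c P) : Test N (negate p) m (c + 3) (¬ P) := by
  intro t
  simp only [Tangle.negate, wps]
  refine Tr.use hp ?_
  rintro a m' t' ⟨rfl, h⟩ ht
  split_ifs with h0
  · exact ⟨⟨rfl, by have := h.not.1 (by simpa using h0); simp [this]⟩, by omega⟩
  · exact ⟨⟨rfl, by simp [h.1 h0]⟩, by omega⟩

theorem test_lt (N x y : ℕ) (m : Mem) : Test N (testLt x y) m 2 (x < y) := by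
  intro t
  simp only [testLt, wps]
  split_ifs with h <;> simp [h]

theorem test_eq (N x y : ℕ) (m : Mem) : Test N (testEq x y) m 2 (x = y) := by
  intro t
  simp only [testEq, wps]
  split_ifs with h <;> simp [h]

theorem test_read {N : ℕ} {a : Arr} {i j : ℕ} {m : Mem} (hi : i < N) (hj : j < N) :
    Test N (.read a i j) m 1 (m a i j ≠ 0) := by
  intro t
  simp [wps, hi, hj]

theorem test_rd {N : ℕ} {a : Arr} {i : ℕ} {m : Mem} (hi : i < N) :
    Test N (rd a i) m 2 (m a i 0 ≠ 0) := by
  intro t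
  simp [wps, hi]; omega

theorem tr_count {N k c : ℕ} {p : ℕ → Prog ℕ ℕ} {m : Mem} (P : ℕ → Prop) [DecidablePred P]
    (hp : ∀ j < k, Test N (p j) m c (P j)) :
    Tr N (count k p) m (k * (c + 4) + 2)
      (fun a m' => m' = m ∧ a = ((Finset.range k).filter P).card) := by
  intro t
  simp only [count, wps]
  refine (wp_loop (c := c + 3)
    (fun j a m' => m' = m ∧ a = ((Finset.range j).filter P).card) ⟨rfl, by simp⟩ ?_).use ?_
  · rintro j acc m' hj ⟨rfl, rfl⟩ t
    simp only [wps]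
    refine Tr.use (hp j hj) ?_
    rintro a m' t' ⟨rfl, h⟩ ht
    rw [Finset.range_add_one, Finset.filter_insert]
    split_ifs with h0 h1 h1
    · exact absurd h0 (h.2 h1)
    · exact ⟨⟨rfl, rfl⟩, by omega⟩
    · exact ⟨⟨rfl, by rw [Finset.card_insert_of_notMem (by simp)]⟩, by omega⟩
    · exact absurd (h.1 h0) h1
  · rintro a m' t' ⟨rfl, rfl⟩ ht
    exact ⟨⟨rfl, rfl⟩, by norm_num [add_assoc] at ht; omega⟩

theorem test_count {N k c : ℕ} {p : ℕ → Prog ℕ ℕ} {m : Mem} (P : ℕ → Prop)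
    (hp : ∀ j < k, Test N (p j) m c (P j)) :
    Test N (count k p) m (k * (c + 4) + 2) (∃ j < k, P j) := by
  classical
  refine Tr.mono (tr_count P hp) le_rfl ?_
  rintro a m' ⟨rfl, rfl⟩
  refine ⟨rfl, ?_⟩
  rw [Finset.card_ne_zero]
  simp [Finset.Nonempty]

theorem tr_lastSuch {N k c d : ℕ} {p : ℕ → Prog ℕ ℕ} {m : Mem} (P : ℕ → Prop)
    (hp : ∀ j < k, Test N (p j) m c (P j)) :
    Tr N (lastSuch k d p) m (k * (c + 3) + 1)
      (fun a m' => m' = m ∧ ((a = d ∧ ∀ j < k, ¬ P j) ∨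
        (a < k ∧ P a ∧ ∀ j < k, a < j → ¬ P j))) := by
  refine Tr.mono (wp_loop (c := c + 2)
    (fun i a m' => m' = m ∧ ((a = d ∧ ∀ j < i, ¬ P j) ∨
        (a < i ∧ P a ∧ ∀ j < i, a < j → ¬ P j))) ⟨rfl, by simp⟩ ?_) (by rw [add_assoc]) fun _ _ h => h
  rintro j acc m' hj ⟨rfl, hI⟩ t
  simp only [wps]
  refine Tr.use (hp j hj) ?_
  rintro a m' t' ⟨rfl, h⟩ ht
  split_ifs with h0
  · refine ⟨⟨rfl, ?_⟩, by omega⟩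
    have hj' : ¬ P j := h.not.1 (by simpa using h0)
    rcases hI with ⟨rfl, hI⟩ | ⟨h1, h2, hI⟩
    · refine Or.inl ⟨rfl, fun i hi => ?_⟩
      rcases Nat.lt_succ_iff_lt_or_eq.1 hi with hi | rfl
      exacts [hI i hi, hj']
    · refine Or.inr ⟨by omega, h2, fun i hi => ?_⟩
      rcases Nat.lt_succ_iff_lt_or_eq.1 hi with hi | rfl
      exacts [hI i hi, fun _ => hj']
  · exact ⟨⟨rfl, Or.inr ⟨by omega, h.1 h0, fun i hi hi' => by omega⟩⟩, by omega⟩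

end Tangle

/-! ### Pairs of trees with a matching, and the preparation phase -/

namespace Tangle

/-- Two rooted binary trees, given by the children `ch` of the internal vertices, and a
matching `f` of their leaves. The leaves are numbered `0, …, n - 1` and the internal vertices
`n, …, 2 n - 2`, and `L σ v` is the set of leaves below the vertex `v` on side `σ`. -/
structure TreePair where
  n : ℕ
  ch : Side → Bool → ℕ → ℕ
  L : Side → ℕ → Finset ℕ
  f : ℕ → ℕ
  pos : 1 ≤ n
  f_lt : ∀ i < n, f i < n
  f_inj : ∀ i < n, ∀ j < n, f i = f j → i = j
  ch_lt : ∀ σ b v, n ≤ v → v < 2 * n - 1 → ch σ b v < v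
  L_leaf : ∀ σ, ∀ v < n, L σ v = {v}
  L_node : ∀ σ v x, n ≤ v → v < 2 * n - 1 →
    (x ∈ L σ v ↔ x ∈ L σ (ch σ false v) ∨ x ∈ L σ (ch σ true v))
  disj : ∀ σ v x, n ≤ v → v < 2 * n - 1 → x ∈ L σ (ch σ false v) → x ∉ L σ (ch σ true v)
  lam : ∀ σ v v', v < v' → n ≤ v' → v' < 2 * n - 1 →
    (∃ b, L σ v ⊆ L σ (ch σ b v')) ∨ Disjoint (L σ v) (L σ v')
  root : ∀ σ, ∀ x < n, x ∈ L σ (2 * n - 2)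

namespace TreePair

variable (D : TreePair)

/-- The endpoint of the edge `i` on side `σ`. -/
def e : Side → ℕ → ℕ
  | .T, i => i
  | .S, i => D.f i

theorem e_lt {σ : Side} {i : ℕ} (h : i < D.n) : D.e σ i < D.n := by
  cases σ
  exacts [h, D.f_lt i h]

theorem e_inj {σ : Side} {i j : ℕ} (hi : i < D.n) (hj : j < D.n) (h : D.e σ i = D.e σ j) :
    i = j := by
  cases σ
  exacts [h, D.f_inj i hi j hj h]

end TreePair

/-- Memory has changed at most in the arrays from the list. -/
def Fr (l : List Arr) (m m' : Mem) : Prop := ∀ a, a ∉ l → m' a = m a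

theorem Fr.refl (l : List Arr) (m : Mem) : Fr l m m := fun _ _ => rfl

theorem Fr.trans {l : List Arr} {m m' m'' : Mem} (h : Fr l m m') (h' : Fr l m' m'') :
    Fr l m m'' := fun a ha => (h' a ha).trans (h a ha)

theorem Fr.mono {l l' : List Arr} {m m' : Mem} (h : Fr l m m') (hl : l ⊆ l') : Fr l' m m' :=
  fun a ha => h a fun h' => ha (hl h')

theorem Fr.upd {l : List Arr} {m m' : Mem} (h : Fr l m m') {a : Arr} {i j x : ℕ} (ha : a ∈ l) :
    Fr l m (upd m' a i j x) := fun b hb => by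
  rw [upd_ne _ _ _ _ (by rintro rfl; exact hb ha), h b hb]

/-- The arrays that are constant after the preparation. -/
def Arr.isStatic : Arr → Bool
  | .size | .verts | .child _ _ | .phi | .edge _ | .desc _ => true
  | _ => false

/-- The input of the algorithm is in memory. -/
structure Input (D : TreePair) (m : Mem) : Prop where
  size : m .size 0 0 = D.n
  child : ∀ σ b v, D.n ≤ v → v < 2 * D.n - 1 → m (.child σ b) v 0 = D.ch σ b v
  phi : ∀ i < D.n, m .phi i 0 = D.f i

theorem Input.frame {D : TreePair} {m m' : Mem} (h : Input D m) {l : List Arr} (hf : Fr l m m')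
    (hl : ∀ a ∈ l, a ≠ .size ∧ (∀ σ b, a ≠ .child σ b) ∧ a ≠ .phi) : Input D m' where
  size := by rw [hf _ fun h => (hl _ h).1 rfl, h.size]
  child σ b v := by rw [hf _ fun h => (hl _ h).2.1 _ _ rfl]; exact h.child σ b v
  phi i := by rw [hf _ fun h => (hl _ h).2.2 rfl]; exact h.phi i

/-- The results of the preparation are in memory. -/
structure Static (D : TreePair) (m : Mem) : Prop extends Input D m where
  verts : m .verts 0 0 = 2 * D.n - 1
  edge : ∀ σ, ∀ i < D.n, m (.edge σ) i 0 = D.e σ i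
  desc : ∀ σ v x, v < 2 * D.n - 1 → x < D.n → (m (.desc σ) v x ≠ 0 ↔ x ∈ D.L σ v)

theorem Static.frame {D : TreePair} {m m' : Mem} (h : Static D m) {l : List Arr}
    (hf : Fr l m m') (hl : ∀ a ∈ l, a.isStatic = false := by simp [Arr.isStatic]) :
    Static D m' := by
  have key : ∀ a, a.isStatic = true → m' a = m a := fun a ha =>
    hf a fun h' => by simp [hl a h'] at ha
  refine ⟨⟨?_, ?_, ?_⟩, ?_, ?_, ?_⟩
  · rw [key _ rfl, h.size]
  · intro σ b v; rw [key _ rfl]; exact h.child σ b v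
  · intro i; rw [key _ rfl]; exact h.phi i
  · rw [key _ rfl, h.verts]
  · intro σ i; rw [key _ rfl]; exact h.edge σ i
  · intro σ v x; rw [key _ rfl]; exact h.desc σ v x

/-- The array `inJ` describes the set `J`. -/
def InJ (D : TreePair) (m : Mem) (J : Finset ℕ) : Prop :=
  ∀ i < D.n, (m .inJ i 0 ≠ 0 ↔ i ∈ J)

theorem InJ.frame {D : TreePair} {m m' : Mem} {J : Finset ℕ} (h : InJ D m J) {l : List Arr}
    (hf : Fr l m m') (hl : .inJ ∉ l := by simp) : InJ D m' J := by
  unfold InJ; rw [hf _ hl]; exact h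

section Preparation

variable {D : TreePair}

/-- Children have smaller numbers than their parent, so the rows of the children are complete when
row v is filled. Only the columns of leaves are specified. -/
theorem tr_descTable (σ : Side) {m : Mem} (hi : Input D m) :
    Tr (2 * D.n) (forUp (2 * D.n - 1) (fun v => forUp (2 * D.n - 1) (fun x => do
      let b ← either (testEq x v) (do
        .ifLt v D.n (.const 0) (do
          let c₁ ← rd (.child σ false) v
          let c₂ ← rd (.child σ true) v
          either (leq σ x c₁) (leq σ x c₂)))
      .write (.desc σ) v x b))) m (100 * D.n ^ 2)
      (fun _ m' => Fr [.desc σ] m m' ∧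
        ∀ v x, v < 2 * D.n - 1 → x < D.n → (m' (.desc σ) v x ≠ 0 ↔ x ∈ D.L σ v)) := by
  have hn := D.pos
  refine Tr.mono (tr_forUp (c := 46 * D.n) (fun k m' => Fr [.desc σ] m m' ∧
    ∀ v x, v < k → x < D.n → (m' (.desc σ) v x ≠ 0 ↔ x ∈ D.L σ v)) ⟨Fr.refl _ _, by simp⟩ ?_)
    ?_ fun _ _ h => h
  · rintro v m₁ hv ⟨hf, hd⟩
    refine Tr.mono (tr_forUp (c := 20) (fun k m' => Fr [.desc σ] m m' ∧
      (∀ w x, w < v → x < D.n → (m' (.desc σ) w x ≠ 0 ↔ x ∈ D.L σ w)) ∧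
      (∀ x < k, x < D.n → (m' (.desc σ) v x ≠ 0 ↔ x ∈ D.L σ v))) ⟨hf, hd, by simp⟩ ?_) ?_ ?_
    · rintro x m₂ hx ⟨hf, hd, hk⟩ t
      have hi₂ : Input D m₂ := hi.frame hf (by simp)
      simp only [wps]
      refine Tr.use (Test.either (test_eq _ _ _ _) (d := 10)
        (R := D.n ≤ v ∧ (m₂ (.desc σ) (D.ch σ false v) x ≠ 0 ∨
          m₂ (.desc σ) (D.ch σ true v) x ≠ 0)) ?_) ?_
      · intro t
        simp only [wps]
        split_ifs with h1
        · exact ⟨⟨trivial, by simp; omega⟩, by omega⟩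
        · rw [hi₂.child σ _ v (by omega) hv, hi₂.child σ _ v (by omega) hv]
          have h2 := D.ch_lt σ false v (by omega) hv
          have h3 := D.ch_lt σ true v (by omega) hv
          refine ⟨by omega, by omega, by omega, by omega, ?_⟩
          refine Tr.use (Test.either (test_read (by omega) (by omega))
            (test_read (by omega) (by omega))) ?_
          rintro b m₃ t' ⟨rfl, hb⟩ ht
          exact ⟨⟨rfl, by rw [hb]; simp; omega⟩, by omega⟩
      · rintro b m₃ t' ⟨rfl, hb⟩ ht
        refine ⟨by omega, by omega, ⟨hf.upd (by simp), ?_, ?_⟩, by omega⟩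
        · intro w y hw hy
          have : w ≠ v := by omega
          simp only [upd, this, false_and, and_false, if_false]
          exact hd w y hw hy
        · intro y hy hy'
          by_cases hyx : y = x
          · subst hyx
            simp only [upd_self]
            rw [hb]
            by_cases h1 : v < D.n
            · rw [D.L_leaf σ v h1]; simp; omega
            · have h2 := D.ch_lt σ false v (by omega) hv
              have h3 := D.ch_lt σ true v (by omega) hv
              rw [D.L_node σ v y (by omega) hv, hd _ _ h2 hy', hd _ _ h3 hy']
              have : y ≠ v := by omega
              simp [this]; omega
          · simp only [upd, hyx, and_false, if_false]
            exact hk y (by omega) hy'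
    · omega
    · rintro _ m' ⟨h1, h2, h3⟩
      refine ⟨h1, fun w x hw hx => ?_⟩
      rcases Nat.lt_succ_iff_lt_or_eq.1 hw with hw | rfl
      exacts [h2 w x hw hx, h3 x (by omega) hx]
  · have : (2 * D.n - 1) * (46 * D.n + 1) ≤ 2 * D.n * (47 * D.n) := by gcongr <;> omega
    nlinarith

theorem tr_prepare {m : Mem} {I : Finset ℕ} (hi : Input D m)
    (hI : ∀ i < D.n, (m .inI i 0 ≠ 0 ↔ i ∈ I)) :
    Tr (2 * D.n) prepare m (300 * D.n ^ 2)
      (fun _ m' => Static D m' ∧ InJ D m' I ∧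
        Fr [.verts, .edge .T, .edge .S, .inJ, .desc .T, .desc .S] m m') := by
  intro t
  have hn := D.pos
  simp only [prepare, wps, hi.size]
  refine ⟨by omega, by omega, ?_⟩
  refine (wp_loop (c := 2) (fun k a m' => a = 2 * k ∧ m' = m) ⟨rfl, rfl⟩ ?_).use ?_
  · rintro j a m' hj ⟨rfl, rfl⟩ t
    simp only [wps]
    exact ⟨⟨by ring, trivial⟩, by omega⟩
  rintro a m₁ t₁ ⟨rfl, rfl⟩ ht₁
  refine ⟨by omega, by omega, ?_⟩
  have hi₁ : Input D (upd m₁ .verts 0 0 (2 * D.n - 1)) :=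
    hi.frame (Fr.upd (Fr.refl [.verts] _) (by simp)) (by simp)
  refine (tr_forUp (c := 12) (fun k m' =>
    Fr [.edge .T, .edge .S, .inJ] (upd m₁ .verts 0 0 (2 * D.n - 1)) m' ∧
    ∀ i < k, (∀ σ, m' (.edge σ) i 0 = D.e σ i) ∧ (m' .inJ i 0 ≠ 0 ↔ i ∈ I))
    ⟨Fr.refl _ _, by simp⟩ ?_).use ?_
  · rintro j m₂ hj ⟨hf, hk⟩ t
    have hi₂ := hi₁.frame hf (by simp)
    simp only [wps]
    refine ⟨by omega, by omega, by omega, by omega, by omega, by omega, by omega, by omega,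
      by omega, by omega, ⟨?_, ?_⟩, by omega⟩
    · exact ((hf.upd (by simp)).upd (by simp)).upd (by simp)
    · intro i hij
      constructor
      · intro σ
        by_cases hij' : i = j
        · subst hij'
          cases σ
          · simp [upd, TreePair.e]
          · simp [upd, TreePair.e, hi₂.phi i hj]
        · cases σ <;> simpa [upd, hij'] using (hk i (by omega)).1 _
      · by_cases hij' : i = j
        · subst hij'
          rw [upd_self, ← hI i hj]
          simp only [upd, reduceCtorEq, false_and, if_false]
          rw [hf _ (by simp)]
          simp [upd]
        · rw [← (hk i (by omega)).2]
          simp [upd, hij']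
  rintro _ m₂ t₂ ⟨hf₂, hk⟩ ht₂
  have hi₂ := hi₁.frame hf₂ (by simp)
  have hn2 : D.n ≤ D.n ^ 2 := Nat.le_self_pow (by simp) _
  refine (tr_descTable .T hi₂).use ?_
  rintro _ m₃ t₃ ⟨hf₃, hT⟩ ht₃
  have hi₃ := hi₂.frame hf₃ (by simp)
  refine (tr_descTable .S hi₃).use ?_
  rintro _ m₄ t₄ ⟨hf₄, hS⟩ ht₄
  have hi₄ := hi₃.frame hf₄ (by simp)
  refine ⟨⟨⟨hi₄, ?_, ?_, ?_⟩, ?_, ?_⟩, by omega⟩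
  · rw [hf₄ _ (by simp), hf₃ _ (by simp), hf₂ _ (by simp), upd_self]
  · intro σ i hi
    rw [hf₄ _ (by simp), hf₃ _ (by simp)]
    exact (hk i hi).1 σ
  · intro σ
    cases σ
    · rw [hf₄ _ (by simp)]; exact hT
    · exact hS
  · intro i hi
    rw [hf₄ _ (by simp), hf₃ _ (by simp)]
    exact (hk i hi).2
  · have hf₁ : Fr [.verts] m₁ (upd m₁ .verts 0 0 (2 * D.n - 1)) := (Fr.refl _ _).upd (by simp)
    exact (hf₁.mono (by simp)).trans ((hf₂.mono (by simp)).trans ((hf₃.mono (by simp)).trans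
      (hf₄.mono (by simp))))

end Preparation
end Tangle

/-! ### Induced trees and the table of joined vertices -/

namespace Tangle

namespace TreePair

variable (D : TreePair)

/-- The edges in `J` that have an endpoint below `v` on side `σ`. -/
def E (σ : Side) (J : Finset ℕ) (v : ℕ) : Finset ℕ := J.filter fun j => D.e σ j ∈ D.L σ v

theorem mem_E {σ : Side} {J : Finset ℕ} {v j : ℕ} :
    j ∈ D.E σ J v ↔ j ∈ J ∧ D.e σ j ∈ D.L σ v := by simp [E]

/-- Both children of the internal vertex `v` have a leaf below them that is an endpoint of an edge
in `J`. -/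
def Branching (σ : Side) (J : Finset ℕ) (v : ℕ) : Prop :=
  D.n ≤ v ∧ v < 2 * D.n - 1 ∧ ∀ b, (D.E σ J (D.ch σ b v)).Nonempty

/-- Some edge in `J` joins a leaf below `u` on side `T` to a leaf below `v` on side `S`. -/
def Joined (J : Finset ℕ) (u v : ℕ) : Prop := ∃ i ∈ J, D.e .T i ∈ D.L .T u ∧ D.e .S i ∈ D.L .S v

variable {D}

theorem E_node {σ : Side} {J : Finset ℕ} {v : ℕ} (h : D.n ≤ v) (h' : v < 2 * D.n - 1) :
    D.E σ J v = D.E σ J (D.ch σ false v) ∪ D.E σ J (D.ch σ true v) := by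
  ext j
  simp only [Finset.mem_union, mem_E, D.L_node σ v _ h h']
  tauto

theorem ch_lt' {σ : Side} {b : Bool} {v : ℕ} (h : D.n ≤ v) (h' : v < 2 * D.n - 1) :
    D.ch σ b v < 2 * D.n - 1 := (D.ch_lt σ b v h h').trans h'

end TreePair

open TreePair

variable {D : TreePair} {m : Mem} {J : Finset ℕ}

theorem test_leq (hm : Static D m) {σ : Side} {x v : ℕ} (hv : v < 2 * D.n - 1)
    (hx : x < D.n) : Test (2 * D.n) (leq σ x v) m 1 (x ∈ D.L σ v) :=
  Test.congr (test_read (by omega) (by omega)) le_rfl (hm.desc σ v x hv hx)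

theorem test_meetsJ (hm : Static D m) (hJ : InJ D m J) (hJn : ∀ j ∈ J, j < D.n) {σ : Side}
    {v : ℕ} (hv : v < 2 * D.n - 1) :
    Test (2 * D.n) (meetsJ σ v) m (16 * D.n) (D.E σ J v).Nonempty := by
  intro t
  have hn := D.pos
  simp only [meetsJ, wps, hm.size]
  refine ⟨by omega, by omega, ?_⟩
  refine Tr.use (test_count (c := 8) (fun j => j ∈ J ∧ D.e σ j ∈ D.L σ v) ?_) ?_
  · intro j hj
    refine (Test.both (c := 2) (d := 3) ((test_rd (by omega)).congr le_rfl (hJ j hj)) ?_)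
    intro _ t
    simp only [wps, hm.edge σ j hj]
    refine ⟨by omega, by omega, ?_⟩
    refine Tr.use (test_leq hm hv (D.e_lt hj)) ?_
    rintro a m' t' ⟨rfl, h⟩ ht
    exact ⟨⟨rfl, h⟩, by omega⟩
  · rintro a m' t' ⟨rfl, h⟩ ht
    refine ⟨⟨rfl, h.trans ?_⟩, by omega⟩
    simp only [Finset.Nonempty, mem_E]
    exact ⟨fun ⟨j, _, h⟩ => ⟨j, h⟩, fun ⟨j, h⟩ => ⟨j, hJn j h.1, h⟩⟩

/-- The array `red` is correct for all vertices below `k` on side `σ`. -/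
def RedOk (D : TreePair) (m : Mem) (J : Finset ℕ) (σ : Side) (k : ℕ) : Prop :=
  ∀ v < k, m (.red σ) v 0 ≤ v ∧ ((D.E σ J v).Nonempty →
    D.E σ J (m (.red σ) v 0) = D.E σ J v ∧
      (m (.red σ) v 0 < D.n ∨ D.Branching σ J (m (.red σ) v 0)))

theorem RedOk.step {σ : Side} {v x : ℕ} (h : RedOk D m J σ v) (hx : x ≤ v)
    (h' : (D.E σ J v).Nonempty →
      D.E σ J x = D.E σ J v ∧ (x < D.n ∨ D.Branching σ J x)) :
    RedOk D (upd m (.red σ) v 0 x) J σ (v + 1) := by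
  intro w hw
  by_cases hwv : w = v
  · subst hwv; simpa using ⟨hx, h'⟩
  · simpa [upd_zero, hwv] using h w (by omega)

theorem RedOk.frame {m' : Mem} {σ : Side} {k : ℕ} (h : RedOk D m J σ k) {l : List Arr}
    (hf : Fr l m m') (hl : .red σ ∉ l := by simp) : RedOk D m' J σ k := by
  unfold RedOk; rw [hf _ hl]; exact h

/-- Either both children of v meet J and v is branching, or the edges below v all lie below one
child, whose entry is already correct. If no child meets J, only the bound by v survives, which
keeps later accesses within memory. -/
theorem tr_redTable (σ : Side) (hm : Static D m) (hJ : InJ D m J) (hJn : ∀ j ∈ J, j < D.n) :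
    Tr (2 * D.n) (forUp (2 * D.n - 1) (fun v => .ifLt v D.n (wr (.red σ) v v) (do
      let c₁ ← rd (.child σ false) v
      let c₂ ← rd (.child σ true) v
      let b₁ ← meetsJ σ c₁
      let b₂ ← meetsJ σ c₂
      ifNZ b₁
        (ifNZ b₂
          (wr (.red σ) v v)
          (do
            let x ← rd (.red σ) c₁
            wr (.red σ) v x))
        (do
          let x ← rd (.red σ) c₂
          wr (.red σ) v x)))) m (100 * D.n ^ 2)
      (fun _ m' => Fr [.red σ] m m' ∧ RedOk D m' J σ (2 * D.n - 1)) := by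
  have hn := D.pos
  refine Tr.mono (tr_forUp (c := 46 * D.n)
    (fun k m' => Fr [.red σ] m m' ∧ RedOk D m' J σ k)
    ⟨Fr.refl _ _, fun v hv => by omega⟩ ?_) ?_ fun _ _ h => h
  · rintro v m₁ hv ⟨hf, hr⟩ t
    have hm₁ := hm.frame hf
    have hJ₁ := hJ.frame hf
    simp only [wps]
    split_ifs with h
    · exact ⟨by omega, by omega, ⟨hf.upd (by simp), hr.step le_rfl fun _ => ⟨rfl, Or.inl h⟩⟩,
        by omega⟩
    · have hnv : D.n ≤ v := by omega
      rw [hm₁.child σ _ v hnv hv, hm₁.child σ _ v hnv hv]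
      have h1 := D.ch_lt σ false v hnv hv
      have h2 := D.ch_lt σ true v hnv hv
      refine ⟨by omega, by omega, by omega, by omega, ?_⟩
      refine Tr.use (test_meetsJ hm₁ hJ₁ hJn (ch_lt' hnv hv)) ?_
      rintro b₁ m₂ t' ⟨rfl, hb₁⟩ ht'
      refine Tr.use (test_meetsJ hm₁ hJ₁ hJn (ch_lt' hnv hv)) ?_
      rintro b₂ m₃ t'' ⟨rfl, hb₂⟩ ht''
      -- A child without edges in J can be dropped: the other child carries the same edges as v.
      have key : ∀ b c, D.E σ J (D.ch σ c v) = ∅ →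
          D.E σ J v = D.E σ J (D.ch σ b v) ∪ D.E σ J (D.ch σ c v) →
          (D.E σ J v).Nonempty → D.E σ J (m₃ (.red σ) (D.ch σ b v) 0) = D.E σ J v ∧
          (m₃ (.red σ) (D.ch σ b v) 0 < D.n ∨
            D.Branching σ J (m₃ (.red σ) (D.ch σ b v) 0)) := by
        intro b c hc hE hne
        rw [hc, Finset.union_empty] at hE
        rw [hE] at hne ⊢
        exact (hr _ (D.ch_lt σ b v hnv hv)).2 hne
      have hE := E_node (σ := σ) (J := J) hnv hv
      split_ifs with h3 h4
      · refine ⟨by omega, by omega, by omega, by omega, ⟨hf.upd (by simp), hr.step ?_ ?_⟩,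
          by omega⟩
        · exact (hr _ h2).1.trans h2.le
        · refine key true false ?_ (by rw [hE, Finset.union_comm])
          exact Finset.not_nonempty_iff_eq_empty.1 (hb₁.not.1 (by simpa using h3))
      · refine ⟨by omega, by omega, by omega, by omega, ⟨hf.upd (by simp), hr.step ?_ ?_⟩,
          by omega⟩
        · exact (hr _ h1).1.trans h1.le
        · refine key false true ?_ hE
          exact Finset.not_nonempty_iff_eq_empty.1 (hb₂.not.1 (by simpa using h4))
      · refine ⟨by omega, by omega, ⟨hf.upd (by simp), hr.step le_rfl ?_⟩, by omega⟩
        exact fun _ => ⟨rfl, Or.inr ⟨hnv, hv, fun b => by cases b; exacts [hb₁.1 h3, hb₂.1 h4]⟩⟩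
  · have : (2 * D.n - 1) * (46 * D.n + 1) ≤ 2 * D.n * (47 * D.n) := by gcongr <;> omega
    nlinarith

theorem tr_induceTrees (hm : Static D m) (hJ : InJ D m J) (hJn : ∀ j ∈ J, j < D.n) :
    Tr (2 * D.n) induceTrees m (250 * D.n ^ 2)
      (fun _ m' => Fr [.red .T, .red .S] m m' ∧ ∀ σ, RedOk D m' J σ (2 * D.n - 1)) := by
  intro t
  have hn := D.pos
  have hn2 : D.n ≤ D.n ^ 2 := Nat.le_self_pow (by simp) _
  simp only [induceTrees, wps, hm.size, hm.verts]
  refine ⟨by omega, by omega, by omega, by omega, ?_⟩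
  refine (tr_redTable .T hm hJ hJn).use ?_
  rintro _ m₁ t₁ ⟨hf₁, hT⟩ ht₁
  refine (tr_redTable .S (hm.frame hf₁) (hJ.frame hf₁) hJn).use ?_
  rintro _ m₂ t₂ ⟨hf₂, hS⟩ ht₂
  refine ⟨⟨(hf₁.mono (by simp)).trans (hf₂.mono (by simp)), fun σ => ?_⟩, by omega⟩
  cases σ
  exacts [hT.frame hf₂, hS]

/-- The array `adj` is correct for the vertices `u` and `v`. -/
def AdjOk (D : TreePair) (m : Mem) (J : Finset ℕ) (u v : ℕ) : Prop :=
  m .adj u v ≠ 0 ↔ D.Joined J u v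

theorem joined_left {u v : ℕ} (h : D.n ≤ u) (h' : u < 2 * D.n - 1) :
    D.Joined J u v ↔ D.Joined J (D.ch .T false u) v ∨ D.Joined J (D.ch .T true u) v := by
  simp only [TreePair.Joined, ← exists_or]
  refine exists_congr fun i => ?_
  rw [D.L_node .T u _ h h']
  tauto

theorem joined_right {u v : ℕ} (h : D.n ≤ v) (h' : v < 2 * D.n - 1) :
    D.Joined J u v ↔ D.Joined J u (D.ch .S false v) ∨ D.Joined J u (D.ch .S true v) := by
  simp only [TreePair.Joined, ← exists_or]
  refine exists_congr fun i => ?_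
  rw [D.L_node .S v _ h h']
  tauto

theorem joined_leaf {u v : ℕ} (h : u < D.n) (h' : v < D.n) :
    D.Joined J u v ↔ u ∈ J ∧ D.f u = v := by
  simp only [TreePair.Joined, D.L_leaf _ _ h, D.L_leaf _ _ h', e, Finset.mem_singleton]
  constructor
  · rintro ⟨i, hi, rfl, rfl⟩; exact ⟨hi, rfl⟩
  · rintro ⟨hi, rfl⟩; exact ⟨u, hi, rfl, rfl⟩

/-- An entry with internal u comes from earlier rows, one with a leaf u and internal v from earlier
columns. The table has to be zero at the beginning, since among pairs of leaves only the matched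
ones are written. -/
theorem tr_boolTable (hm : Static D m) (hJ : InJ D m J) (h0 : ∀ u v, m .adj u v = 0) :
    Tr (2 * D.n) boolTable m (200 * D.n ^ 2)
      (fun _ m' => Fr [.adj] m m' ∧
        ∀ u v, u < 2 * D.n - 1 → v < 2 * D.n - 1 → AdjOk D m' J u v) := by
  intro t
  have hn := D.pos
  have hn2 : D.n ≤ D.n ^ 2 := Nat.le_self_pow (by simp) _
  simp only [boolTable, wps, hm.size, hm.verts]
  refine ⟨by omega, by omega, by omega, by omega, ?_⟩
  refine (tr_forUp (c := 5) (fun k m' => Fr [.adj] m m' ∧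
    ∀ u v, (m' .adj u v ≠ 0 ↔ u < k ∧ u ∈ J ∧ D.f u = v)) ⟨Fr.refl _ _, by simp [h0]⟩ ?_).use ?_
  · rintro i m₁ hi ⟨hf, hk⟩ t
    have hm₁ := hm.frame hf
    have := D.f_lt i hi
    simp only [wps, hm₁.phi i hi]
    refine ⟨by omega, by omega, by omega, by omega, by omega, by omega,
      ⟨hf.upd (by simp), fun u v => ?_⟩, by omega⟩
    by_cases huv : u = i ∧ v = D.f i
    · obtain ⟨rfl, rfl⟩ := huv
      rw [upd_self, (hJ.frame hf :) u hi]; simp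
    · have h1 : ¬ (u = i ∧ D.f u = v) := by rintro ⟨rfl, rfl⟩; simp at huv
      simp only [upd, huv, and_false, if_false, hk]
      constructor
      · rintro ⟨h1, h2⟩; exact ⟨by omega, h2⟩
      · rintro ⟨h2, h3⟩
        exact ⟨by rcases Nat.lt_succ_iff_lt_or_eq.1 h2 with h | h; exacts [h, absurd ⟨h, h3.2⟩ h1],
          h3⟩
  rintro _ m₁ t₁ ⟨hf₁, hl⟩ ht₁
  have hl' : ∀ u v, u < D.n → v < D.n → AdjOk D m₁ J u v := fun u v hu hv => by
    rw [AdjOk, hl, joined_leaf hu hv]; simp [hu]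
  -- Writing one correct entry enlarges the region P of correct entries by that cell.
  have step : ∀ {m' : Mem} {u v x : ℕ} {P : ℕ → ℕ → Prop},
      (∀ u' v', u' < 2 * D.n - 1 → v' < 2 * D.n - 1 → P u' v' → AdjOk D m' J u' v') →
      (x ≠ 0 ↔ D.Joined J u v) →
      ∀ u' v', u' < 2 * D.n - 1 → v' < 2 * D.n - 1 → (P u' v' ∨ u' = u ∧ v' = v) →
        AdjOk D (upd m' .adj u v x) J u' v' := by
    intro m' u v x P h hx u' v' hu hv h'
    by_cases huv : u' = u ∧ v' = v
    · obtain ⟨rfl, rfl⟩ := huv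
      rwa [AdjOk, upd_self]
    · simp only [AdjOk, upd, huv, and_false, if_false]
      exact h u' v' hu hv (h'.resolve_right huv)
  refine (tr_forUp (c := 40 * D.n) (fun k m' => Fr [.adj] m m' ∧
    ∀ u v, u < 2 * D.n - 1 → v < 2 * D.n - 1 → (u < k ∨ u < D.n ∧ v < D.n) → AdjOk D m' J u v)
    ⟨hf₁, fun u v _ _ h => hl' u v (by omega) (by omega)⟩ ?_).use ?_
  · rintro u m₂ hu ⟨hf₂, hk⟩
    refine Tr.mono (tr_forUp (c := 15) (fun k m' => Fr [.adj] m m' ∧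
      ∀ u' v', u' < 2 * D.n - 1 → v' < 2 * D.n - 1 →
        ((u' < u ∨ u' < D.n ∧ v' < D.n) ∨ u' = u ∧ v' < k) → AdjOk D m' J u' v')
      ⟨hf₂, fun u' v' hu hv h => hk u' v' hu hv (by omega)⟩ ?_) ?_ ?_
    · rintro v m₃ hv ⟨hf₃, hk₃⟩ t
      have hm₃ := hm.frame hf₃
      simp only [wps]
      split_ifs with h1 h2
      · exact ⟨⟨hf₃, fun u' v' hu hv h => hk₃ u' v' hu hv (by omega)⟩, by omega⟩
      · have h2' : D.n ≤ v := by omega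
        have hc := D.ch_lt .S false v h2' hv
        have hc' := D.ch_lt .S true v h2' hv
        rw [hm₃.child .S _ v h2' hv, hm₃.child .S _ v h2' hv]
        refine ⟨by omega, by omega, by omega, by omega, ?_⟩
        refine Tr.use (Test.either (test_read (by omega) (by omega))
          (test_read (by omega) (by omega))) ?_
        rintro b m₄ t' ⟨rfl, hb⟩ ht
        refine ⟨by omega, by omega, ⟨hf₃.upd (by simp), fun u' v' hu' hv' h => ?_⟩, by omega⟩
        refine step hk₃ ?_ u' v' hu' hv' (by omega)
        have e₁ : AdjOk D m₄ J u (D.ch .S false v) := hk₃ _ _ hu (ch_lt' h2' hv) (by omega)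
        have e₂ : AdjOk D m₄ J u (D.ch .S true v) := hk₃ _ _ hu (ch_lt' h2' hv) (by omega)
        rw [hb, joined_right h2' hv]; exact or_congr e₁ e₂
      · have h2' : D.n ≤ u := by omega
        have hc := D.ch_lt .T false u h2' hu
        have hc' := D.ch_lt .T true u h2' hu
        rw [hm₃.child .T _ u h2' hu, hm₃.child .T _ u h2' hu]
        refine ⟨by omega, by omega, by omega, by omega, ?_⟩
        refine Tr.use (Test.either (test_read (by omega) (by omega))
          (test_read (by omega) (by omega))) ?_
        rintro b m₄ t' ⟨rfl, hb⟩ ht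
        refine ⟨by omega, by omega, ⟨hf₃.upd (by simp), fun u' v' hu' hv' h => ?_⟩, by omega⟩
        refine step hk₃ ?_ u' v' hu' hv' (by omega)
        have e₁ : AdjOk D m₄ J (D.ch .T false u) v := hk₃ _ _ (ch_lt' h2' hu) hv (by omega)
        have e₂ : AdjOk D m₄ J (D.ch .T true u) v := hk₃ _ _ (ch_lt' h2' hu) hv (by omega)
        rw [hb, joined_left h2' hu]; exact or_congr e₁ e₂
    · omega
    · rintro _ m' ⟨h1, h2⟩
      exact ⟨h1, fun u' v' hu hv h => h2 u' v' hu hv (by omega)⟩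
  · rintro _ m' t' ⟨h1, h2⟩ ht
    refine ⟨⟨h1, fun u v hu hv => h2 u v hu hv (by omega)⟩, ?_⟩
    have : (2 * D.n - 1) * (40 * D.n + 1) ≤ 2 * D.n * (41 * D.n) := by gcongr <;> omega
    nlinarith

end Tangle

namespace Tangle

/-! ### Orders given by lists -/

theorem idxOf_lt_of_append {A B : List ℕ} {a b : ℕ} (h : (A ++ B).Nodup) (ha : a ∈ A)
    (hb : b ∈ B) : (A ++ B).idxOf a < (A ++ B).idxOf b := by
  have hb' : b ∉ A := fun h' => (List.nodup_append.1 h).2.2 b h' b hb rfl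
  rw [List.idxOf_append, List.idxOf_append, if_pos ha, if_neg hb']
  have := List.idxOf_lt_length_of_mem ha
  omega

theorem idxOf_reverse {X : List ℕ} (h : X.Nodup) {a : ℕ} (ha : a ∈ X) :
    X.reverse.idxOf a + X.idxOf a + 1 = X.length := by
  induction X with
  | nil => simp at ha
  | cons x X ih =>
    rw [List.nodup_cons] at h
    rw [List.reverse_cons, List.idxOf_append]
    by_cases hax : a = x
    · subst hax
      simp [h.1]
    · have ha' : a ∈ X := by simpa [hax] using ha
      rw [if_pos (by simpa using ha'), List.idxOf_cons_ne _ (Ne.symm hax), List.length_cons,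
        ← ih h.2 ha', Nat.succ_eq_add_one]
      ring

/-- The elements of `S` are consecutive in `X`. -/
def Convex (X : List ℕ) (S : Finset ℕ) : Prop :=
  ∀ a ∈ X, ∀ b ∈ X, ∀ c ∈ X, X.idxOf a < X.idxOf b → X.idxOf b < X.idxOf c →
    a ∈ S → c ∈ S → b ∈ S

/-- Cut the list at the first member of S, and then at the first later non-member; a member beyond
the second cut would violate convexity. -/
theorem Convex.split {X : List ℕ} {S : Finset ℕ} (h : Convex X S) (hX : X.Nodup) :
    ∃ A B C, X = A ++ B ++ C ∧ (∀ a ∈ A, a ∉ S) ∧ (∀ b ∈ B, b ∈ S) ∧ ∀ c ∈ C, c ∉ S := by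
  have aux : ∀ (p : ℕ → Prop) [DecidablePred p] (X : List ℕ), ∃ A R, X = A ++ R ∧
      (∀ a ∈ A, p a) ∧ (R = [] ∨ ∃ c R', R = c :: R' ∧ ¬ p c) := by
    intro p _ X
    induction X with
    | nil => exact ⟨[], [], rfl, by simp, Or.inl rfl⟩
    | cons x X ih =>
      by_cases hx : p x
      · obtain ⟨A, R, rfl, h1, h2⟩ := ih
        exact ⟨x :: A, R, rfl, by simpa [hx] using h1, h2⟩
      · exact ⟨[], x :: X, rfl, by simp, Or.inr ⟨x, X, rfl, hx⟩⟩
  obtain ⟨A, R, rfl, hA, rfl | ⟨b, B', rfl, hb⟩⟩ := aux (· ∉ S) X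
  · exact ⟨A, [], [], by simp, hA, by simp, by simp⟩
  obtain ⟨B, C, rfl, hB, rfl | ⟨c, C', rfl, hc⟩⟩ := aux (· ∈ S) B'
  · exact ⟨A, b :: B, [], by simp, hA, by simpa using ⟨by simpa using hb, hB⟩, by simp⟩
  refine ⟨A, b :: B, c :: C', by simp, hA, by simpa using ⟨by simpa using hb, hB⟩, ?_⟩
  intro d hd hdS
  rcases List.mem_cons.1 hd with rfl | hd
  · exact hc hdS
  refine hc (h b (by simp) c (by simp) d (by simp [hd]) ?_ ?_ (by simpa using hb) hdS)
  · have e : A ++ b :: (B ++ c :: C') = (A ++ b :: B) ++ c :: C' := by simp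
    rw [e] at hX ⊢
    exact idxOf_lt_of_append hX (by simp) (by simp)
  · have e : A ++ b :: (B ++ c :: C') = (A ++ b :: B ++ [c]) ++ C' := by simp
    rw [e] at hX ⊢
    exact idxOf_lt_of_append hX (by simp) hd

/-- Positions outside the block B do not change; inside it, the old and the new position add up to
the constant 2|A| + |B| - 1. -/
theorem idxOf_flip {A B C : List ℕ} {S : Finset ℕ} (hX : (A ++ B ++ C).Nodup)
    (hA : ∀ a ∈ A, a ∉ S) (hB : ∀ b ∈ B, b ∈ S) (hC : ∀ c ∈ C, c ∉ S) {a b : ℕ}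
    (ha : a ∈ A ++ B ++ C) (hb : b ∈ A ++ B ++ C) :
    (A ++ B.reverse ++ C).idxOf a < (A ++ B.reverse ++ C).idxOf b ↔
      if a ∈ S ∧ b ∈ S then (A ++ B ++ C).idxOf b < (A ++ B ++ C).idxOf a
      else (A ++ B ++ C).idxOf a < (A ++ B ++ C).idxOf b := by
  have hB' : B.Nodup := (List.nodup_append.1 (List.nodup_append.1 hX).1).2.1
  have key : ∀ x ∈ A ++ B ++ C,
      (x ∉ S ∧ (A ++ B.reverse ++ C).idxOf x = (A ++ B ++ C).idxOf x ∧
        ((A ++ B ++ C).idxOf x < A.length ∨ A.length + B.length ≤ (A ++ B ++ C).idxOf x)) ∨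
      (x ∈ S ∧ A.length ≤ (A ++ B ++ C).idxOf x ∧
        (A ++ B ++ C).idxOf x < A.length + B.length ∧
        (A ++ B.reverse ++ C).idxOf x + (A ++ B ++ C).idxOf x + 1 = 2 * A.length + B.length) := by
    intro x hx
    simp only [List.append_assoc, List.idxOf_append, List.mem_reverse, List.length_reverse]
    by_cases h1 : x ∈ A
    · have := List.idxOf_lt_length_of_mem h1
      exact Or.inl ⟨hA x h1, by simp [h1], by simp [h1, this]⟩
    by_cases h2 : x ∈ B
    · have := idxOf_reverse hB' h2
      refine Or.inr ⟨hB x h2, ?_⟩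
      simp only [h1, h2, if_true, if_false]
      omega
    · have h3 : x ∈ C := by simpa [h1, h2] using hx
      refine Or.inl ⟨hC x h3, ?_⟩
      simp only [h1, h2, if_false, true_and]
      omega
  have e := key a ha
  have e' := key b hb
  split_ifs with h
  · rcases e with e | e
    · exact absurd h.1 e.1
    rcases e' with e' | e'
    · exact absurd h.2 e'.1
    omega
  · rcases e with e | e <;> rcases e' with e' | e'
    · omega
    · omega
    · omega
    · exact absurd ⟨e.1, e'.1⟩ h

/-- Two sets are disjoint, or one contains the other. -/
def Laminar (S S' : Finset ℕ) : Prop := S ⊆ S' ∨ S' ⊆ S ∨ Disjoint S S'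

/-- Reversing the order inside a convex set keeps convexity of laminar sets. -/
theorem Convex.flip {X Y : List ℕ} {S S' : Finset ℕ} (h : Convex X S) (h' : Convex X S')
    (hl : Laminar S S') (hmem : ∀ a, a ∈ Y ↔ a ∈ X)
    (hinj : ∀ a ∈ X, ∀ b ∈ X, X.idxOf a = X.idxOf b → a = b)
    (hXY : ∀ a ∈ X, ∀ b ∈ X, Y.idxOf a < Y.idxOf b ↔
      if a ∈ S ∧ b ∈ S then X.idxOf b < X.idxOf a else X.idxOf a < X.idxOf b) :
    Convex Y S' := by
  intro a ha b hb c hc hab hbc haS hcS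
  rw [hmem] at ha hb hc
  rw [hXY a ha b hb] at hab
  rw [hXY b hb c hc] at hbc
  have h1 := h a ha b hb c hc
  have h2 := h c hc b hb a ha
  have h3 := h' a ha b hb c hc
  have h4 := h' c hc b hb a ha
  -- Comparisons with an element outside S are not reversed. If S ⊆ S', a middle element in S is
  -- harmless. If S' ⊆ S, both ends are in S, and either all or none of the comparisons are
  -- reversed. If the sets are disjoint, the ends are outside S and nothing is reversed.
  rcases hl with hl | hl | hl
  · have := @hl b
    have k1 := h a ha c hc b hb
    have k2 := h b hb a ha c hc
    have k3 := h c hc a ha b hb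
    have k4 := h b hb c hc a ha
    have e1 := hinj a ha c hc
    by_cases hbS : b ∈ S
    · exact hl hbS
    simp only [hbS, false_and, and_false, if_false] at hab hbc
    exact h3 hab hbc haS hcS
  · have ha' := hl haS
    have hc' := hl hcS
    by_cases hbS : b ∈ S
    · simp only [ha', hbS, hc', and_true, if_true] at hab hbc
      exact h4 hbc hab hcS haS
    · simp only [hbS, false_and, and_false, if_false] at hab hbc
      exact h3 hab hbc haS hcS
  · have ha' : a ∉ S := fun h => Finset.disjoint_left.1 hl h haS
    have hc' : c ∉ S := fun h => Finset.disjoint_left.1 hl h hcS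
    simp only [ha', hc', false_and, and_false, if_false] at hab hbc
    exact h3 hab hbc haS hcS

/-- A new element that is placed just above `y` can be added to convex sets that contain `y`. -/
theorem Convex.insert {A B : List ℕ} {x y : ℕ} {S : Finset ℕ} (hX : (A ++ x :: y :: B).Nodup)
    (h : Convex (A ++ y :: B) S)
    (hx : x ∈ S → y ∈ S ∨ ∀ a ∈ A ++ y :: B, a ∉ S)
    (hA : x ∉ S → y ∈ S → ∀ a ∈ A, a ∉ S) : Convex (A ++ x :: y :: B) S := by
  have hxA : x ∉ A := fun h' => (List.nodup_append.1 hX).2.2 x h' x (by simp) rfl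
  have hxB : x ∉ y :: B := (List.nodup_cons.1 (List.nodup_append.1 hX).2.1).1
  have ey : (A ++ y :: B).idxOf y = A.length := by
    have : y ∉ A := fun h' => (List.nodup_append.1 hX).2.2 y h' y (by simp) rfl
    simp [List.idxOf_append, this]
  have ex : (A ++ x :: y :: B).idxOf x = A.length := by simp [List.idxOf_append, hxA]
  -- Old entries before the new one keep their position; the others move by one.
  have key : ∀ a ∈ A ++ y :: B, a ≠ x ∧
      ((A ++ x :: y :: B).idxOf a = (A ++ y :: B).idxOf a ∧ (A ++ y :: B).idxOf a < A.length ∧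
        a ∈ A ∨
       (A ++ x :: y :: B).idxOf a = (A ++ y :: B).idxOf a + 1 ∧
        A.length ≤ (A ++ y :: B).idxOf a ∧ (a = y ∨ A.length < (A ++ y :: B).idxOf a)) := by
    intro a ha
    have hax : a ≠ x := by
      rintro rfl; rcases List.mem_append.1 ha with h' | h'
      exacts [hxA h', hxB h']
    refine ⟨hax, ?_⟩
    by_cases h1 : a ∈ A
    · have := List.idxOf_lt_length_of_mem h1
      left; simp [List.idxOf_append, h1, this]
    · right
      by_cases hay : a = y
      · subst hay
        simp [List.idxOf_append, h1, List.idxOf_cons_ne _ hax.symm, add_comm]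
      · simp only [List.idxOf_append, h1, if_false, List.idxOf_cons_ne _ hax.symm,
          List.idxOf_cons_ne _ (Ne.symm hay)]
        omega
  have mem : ∀ a, a ∈ A ++ x :: y :: B → a = x ∨ a ∈ A ++ y :: B := by
    intro a; simp; tauto
  have hy : y ∈ A ++ y :: B := by simp
  intro a ha b hb c hc hab hbc haS hcS
  replace ha := mem a ha
  replace hb := mem b hb
  replace hc := mem c hc
  rcases ha with rfl | ha <;> rcases hb with rfl | hb <;> rcases hc with rfl | hc
  · exact haS
  · exact haS
  · omega
  · rcases hx haS with h1 | h1
    · have hb' := key b hb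
      have hc' := key c hc
      by_cases hby : b = y
      · rwa [hby]
      have hb2 : A.length < (A ++ y :: B).idxOf b := by omega
      exact h y hy b hb c hc (by omega) (by omega) h1 hcS
    · exact absurd hcS (h1 c hc)
  · exact hcS
  · have ha' := key a ha
    have hc' := key c hc
    by_contra hb
    refine hA hb ?_ a (ha'.2.elim (·.2.2) fun h' => by omega) haS
    by_cases hcy : c = y
    · rwa [← hcy]
    exact h a ha y hy c hc (by omega) (by omega) haS hcS
  · rcases hx hcS with h1 | h1
    · have hb' := key b hb
      have ha' := key a ha
      exact h a ha b hb y hy (by omega) (by omega) haS h1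
    · exact absurd haS (h1 a ha)
  · have ha' := key a ha
    have hb' := key b hb
    have hc' := key c hc
    exact h a ha b hb c hc (by omega) (by omega) haS hcS

end Tangle

namespace Tangle
open TreePair

/-! ### Lists in memory -/

/-- The list on side `σ` in memory is `X`. -/
def Lst (m : Mem) (σ : Side) (X : List ℕ) : Prop :=
  m (.len σ) 0 0 = X.length ∧ ∀ k < X.length, m (.lay σ) k 0 = X.getD k 0

theorem Lst.frame {m m' : Mem} {σ : Side} {X : List ℕ} (h : Lst m σ X) {l : List Arr}
    (hf : Fr l m m') (hl : .len σ ∉ l ∧ .lay σ ∉ l := by simp) : Lst m' σ X := by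
  unfold Lst; rw [hf _ hl.1, hf _ hl.2]; exact h

theorem getD_mem {X : List ℕ} {k : ℕ} (h : k < X.length) : X.getD k 0 ∈ X := by
  rw [List.getD_eq_getElem _ _ h]; exact List.getElem_mem h

theorem exists_getD_of_mem {X : List ℕ} {x : ℕ} (h : x ∈ X) : ∃ k < X.length, X.getD k 0 = x := by
  obtain ⟨k, hk, rfl⟩ := List.getElem_of_mem h
  exact ⟨k, hk, List.getD_eq_getElem _ _ hk⟩

theorem split_at {X : List ℕ} {p : ℕ} (h : p < X.length) :
    ∃ A B, X = A ++ X.getD p 0 :: B ∧ A.length = p := by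
  refine ⟨X.take p, X.drop (p + 1), ?_, by simp; omega⟩
  rw [List.getD_eq_getElem _ _ h, List.getElem_cons_drop, List.take_append_drop]

theorem getD_append_cons (A B : List ℕ) (y k : ℕ) :
    (A ++ y :: B).getD k 0 = if k < A.length then A.getD k 0
      else if k = A.length then y else B.getD (k - A.length - 1) 0 := by
  split_ifs with h h'
  · rw [List.getD_append _ _ _ _ h]
  · subst h'; simp
  · rw [List.getD_append_right _ _ _ _ (by omega),
      show k - A.length = (k - A.length - 1) + 1 by omega, List.getD_cons_succ]
    simp

variable {D : TreePair} {m : Mem} {J : Finset ℕ}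

theorem tr_splice {N : ℕ} {σ : Side} {A B : List ℕ} {y a b : ℕ} (h : Lst m σ (A ++ y :: B))
    (hN : A.length + B.length + 1 < N) :
    Tr N (splice σ A.length a b) m ((A.length + B.length + 1) * 20 + 30)
      (fun _ m' => Fr [.lay σ, .len σ, .tmp] m m' ∧ Lst m' σ (A ++ a :: b :: B)) := by
  have hlen : (A ++ y :: B).length = A.length + B.length + 1 := by simp; omega
  have hlen' : (A ++ a :: b :: B).length = A.length + B.length + 2 := by simp; omega
  set l := A.length + B.length + 1 with hl
  intro t
  simp only [splice, wps, h.1, hlen]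
  refine ⟨by omega, by omega, ?_⟩
  -- Behind the replaced entry, the write index c is one ahead of the read index k.
  refine (wp_loop (c := 9) (fun k c m' => Fr [.tmp] m m' ∧
    c = (if k ≤ A.length then k else k + 1) ∧
    ∀ j < c, m' .tmp j 0 = (A ++ a :: b :: B).getD j 0) ⟨Fr.refl _ _, by simp, by simp⟩ ?_).use ?_
  · rintro k c m₁ hk ⟨hf, rfl, hc⟩ t
    simp only [wps]
    have hx : m₁ (.lay σ) k 0 = (A ++ y :: B).getD k 0 := by
      rw [hf _ (by simp), h.2 k (by omega)]
    rw [getD_append_cons] at hx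
    refine ⟨by omega, by omega, ?_⟩
    rcases Nat.lt_trichotomy k A.length with h1 | h1 | h1
    · rw [if_pos h1.le] at hc ⊢
      rw [if_neg h1.ne]
      refine ⟨by omega, by omega, ⟨hf.upd (by simp), by rw [if_pos (by omega)], ?_⟩, by omega⟩
      intro j hj
      simp only [upd_zero]
      split_ifs with h3
      · subst h3
        rw [hx, if_pos (by omega), getD_append_cons, if_pos (by omega)]
      · exact hc j (by omega)
    · subst h1
      rw [if_pos le_rfl] at hc ⊢
      rw [if_pos rfl]
      refine ⟨by omega, by omega, by omega, by omega,
        ⟨(hf.upd (by simp)).upd (by simp), by simp, ?_⟩, by omega⟩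
      intro j hj
      simp only [upd_zero]
      split_ifs with h3 h4
      · subst h3; rw [getD_append_cons, if_neg (by omega), if_neg (by omega)]; simp
      · subst h4; simp
      · exact hc j (by omega)
    · rw [if_neg h1.ne', if_neg (by omega)]
      rw [if_neg (by omega)] at hc
      refine ⟨by omega, by omega, ⟨hf.upd (by simp), by rw [if_neg (by omega)], ?_⟩, by omega⟩
      intro j hj
      simp only [upd_zero]
      split_ifs with h3
      · subst h3
        rw [hx, if_neg (by omega), if_neg h1.ne', getD_append_cons, if_neg (by omega),
          if_neg (by omega), show k + 1 - A.length - 1 = (k - A.length - 1) + 1 by omega,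
          List.getD_cons_succ]
      · exact hc j (by omega)
  · rintro c m₁ t₁ ⟨hf₁, rfl, hc⟩ ht₁
    rw [if_neg (by omega)] at hc ⊢
    refine (tr_forUp (c := 4) (fun k m' => Fr [.lay σ, .tmp] m m' ∧ Fr [.lay σ] m₁ m' ∧
      ∀ j < k, m' (.lay σ) j 0 = (A ++ a :: b :: B).getD j 0)
      ⟨hf₁.mono (by simp), Fr.refl _ _, by simp⟩ ?_).use ?_
    · rintro k m₂ hk ⟨hf, hf', hc'⟩ t
      simp only [wps]
      refine ⟨by omega, by omega, by omega, by omega,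
        ⟨hf.upd (by simp), hf'.upd (by simp), ?_⟩, by omega⟩
      intro j hj
      simp only [upd_zero]
      split_ifs with h1
      · rw [h1, hf' _ (by simp), hc k (by omega)]
      · exact hc' j (by omega)
    · rintro _ m₂ t₂ ⟨hf₂, -, hc₂⟩ ht₂
      refine ⟨by omega, by omega, ⟨(hf₂.mono ?_).upd (by simp), ?_, ?_⟩, by omega⟩
      · simp
      · rw [upd_self, hlen']
      · intro k hk
        rw [upd_ne _ _ _ _ (by simp)]
        exact hc₂ k (by omega)

theorem getD_append₃ (A B C : List ℕ) (k : ℕ) :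
    (A ++ B ++ C).getD k 0 = if k < A.length then A.getD k 0
      else if k < A.length + B.length then B.getD (k - A.length) 0
      else C.getD (k - A.length - B.length) 0 := by
  split_ifs with h h'
  · rw [List.append_assoc, List.getD_append _ _ _ _ h]
  · rw [List.getD_append _ _ _ _ (by simpa using h'), List.getD_append_right _ _ _ _ (by omega)]
  · rw [List.getD_append_right _ _ _ _ (by simp; omega), List.length_append, Nat.sub_sub]

theorem getD_reverse {B : List ℕ} {k : ℕ} (h : k < B.length) :
    B.reverse.getD k 0 = B.getD (B.length - 1 - k) 0 := by
  rw [List.getD_eq_getElem _ _ (by simpa using h), List.getElem_reverse,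
    List.getD_eq_getElem _ _ (by omega)]

/-- The first pass pushes the block onto the stack `tmp`, the second pops it. Entries from the
current position on are still the old ones in the second pass, so the membership test recognizes the
same positions in both passes. -/
theorem tr_flip_list {σ : Side} {A B C : List ℕ} {u : ℕ} (hm : Static D m)
    (h : Lst m σ (A ++ B ++ C)) (hn : (A ++ B ++ C).length ≤ D.n)
    (hlt : ∀ x ∈ A ++ B ++ C, x < D.n) (hu : u < 2 * D.n - 1)
    (hA : ∀ a ∈ A, a ∉ D.L σ u) (hB : ∀ b ∈ B, b ∈ D.L σ u) (hC : ∀ c ∈ C, c ∉ D.L σ u) :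
    Tr (2 * D.n) (flip σ u) m (50 * D.n)
      (fun _ m' => Fr [.lay σ, .tmp] m m' ∧ Lst m' σ (A ++ B.reverse ++ C)) := by
  have hlen : (A ++ B ++ C).length = A.length + B.length + C.length := by simp; ring
  have hlen' : (A ++ B.reverse ++ C).length = A.length + B.length + C.length := by simp; ring
  have hpos := D.pos
  rw [hlen] at hn
  have hS : ∀ k < A.length + B.length + C.length, ((A ++ B ++ C).getD k 0 ∈ D.L σ u ↔
      A.length ≤ k ∧ k < A.length + B.length) := by
    intro k hk
    rw [getD_append₃]
    split_ifs with h1 h2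
    · exact iff_of_false (hA _ (getD_mem h1)) (by omega)
    · exact iff_of_true (hB _ (getD_mem (by omega))) (by omega)
    · exact iff_of_false (hC _ (getD_mem (by omega))) (by omega)
  set l := A.length + B.length + C.length with hl
  have hx : ∀ k < l, (A ++ B ++ C).getD k 0 < D.n := fun k hk => hlt _ (getD_mem (by omega))
  intro t
  simp only [flip, wps, h.1, hlen]
  refine ⟨by omega, by omega, ?_⟩
  refine (wp_loop (c := 8) (fun k c m' => Fr [.tmp] m m' ∧
    c = min (k - A.length) B.length ∧
    ∀ j < c, m' .tmp j 0 = B.getD j 0) ⟨Fr.refl _ _, by simp, by simp⟩ ?_).use ?_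
  · rintro k c m₁ hk ⟨hf, rfl, hc⟩ t
    simp only [wps]
    rw [hf (.lay σ) (by simp), h.2 k (by omega)]
    refine ⟨by omega, by omega, ?_⟩
    refine Tr.use (test_leq (hm.frame hf) hu (hx k hk)) ?_
    rintro x m₂ t₂ ⟨rfl, hb⟩ ht₂
    rw [hS k hk] at hb
    split_ifs with h1
    · exact ⟨⟨hf, by omega, hc⟩, by omega⟩
    · have h1' := hb.1 h1
      refine ⟨by omega, by omega, ⟨hf.upd (by simp), by omega, ?_⟩, by omega⟩
      intro j hj
      simp only [upd_zero]
      split_ifs with h3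
      · rw [getD_append₃, if_neg (by omega), if_pos h1'.2]
        congr 1; omega
      · exact hc j (by omega)
  · rintro c m₁ t₁ ⟨hf₁, rfl, hc⟩ ht₁
    rw [show min (l - A.length) B.length = B.length by omega] at hc ⊢
    refine (wp_loop (c := 10) (fun k c m' => Fr [.lay σ, .tmp] m m' ∧ Fr [.lay σ] m₁ m' ∧
      c = B.length - min (k - A.length) B.length ∧
      (∀ j < k, m' (.lay σ) j 0 = (A ++ B.reverse ++ C).getD j 0) ∧
      (∀ j < l, k ≤ j → m' (.lay σ) j 0 = (A ++ B ++ C).getD j 0))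
      ⟨hf₁.mono (by simp), Fr.refl _ _, by simp, by simp, fun j hj _ => ?_⟩ ?_).use ?_
    · rw [hf₁ _ (by simp), h.2 j (by omega)]
    · rintro k c m₂ hk ⟨hf, hf', rfl, hc', hc''⟩ t
      simp only [wps]
      rw [hc'' k hk le_rfl]
      refine ⟨by omega, by omega, ?_⟩
      refine Tr.use (test_leq (hm.frame hf) hu (hx k hk)) ?_
      rintro x m₃ t₂ ⟨rfl, hb⟩ ht₂
      rw [hS k hk] at hb
      split_ifs with h1
      · refine ⟨⟨hf, hf', by omega, ?_, fun j hj hkj => hc'' j hj (by omega)⟩, by omega⟩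
        intro j hj
        rcases Nat.lt_succ_iff_lt_or_eq.1 hj with hj | rfl
        · exact hc' j hj
        · rw [hc'' j hk le_rfl, getD_append₃, getD_append₃, List.length_reverse]
          split_ifs <;> first | rfl | omega
      · have h1' := hb.1 h1
        refine ⟨by omega, by omega, by omega, by omega, ⟨hf.upd (by simp), hf'.upd (by simp),
          by omega, ?_, ?_⟩, by omega⟩
        · intro j hj
          simp only [upd_zero]
          split_ifs with h3
          · subst h3
            rw [hf' _ (by simp), hc _ (by omega), getD_append₃, if_neg (by omega),
              if_pos (by simpa using h1'.2), getD_reverse (by omega)]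
            congr 1; omega
          · exact hc' j (by omega)
        · intro j hj hkj
          simp only [upd_zero]
          rw [if_neg (by omega)]
          exact hc'' j hj (by omega)
    · rintro c m₂ t₂ ⟨hf₂, -, rfl, hc₂, -⟩ ht₂
      refine ⟨⟨hf₂, ?_, ?_⟩, by omega⟩
      · rw [hf₂ _ (by simp), hlen', h.1, hlen]
      · intro k hk
        exact hc₂ k (by omega)

end Tangle

namespace Tangle
open TreePair

/-! ### Untangling: combinatorics -/

/-- `lt` is a strict linear order on the edges in `I` for which the edges below any vertex of one of
the trees are consecutive, that is, a planar layout. -/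
structure PlanarOrder (D : TreePair) (I : Finset ℕ) (lt : ℕ → ℕ → Prop) : Prop where
  bound : ∀ i ∈ I, i < D.n
  irrefl : ∀ i ∈ I, ¬ lt i i
  trans : ∀ i ∈ I, ∀ j ∈ I, ∀ k ∈ I, lt i j → lt j k → lt i k
  total : ∀ i ∈ I, ∀ j ∈ I, i ≠ j → lt i j ∨ lt j i
  convex : ∀ σ, ∀ v < 2 * D.n - 1, ∀ i ∈ I, ∀ j ∈ I, ∀ k ∈ I, lt i j → lt j k →
    i ∈ D.E σ I v → k ∈ D.E σ I v → j ∈ D.E σ I v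

/-- The list `X` of vertices on side `σ` is refined by the planar layout `lt`. -/
structure Refined (D : TreePair) (I : Finset ℕ) (lt : ℕ → ℕ → Prop) (σ : Side) (X : List ℕ) :
    Prop where
  vert : ∀ x ∈ X, x < 2 * D.n - 1 ∧ (D.E σ I x).Nonempty ∧ (x < D.n ∨ D.Branching σ I x)
  sorted : X.Pairwise fun x y => ∀ i ∈ D.E σ I x, ∀ j ∈ D.E σ I y, lt i j
  cover : ∀ i ∈ I, ∃ x ∈ X, i ∈ D.E σ I x

variable {D : TreePair} {I : Finset ℕ} {lt : ℕ → ℕ → Prop} {σ τ : Side} {X Y : List ℕ}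

namespace TreePair

theorem E_subset {v : ℕ} : D.E σ I v ⊆ I := Finset.filter_subset _ _

theorem E_disjoint {v : ℕ} (h : D.n ≤ v) (h' : v < 2 * D.n - 1) :
    Disjoint (D.E σ I (D.ch σ false v)) (D.E σ I (D.ch σ true v)) := by
  rw [Finset.disjoint_left]
  intro i hi hi'
  exact D.disj σ v _ h h' (D.mem_E.1 hi).2 (D.mem_E.1 hi').2

theorem E_leaf {x i : ℕ} (hx : x < D.n) : i ∈ D.E σ I x ↔ i ∈ I ∧ D.e σ i = x := by
  rw [mem_E, D.L_leaf σ x hx, Finset.mem_singleton]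

theorem E_ch_subset {b : Bool} {v : ℕ} (h : D.n ≤ v) (h' : v < 2 * D.n - 1) :
    D.E σ I (D.ch σ b v) ⊆ D.E σ I v := by
  rw [E_node h h']
  cases b
  exacts [Finset.subset_union_left, Finset.subset_union_right]

end TreePair

/-- Disjoint convex sets in a linear order do not interleave, so a single comparison decides all of
them. -/
theorem PlanarOrder.sep (h : PlanarOrder D I lt) {u v : ℕ} (hu : u < 2 * D.n - 1)
    (hv : v < 2 * D.n - 1) (hd : Disjoint (D.E σ I u) (D.E σ I v)) {a b : ℕ}
    (ha : a ∈ D.E σ I u) (hb : b ∈ D.E σ I v) (hab : lt a b) :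
    ∀ a' ∈ D.E σ I u, ∀ b' ∈ D.E σ I v, lt a' b' := by
  rw [Finset.disjoint_left] at hd
  have h1 : ∀ a' ∈ D.E σ I u, lt a' b := by
    intro a' ha'
    rcases h.total a' (E_subset ha') b (E_subset hb) (by rintro rfl; exact hd ha' hb) with h1 | h1
    · exact h1
    · exact absurd hb (hd (h.convex σ u hu a (E_subset ha) b (E_subset hb) a' (E_subset ha')
        hab h1 ha ha'))
  intro a' ha' b' hb'
  rcases h.total a' (E_subset ha') b' (E_subset hb') (by rintro rfl; exact hd ha' hb') with h2 | h2
  · exact h2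
  · exact absurd (h.convex σ v hv b' (E_subset hb') a' (E_subset ha') b (E_subset hb)
      h2 (h1 a' ha') hb' hb) (hd ha')

theorem Refined.pos_lt (h : Refined D I lt σ X) {p q i j : ℕ} (hp : p < X.length)
    (hq : q < X.length) (hpq : p < q) (hi : i ∈ D.E σ I (X.getD p 0))
    (hj : j ∈ D.E σ I (X.getD q 0)) : lt i j := by
  rw [List.getD_eq_getElem _ _ hp] at hi
  rw [List.getD_eq_getElem _ _ hq] at hj
  exact List.pairwise_iff_getElem.1 h.sorted p q hp hq hpq i hi j hj

theorem Refined.pos_unique (h : Refined D I lt σ X) (ho : PlanarOrder D I lt) {p q i : ℕ}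
    (hp : p < X.length) (hq : q < X.length) (hi : i ∈ D.E σ I (X.getD p 0))
    (hj : i ∈ D.E σ I (X.getD q 0)) : p = q := by
  rcases Nat.lt_trichotomy p q with hpq | hpq | hpq
  · exact absurd (h.pos_lt hp hq hpq hi hj) (ho.irrefl i (E_subset hi))
  · exact hpq
  · exact absurd (h.pos_lt hq hp hpq hj hi) (ho.irrefl i (E_subset hi))

theorem Refined.unique (h : Refined D I lt σ X) (ho : PlanarOrder D I lt) {x y i : ℕ}
    (hx : x ∈ X) (hy : y ∈ X) (hix : i ∈ D.E σ I x) (hiy : i ∈ D.E σ I y) : x = y := by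
  obtain ⟨p, hp, rfl⟩ := exists_getD_of_mem hx
  obtain ⟨q, hq, rfl⟩ := exists_getD_of_mem hy
  rw [h.pos_unique ho hp hq hix hiy]

/-- The edge sets of the entries are nonempty and pairwise disjoint, so representatives inject the
list into I. This keeps the positions in the lists within bounds and forces the untangling to end.
-/
theorem Refined.length_le (h : Refined D I lt σ X) (ho : PlanarOrder D I lt) :
    X.length ≤ I.card := by
  have hc : ∀ x : ℕ, ∃ i, x ∈ X → i ∈ D.E σ I x := fun x => by
    by_cases hx : x ∈ X
    · obtain ⟨i, hi⟩ := (h.vert x hx).2.1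
      exact ⟨i, fun _ => hi⟩
    · exact ⟨0, fun h => absurd h hx⟩
  choose r hr using hc
  have hnd : (X.map r).Nodup := by
    rw [List.Nodup, List.pairwise_map]
    refine h.sorted.imp_of_mem fun {x y} hx hy hxy e => ?_
    have := hxy _ (hr x hx) _ (hr y hy)
    rw [← e] at this
    exact ho.irrefl _ (E_subset (hr x hx)) this
  have : (X.map r).toFinset ⊆ I := by
    intro i hi
    simp only [List.mem_toFinset, List.mem_map] at hi
    obtain ⟨x, hx, rfl⟩ := hi
    exact E_subset (hr x hx)
  have := Finset.card_le_card this
  rwa [List.toFinset_card_of_nodup hnd, List.length_map] at this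

theorem Refined.replace {A B : List ℕ} {u a b : ℕ} (h : Refined D I lt σ (A ++ u :: B))
    (ha : a < 2 * D.n - 1 ∧ (D.E σ I a).Nonempty ∧ (a < D.n ∨ D.Branching σ I a))
    (hb : b < 2 * D.n - 1 ∧ (D.E σ I b).Nonempty ∧ (b < D.n ∨ D.Branching σ I b))
    (hE : D.E σ I u = D.E σ I a ∪ D.E σ I b)
    (hab : ∀ i ∈ D.E σ I a, ∀ j ∈ D.E σ I b, lt i j) :
    Refined D I lt σ (A ++ a :: b :: B) := by
  have ha' : D.E σ I a ⊆ D.E σ I u := hE ▸ Finset.subset_union_left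
  have hb' : D.E σ I b ⊆ D.E σ I u := hE ▸ Finset.subset_union_right
  refine ⟨?_, ?_, ?_⟩
  · intro x hx
    simp only [List.mem_append, List.mem_cons] at hx
    rcases hx with hx | rfl | rfl | hx
    exacts [h.vert x (by simp [hx]), ha, hb, h.vert x (by simp [hx])]
  · have := h.sorted
    rw [List.pairwise_append, List.pairwise_cons] at this ⊢
    rw [List.pairwise_cons]
    obtain ⟨h1, ⟨h2, h3⟩, h4⟩ := this
    refine ⟨h1, ⟨?_, ?_, h3⟩, ?_⟩
    · intro y hy
      rcases List.mem_cons.1 hy with rfl | hy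
      exacts [hab, fun i hi => h2 y hy i (ha' hi)]
    · exact fun y hy i hi => h2 y hy i (hb' hi)
    · intro x hx y hy
      simp only [List.mem_cons] at hy
      rcases hy with rfl | rfl | hy
      exacts [fun i hi j hj => h4 x hx u (by simp) i hi j (ha' hj),
        fun i hi j hj => h4 x hx u (by simp) i hi j (hb' hj), h4 x hx y (by simp [hy])]
  · intro i hi
    obtain ⟨x, hx, hix⟩ := h.cover i hi
    simp only [List.mem_append, List.mem_cons] at hx
    rcases hx with hx | rfl | hx
    · exact ⟨x, by simp [hx], hix⟩
    · rw [hE, Finset.mem_union] at hix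
      rcases hix with hix | hix
      exacts [⟨a, by simp, hix⟩, ⟨b, by simp, hix⟩]
    · exact ⟨x, by simp [hx], hix⟩

/-- Reversal of an order within the set `F`. -/
def flipOrder (F : Finset ℕ) (lt : ℕ → ℕ → Prop) (i j : ℕ) : Prop :=
  if i ∈ F ∧ j ∈ F then lt j i else lt i j

/-- Transitivity of the reversed order rests on convexity of the block, and convexity of the other
sets on laminarity. The latter is required in both trees; it holds if the block occurs as the edge
set of a vertex of each tree. -/
theorem PlanarOrder.flip (h : PlanarOrder D I lt) {u : ℕ} (hu : u < 2 * D.n - 1)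
    (hl : ∀ τ, ∀ v < 2 * D.n - 1, Laminar (D.E σ I u) (D.E τ I v)) :
    PlanarOrder D I (flipOrder (D.E σ I u) lt) := by
  have hc := h.convex σ u hu
  refine ⟨h.bound, ?_, ?_, ?_, ?_⟩
  · intro i hi
    simp [flipOrder, h.irrefl i hi]
  · intro i hi j hj k hk hij hjk
    have hne : i ≠ k := by
      rintro rfl
      unfold flipOrder at hij hjk
      have : ¬ (lt i j ∧ lt j i) := fun hh => h.irrefl i hi (h.trans _ hi _ hj _ hi hh.1 hh.2)
      split_ifs at hij hjk <;> tauto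
    have ht := h.total i hi k hk hne
    have t1 := h.trans i hi j hj k hk
    have t2 := h.trans k hk j hj i hi
    have c1 := hc i hi j hj k hk
    have c2 := hc j hj k hk i hi
    have c3 := hc k hk i hi j hj
    unfold flipOrder at hij hjk ⊢
    -- If exactly two of the three edges are in the block, convexity of the block prevents the third
    -- from lying between them.
    by_cases hiF : i ∈ D.E σ I u <;> by_cases hjF : j ∈ D.E σ I u <;>
      by_cases hkF : k ∈ D.E σ I u <;>
      simp only [hiF, hjF, hkF, and_true, and_false, and_self, if_true,
        if_false] at hij hjk ⊢
    · exact t2 hjk hij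
    · exact ht.resolve_right fun h' => hkF (c2 hjk h' hjF hiF)
    · exact absurd (c1 hij hjk hiF hkF) hjF
    · exact t1 hij hjk
    · exact ht.resolve_right fun h' => hiF (c3 h' hij hkF hjF)
    · exact t1 hij hjk
    · exact t1 hij hjk
    · exact t1 hij hjk
  · intro i hi j hj hij
    have := h.total i hi j hj hij
    unfold flipOrder
    by_cases hiF : i ∈ D.E σ I u <;> by_cases hjF : j ∈ D.E σ I u <;> simp [hiF, hjF] <;> tauto
  · intro τ v hv i hi j hj k hk hij hjk hiv hkv
    have c1 := hc i hi j hj k hk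
    have c2 := hc k hk j hj i hi
    have d1 := h.convex τ v hv i hi j hj k hk
    have d2 := h.convex τ v hv k hk j hj i hi
    unfold flipOrder at hij hjk
    rcases hl τ v hv with hl | hl | hl
    · by_cases hjF : j ∈ D.E σ I u
      · exact hl hjF
      simp only [hjF, and_false, false_and, if_false] at hij hjk
      exact d1 hij hjk hiv hkv
    · have hiF := hl hiv
      have hkF := hl hkv
      by_cases hjF : j ∈ D.E σ I u
      · simp only [hiF, hjF, hkF, and_self, if_true] at hij hjk
        exact d2 hjk hij hkv hiv
      · simp only [hjF, and_false, false_and, if_false] at hij hjk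
        exact d1 hij hjk hiv hkv
    · have hiF : i ∉ D.E σ I u := fun h => Finset.disjoint_left.1 hl h hiv
      have hkF : k ∉ D.E σ I u := fun h => Finset.disjoint_left.1 hl h hkv
      simp only [hiF, hkF, and_false, false_and, if_false] at hij hjk
      exact d1 hij hjk hiv hkv

/-- Distinct entries have disjoint edge sets, so a reversal inside the set of one entry affects no
comparison between entries. -/
theorem Refined.flip (h : Refined D I lt σ X) (ho : PlanarOrder D I lt) {u : ℕ} (hu : u ∈ X) :
    Refined D I (flipOrder (D.E σ I u) lt) σ X := by
  refine ⟨h.vert, h.sorted.imp_of_mem fun {x y} hx hy hxy i hi j hj => ?_, h.cover⟩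
  unfold flipOrder
  rw [if_neg]
  · exact hxy i hi j hj
  rintro ⟨hiu, hju⟩
  obtain rfl := h.unique ho hx hu hi hiu
  obtain rfl := h.unique ho hy hu hj hju
  exact ho.irrefl i (E_subset hi) (hxy i hi i hi)

theorem L_laminar (D : TreePair) (σ : Side) {u v : ℕ} (hu : u < 2 * D.n - 1)
    (hv : v < 2 * D.n - 1) : Laminar (D.L σ u) (D.L σ v) := by
  have key : ∀ u v, u < v → v < 2 * D.n - 1 → D.L σ u ⊆ D.L σ v ∨ Disjoint (D.L σ u) (D.L σ v) := by
    intro u v huv hv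
    by_cases hn : D.n ≤ v
    · rcases D.lam σ u v huv hn hv with ⟨b, h⟩ | h
      · refine Or.inl (h.trans fun x hx => (D.L_node σ v x hn hv).2 ?_)
        cases b
        exacts [Or.inl hx, Or.inr hx]
      · exact Or.inr h
    · rw [D.L_leaf σ u (by omega), D.L_leaf σ v (by omega)]
      right; simp; omega
  rcases Nat.lt_trichotomy u v with h | rfl | h
  · rcases key u v h hv with h | h
    exacts [Or.inl h, Or.inr (Or.inr h)]
  · exact Or.inl subset_rfl
  · rcases key v u h hu with h | h
    exacts [Or.inr (Or.inl h), Or.inr (Or.inr h.symm)]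

theorem E_laminar (D : TreePair) (σ : Side) (I : Finset ℕ) {u v : ℕ} (hu : u < 2 * D.n - 1)
    (hv : v < 2 * D.n - 1) : Laminar (D.E σ I u) (D.E σ I v) := by
  rcases L_laminar D σ hu hv with h | h | h
  · exact Or.inl fun i hi => D.mem_E.2 ⟨(D.mem_E.1 hi).1, h (D.mem_E.1 hi).2⟩
  · exact Or.inr (Or.inl fun i hi => D.mem_E.2 ⟨(D.mem_E.1 hi).1, h (D.mem_E.1 hi).2⟩)
  · refine Or.inr (Or.inr (Finset.disjoint_left.2 fun i hi hi' => ?_))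
    exact Finset.disjoint_left.1 h (D.mem_E.1 hi).2 (D.mem_E.1 hi').2

/-- A branching vertex is determined by the edges below it. -/
theorem Branching.eq_of_E_eq {u v : ℕ} (hu : D.Branching σ I u) (hv : D.Branching σ I v)
    (h : D.E σ I u = D.E σ I v) : u = v := by
  -- If u is below one child of v, it misses the edges below the other child; if the leaf sets are
  -- disjoint, there are no common edges at all.
  have key : ∀ u v, D.Branching σ I u → D.Branching σ I v → D.E σ I u = D.E σ I v →
      ¬ u < v := by
    intro u v hu hv h huv
    rcases D.lam σ u v huv hv.1 hv.2.1 with ⟨b, hb⟩ | hd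
    · obtain ⟨i, hi⟩ := hv.2.2 (!b)
      have hi' : i ∈ D.E σ I u := h ▸ E_ch_subset hv.1 hv.2.1 hi
      have hib := hb (D.mem_E.1 hi').2
      have hi := (D.mem_E.1 hi).2
      cases b
      exacts [D.disj σ v _ hv.1 hv.2.1 hib hi, D.disj σ v _ hv.1 hv.2.1 hi hib]
    · obtain ⟨i, hi⟩ := hu.2.2 true
      have hi := E_ch_subset hu.1 hu.2.1 hi
      exact Finset.disjoint_left.1 hd (D.mem_E.1 hi).2 (D.mem_E.1 (h ▸ hi)).2
  have h1 := key u v hu hv h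
  have h2 := key v u hv hu h.symm
  omega

/-- The degree of the vertex `u` on side `σ`, when the list on the opposite side is `Y`. -/
def deg (D : TreePair) (I : Finset ℕ) (σ : Side) (Y : List ℕ) (u : ℕ) : ℕ :=
  ((Finset.range Y.length).filter fun k =>
    (D.E σ I u ∩ D.E σ.other I (Y.getD k 0)).Nonempty).card

theorem deg_eq_one (hY : Refined D I lt σ.other Y) {u : ℕ} (h : deg D I σ Y u = 1) :
    ∃ k < Y.length, D.E σ I u ⊆ D.E σ.other I (Y.getD k 0) := by
  obtain ⟨k, hk⟩ := Finset.card_eq_one.1 h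
  have hk' : k < Y.length := by
    have : k ∈ ({k} : Finset ℕ) := by simp
    rw [← hk] at this
    simpa using (Finset.mem_filter.1 this).1
  refine ⟨k, hk', fun i hi => ?_⟩
  obtain ⟨y, hy, hiy⟩ := hY.cover i (E_subset hi)
  obtain ⟨j, hj, rfl⟩ := exists_getD_of_mem hy
  have : j ∈ ({k} : Finset ℕ) := by
    rw [← hk, Finset.mem_filter]
    exact ⟨by simpa using hj, i, Finset.mem_inter.2 ⟨hi, hiy⟩⟩
  rw [Finset.mem_singleton] at this
  rwa [← this]

theorem deg_of_subset (hY : Refined D I lt σ.other Y) (ho : PlanarOrder D I lt) {u k : ℕ}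
    (hk : k < Y.length) (hu : (D.E σ I u).Nonempty)
    (h : D.E σ I u ⊆ D.E σ.other I (Y.getD k 0)) : deg D I σ Y u = 1 := by
  rw [deg, Finset.card_eq_one]
  refine ⟨k, ?_⟩
  ext j
  simp only [Finset.mem_filter, Finset.mem_range, Finset.mem_singleton]
  constructor
  · rintro ⟨hj, i, hi⟩
    rw [Finset.mem_inter] at hi
    exact hY.pos_unique ho hj hk hi.2 (h hi.1)
  · rintro rfl
    obtain ⟨i, hi⟩ := hu
    exact ⟨hk, i, Finset.mem_inter.2 ⟨hi, h hi⟩⟩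

theorem deg_pos (hX : Refined D I lt σ.other X) {v : ℕ} (h : (D.E σ I v).Nonempty) :
    1 ≤ deg D I σ X v := by
  obtain ⟨i, hi⟩ := h
  obtain ⟨x, hx, hix⟩ := hX.cover i (E_subset hi)
  obtain ⟨k, hk, rfl⟩ := exists_getD_of_mem hx
  exact Finset.card_pos.2 ⟨k, Finset.mem_filter.2 ⟨by simpa using hk, i,
    Finset.mem_inter.2 ⟨hi, hix⟩⟩⟩

@[simp] theorem other_other (σ : Side) : σ.other.other = σ := by cases σ <;> rfl

theorem eq_other {σ τ : Side} (h : τ ≠ σ) : τ = σ.other := by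
  cases τ <;> cases σ <;> simp_all [Side.other]

/-- If an internal vertex has highest degree, and this degree is one, then its
neighbour is incident to the same edges. -/
theorem neighbour_of_deg_one (ho : PlanarOrder D I lt) (hX : Refined D I lt σ X)
    (hY : Refined D I lt σ.other Y) {u k : ℕ} (hu : u ∈ X) (hb : D.Branching σ I u)
    (hmax : ∀ y ∈ Y, D.n ≤ y → deg D I σ.other X y ≤ 1)
    (hk : k < Y.length) (h : D.E σ I u ⊆ D.E σ.other I (Y.getD k 0)) :
    D.Branching σ.other I (Y.getD k 0) ∧ D.E σ.other I (Y.getD k 0) = D.E σ I u := by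
  have hv := hY.vert _ (getD_mem hk)
  set v := Y.getD k 0 with hvdef
  -- A leaf carries a single edge, while both children of u contribute one to v.
  have hn : D.n ≤ v := by
    by_contra hlt
    obtain ⟨i, hi⟩ := hb.2.2 false
    obtain ⟨j, hj⟩ := hb.2.2 true
    have hi' := (E_leaf (by omega)).1 (h (E_ch_subset hb.1 hb.2.1 hi))
    have hj' := (E_leaf (by omega)).1 (h (E_ch_subset hb.1 hb.2.1 hj))
    have hE := hi'.2.trans hj'.2.symm
    have hne : i ≠ j := by
      rintro rfl
      exact Finset.disjoint_left.1 (E_disjoint hb.1 hb.2.1) hi hj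
    exact hne (D.e_inj (ho.bound i hi'.1) (ho.bound j hj'.1) hE)
  refine ⟨hv.2.2.resolve_left (by omega), Finset.Subset.antisymm ?_ h⟩
  have hX' : Refined D I lt σ.other.other X := by rwa [other_other]
  -- By maximality v has degree one as well, so its edges all lead to one vertex of X, and this
  -- vertex shares an edge with u.
  have h1 := hmax v (getD_mem hk) hn
  have h2 := deg_pos (σ := σ.other) hX' hv.2.1
  obtain ⟨j, hj, hsub⟩ := deg_eq_one (σ := σ.other) hX' (le_antisymm h1 h2)
  rw [other_other] at hsub
  obtain ⟨i, hi⟩ := hb.2.2 false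
  have hi := E_ch_subset hb.1 hb.2.1 hi
  rwa [hX.unique ho (getD_mem hj) hu (hsub (h hi)) hi] at hsub

/-- Replacing an internal vertex of highest degree by its children, in the order chosen by the
algorithm. -/
theorem exists_refined {A B : List ℕ} {u u₁ u₂ k : ℕ} (ho : PlanarOrder D I lt)
    (hX : Refined D I lt σ (A ++ u :: B)) (hY : Refined D I lt σ.other Y)
    (hu : D.Branching σ I u)
    (h₁ : u₁ < 2 * D.n - 1 ∧ (u₁ < D.n ∨ D.Branching σ I u₁))
    (h₂ : u₂ < 2 * D.n - 1 ∧ (u₂ < D.n ∨ D.Branching σ I u₂))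
    (hE₁ : D.E σ I u₁ = D.E σ I (D.ch σ false u)) (hE₂ : D.E σ I u₂ = D.E σ I (D.ch σ true u))
    (hmax : deg D I σ Y u = 1 → ∀ y ∈ Y, D.n ≤ y → deg D I σ.other (A ++ u :: B) y ≤ 1)
    (hk : k < Y.length) (hk₁ : (D.E σ I u₁ ∩ D.E σ.other I (Y.getD k 0)).Nonempty)
    (hk₂ : ∀ j < Y.length, k < j → ¬ (D.E σ I u₁ ∩ D.E σ.other I (Y.getD j 0)).Nonempty) :
    ∃ lt', PlanarOrder D I lt' ∧ Refined D I lt' σ.other Y ∧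
      Refined D I lt' σ
        (if ∃ j < k, (D.E σ I u₂ ∩ D.E σ.other I (Y.getD j 0)).Nonempty
          then A ++ u₂ :: u₁ :: B else A ++ u₁ :: u₂ :: B) := by
  have hE : D.E σ I u = D.E σ I u₁ ∪ D.E σ I u₂ := by rw [hE₁, hE₂, E_node hu.1 hu.2.1]
  have hd : Disjoint (D.E σ I u₁) (D.E σ I u₂) := by
    rw [hE₁, hE₂]; exact E_disjoint hu.1 hu.2.1
  have hne₁ : (D.E σ I u₁).Nonempty := hE₁ ▸ hu.2.2 false
  have hne₂ : (D.E σ I u₂).Nonempty := hE₂ ▸ hu.2.2 true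
  have ha : u₁ < 2 * D.n - 1 ∧ (D.E σ I u₁).Nonempty ∧ (u₁ < D.n ∨ D.Branching σ I u₁) :=
    ⟨h₁.1, hne₁, h₁.2⟩
  have hb : u₂ < 2 * D.n - 1 ∧ (D.E σ I u₂).Nonempty ∧ (u₂ < D.n ∨ D.Branching σ I u₂) :=
    ⟨h₂.1, hne₂, h₂.2⟩
  have asymm : ∀ i ∈ I, ∀ j ∈ I, lt i j → ¬ lt j i := fun i hi j hj h h' =>
    ho.irrefl i hi (ho.trans i hi j hj i hi h h')
  obtain ⟨i₁, hi₁⟩ := id hne₁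
  obtain ⟨i₂, hi₂⟩ := id hne₂
  have hne : i₁ ≠ i₂ := by rintro rfl; exact Finset.disjoint_left.1 hd hi₁ hi₂
  rcases ho.total i₁ (E_subset hi₁) i₂ (E_subset hi₂) hne with hlt | hlt
  -- If `lt` has the edges of u₁ first, no neighbour of u₂ can precede one of u₁, and the test
  -- chooses the same order.
  · have hsep := ho.sep h₁.1 h₂.1 hd hi₁ hi₂ hlt
    refine ⟨lt, ho, hY, ?_⟩
    rw [if_neg]
    · exact hX.replace ha hb hE hsep
    · rintro ⟨j, hj, i, hi⟩
      obtain ⟨i', hi'⟩ := hk₁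
      rw [Finset.mem_inter] at hi hi'
      exact asymm _ (E_subset hi'.1) _ (E_subset hi.1) (hsep i' hi'.1 i hi.1)
        (hY.pos_lt (by omega) hk hj hi.2 hi'.2)
  · have hsep := ho.sep h₂.1 h₁.1 hd.symm hi₂ hi₁ hlt
    by_cases hbad : ∃ j < k, (D.E σ I u₂ ∩ D.E σ.other I (Y.getD j 0)).Nonempty
    · rw [if_pos hbad]
      exact ⟨lt, ho, hY, hX.replace hb ha (by rw [hE, Finset.union_comm]) hsep⟩
    -- The algorithm contradicts `lt` here. The neighbours of u₁ are at positions at most k and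
    -- those of u₂ at positions at least k, while `lt` forces the opposite inequality. Hence all are
    -- at k, and u has degree one.
    rw [if_neg hbad]
    have pos₁ : ∀ i ∈ D.E σ I u₁, ∃ j ≤ k, j < Y.length ∧ i ∈ D.E σ.other I (Y.getD j 0) := by
      intro i hi
      obtain ⟨y, hy, hiy⟩ := hY.cover i (E_subset hi)
      obtain ⟨j, hj, rfl⟩ := exists_getD_of_mem hy
      refine ⟨j, ?_, hj, hiy⟩
      by_contra h
      exact hk₂ j hj (by omega) ⟨i, Finset.mem_inter.2 ⟨hi, hiy⟩⟩
    have pos₂ : ∀ i ∈ D.E σ I u₂, ∃ j ≥ k, j < Y.length ∧ i ∈ D.E σ.other I (Y.getD j 0) := by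
      intro i hi
      obtain ⟨y, hy, hiy⟩ := hY.cover i (E_subset hi)
      obtain ⟨j, hj, rfl⟩ := exists_getD_of_mem hy
      refine ⟨j, ?_, hj, hiy⟩
      by_contra h
      exact hbad ⟨j, by omega, i, Finset.mem_inter.2 ⟨hi, hiy⟩⟩
    have le₁ : ∀ i ∈ D.E σ I u₁, ∀ i' ∈ D.E σ I u₂, ∀ j j', j < Y.length → j' < Y.length →
        i ∈ D.E σ.other I (Y.getD j 0) → i' ∈ D.E σ.other I (Y.getD j' 0) → j' ≤ j := by
      intro i hi i' hi' j j' hj hj' hij hij'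
      by_contra h
      exact asymm _ (E_subset hi') _ (E_subset hi) (hsep i' hi' i hi)
        (hY.pos_lt hj hj' (by omega) hij hij')
    have hsub : D.E σ I u ⊆ D.E σ.other I (Y.getD k 0) := by
      intro i hi
      rw [hE, Finset.mem_union] at hi
      rcases hi with hi | hi
      · obtain ⟨j, hjk, hj, hij⟩ := pos₁ i hi
        obtain ⟨j', hjk', hj', hij'⟩ := pos₂ i₂ hi₂
        have := le₁ i hi i₂ hi₂ j j' hj hj' hij hij'
        rwa [show k = j by omega]
      · obtain ⟨j, hjk, hj, hij⟩ := pos₁ i₁ hi₁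
        obtain ⟨j', hjk', hj', hij'⟩ := pos₂ i hi
        have := le₁ i₁ hi₁ i hi j j' hj hj' hij hij'
        rwa [show k = j' by omega]
    have hmem : u ∈ A ++ u :: B := by simp
    have huE := hX.vert u hmem
    obtain ⟨-, hEv⟩ := neighbour_of_deg_one ho hX hY hmem hu
      (hmax (deg_of_subset hY ho hk huE.2.1 hsub)) hk hsub
    -- The neighbour at position k carries the same edges as u, so their common block is laminar to
    -- the blocks of both trees. Reversing `lt` on it makes it agree with the chosen order of the
    -- children.
    have ho' : PlanarOrder D I (flipOrder (D.E σ I u) lt) := by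
      refine ho.flip hu.2.1 fun τ v hv => ?_
      by_cases hτ : τ = σ
      · subst hτ; exact E_laminar D τ I hu.2.1 hv
      · obtain rfl := eq_other hτ
        rw [← hEv]
        exact E_laminar D σ.other I (hY.vert _ (getD_mem hk)).1 hv
    have hX' := hX.flip ho hmem
    have hY' := hY.flip ho (getD_mem hk)
    rw [hEv] at hY'
    refine ⟨_, ho', hY', hX'.replace ha hb hE fun i hi j hj => ?_⟩
    rw [flipOrder, if_pos ⟨hE ▸ Finset.mem_union_left _ hi, hE ▸ Finset.mem_union_right _ hj⟩]
    exact hsep j hj i hi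

end Tangle

namespace Tangle
open TreePair

/-! ### Untangling: the program -/

/-- The recorded pairs consist of branching vertices that are incident to the same edges. -/
def PairsOk (D : TreePair) (I : Finset ℕ) (m : Mem) : Prop :=
  ∀ u < 2 * D.n - 1, m .inM u 0 ≠ 0 →
    D.Branching .T I u ∧ D.Branching .S I (m (.mate .T) u 0) ∧
    D.E .T I u = D.E .S I (m (.mate .T) u 0) ∧ m (.mate .S) (m (.mate .T) u 0) 0 = u

/-- The state of the memory while the planar tanglegram is untangled. -/
structure UState (D : TreePair) (I : Finset ℕ) (m : Mem) (lt : ℕ → ℕ → Prop)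
    (X : Side → List ℕ) : Prop where
  static : Static D m
  red : ∀ σ, RedOk D m I σ (2 * D.n - 1)
  adj : ∀ u v, u < 2 * D.n - 1 → v < 2 * D.n - 1 → AdjOk D m I u v
  order : PlanarOrder D I lt
  lst : ∀ σ, Lst m σ (X σ)
  ref : ∀ σ, Refined D I lt σ (X σ)

variable {D : TreePair} {I : Finset ℕ} {lt : ℕ → ℕ → Prop} {σ τ : Side} {X : Side → List ℕ}
  {m : Mem}

theorem UState.frame (h : UState D I m lt X) {m' : Mem} {l : List Arr} (hf : Fr l m m')
    (hl : (∀ a ∈ l, a.isStatic = false) ∧ (∀ σ, .red σ ∉ l ∧ .len σ ∉ l ∧ .lay σ ∉ l) ∧ .adj ∉ l :=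
      by simp [Arr.isStatic]) : UState D I m' lt X where
  static := h.static.frame hf hl.1
  red σ := (h.red σ).frame hf (hl.2.1 σ).1
  adj u v hu hv := by unfold AdjOk; rw [hf _ hl.2.2]; exact h.adj u v hu hv
  order := h.order
  lst σ := (h.lst σ).frame hf (hl.2.1 σ).2
  ref := h.ref

theorem UState.length_le (h : UState D I m lt X) (σ : Side) : (X σ).length ≤ D.n := by
  refine ((h.ref σ).length_le h.order).trans ?_
  have : I ⊆ Finset.range D.n := fun i hi => by simpa using h.order.bound i hi
  simpa using Finset.card_le_card this

theorem UState.test_adjacent (h : UState D I m lt X) {u v : ℕ} (hu : u < 2 * D.n - 1)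
    (hv : v < 2 * D.n - 1) :
    Test (2 * D.n) (adjacent σ u v) m 1 (D.E σ I u ∩ D.E σ.other I v).Nonempty := by
  have key : ∀ u v, D.Joined I u v ↔ (D.E .T I u ∩ D.E .S I v).Nonempty := by
    intro u v
    simp only [TreePair.Joined, Finset.Nonempty, Finset.mem_inter, mem_E]
    exact exists_congr fun i => by tauto
  cases σ
  · exact (test_read (by omega) (by omega)).congr le_rfl ((h.adj u v hu hv).trans (key u v))
  · refine (test_read (by omega) (by omega)).congr le_rfl ((h.adj v u hv hu).trans ?_)
    rw [key v u, Finset.inter_comm]; rfl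

theorem UState.test_adjacent_at (h : UState D I m lt X) {u : ℕ} (hu : u < 2 * D.n - 1) :
    ∀ k < (X σ.other).length, Test (2 * D.n) (do
      let v ← rd (.lay σ.other) k
      adjacent σ u v) m 3 (D.E σ I u ∩ D.E σ.other I ((X σ.other).getD k 0)).Nonempty := by
  intro k hk t
  have := h.length_le σ.other
  have hpos := D.pos
  simp only [wps]
  refine ⟨by omega, by omega, ?_⟩
  rw [(h.lst σ.other).2 k hk]
  refine Tr.use (h.test_adjacent hu ((h.ref σ.other).vert _ (getD_mem hk)).1) ?_
  rintro a m' t' ⟨rfl, ha⟩ ht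
  exact ⟨⟨rfl, ha⟩, by omega⟩

theorem UState.tr_degree (h : UState D I m lt X) {u : ℕ} (hu : u < 2 * D.n - 1) :
    Tr (2 * D.n) (degree σ u) m (12 * D.n)
      (fun a m' => m' = m ∧ a = deg D I σ (X σ.other) u) := by
  intro t
  have := h.length_le σ.other
  have hpos := D.pos
  simp only [degree, wps, (h.lst σ.other).1]
  refine ⟨by omega, by omega, ?_⟩
  refine Tr.use (tr_count _ (h.test_adjacent_at hu)) ?_
  rintro a m' t' ⟨rfl, rfl⟩ ht
  exact ⟨⟨rfl, rfl⟩, by omega⟩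

theorem UState.tr_bestPosition (h : UState D I m lt X) :
    Tr (2 * D.n) (bestPosition σ) m (60 * D.n ^ 2)
      (fun p m' => m' = m ∧ ((p = (X σ).length ∧ ∀ x ∈ X σ, x < D.n) ∨
        (p < (X σ).length ∧ D.n ≤ (X σ).getD p 0 ∧ ∀ x ∈ X σ, D.n ≤ x →
          deg D I σ (X σ.other) x ≤ deg D I σ (X σ.other) ((X σ).getD p 0)))) := by
  intro t
  have hl := h.length_le σ
  have hpos := D.pos
  simp only [bestPosition, wps, (h.lst σ).1, h.static.size]
  refine ⟨by omega, by omega, by omega, by omega, ?_⟩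
  -- The value p = |X| says that no internal vertex has been met so far.
  refine Tr.use (wp_loop (c := 40 * D.n) (fun k p m' => m' = m ∧
    ((p = (X σ).length ∧ ∀ j < k, (X σ).getD j 0 < D.n) ∨
        (p < k ∧ D.n ≤ (X σ).getD p 0 ∧ ∀ j < k, D.n ≤ (X σ).getD j 0 →
          deg D I σ (X σ.other) ((X σ).getD j 0) ≤ deg D I σ (X σ.other) ((X σ).getD p 0))))
    ⟨rfl, Or.inl ⟨rfl, by simp⟩⟩ ?_) ?_
  · rintro k p m₁ hk ⟨rfl, hp⟩ t
    simp only [wps]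
    rw [(h.lst σ).2 k hk]
    have hx := ((h.ref σ).vert _ (getD_mem hk)).1
    refine ⟨by omega, by omega, ?_⟩
    split_ifs with h1 h2
    · refine ⟨⟨trivial, ?_⟩, by omega⟩
      rcases hp with ⟨rfl, hp⟩ | ⟨hpk, hpn, hp⟩
      · refine Or.inl ⟨rfl, fun j hj => ?_⟩
        rcases Nat.lt_succ_iff_lt_or_eq.1 hj with hj | rfl
        exacts [hp j hj, h1]
      · refine Or.inr ⟨by omega, hpn, fun j hj hjn => ?_⟩
        rcases Nat.lt_succ_iff_lt_or_eq.1 hj with hj | rfl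
        exacts [hp j hj hjn, absurd h1 (by omega)]
    · refine ⟨⟨trivial, Or.inr ⟨by omega, by omega, ?_⟩⟩, by omega⟩
      rcases hp with ⟨rfl, hp⟩ | ⟨hpk, hpn, hp⟩
      · intro j hj hjn
        rcases Nat.lt_succ_iff_lt_or_eq.1 hj with hj | rfl
        exacts [absurd (hp j hj) (by omega), le_rfl]
      · omega
    · rcases hp with ⟨rfl, hp⟩ | ⟨hpk, hpn, hp⟩
      · omega
      refine (h.tr_degree hx).use ?_
      rintro d m₂ t₂ ⟨rfl, rfl⟩ ht₂
      rw [(h.lst σ).2 p (by omega)]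
      refine ⟨by omega, by omega, ?_⟩
      refine (h.tr_degree ((h.ref σ).vert _ (getD_mem (by omega))).1).use ?_
      rintro d m₂ t₂ ⟨rfl, rfl⟩ ht₂
      split_ifs with h3
      · refine ⟨⟨rfl, Or.inr ⟨by omega, by omega, fun j hj hjn => ?_⟩⟩, by omega⟩
        rcases Nat.lt_succ_iff_lt_or_eq.1 hj with hj | rfl
        exacts [(hp j hj hjn).trans h3.le, le_rfl]
      · refine ⟨⟨rfl, Or.inr ⟨by omega, by omega, fun j hj hjn => ?_⟩⟩, by omega⟩
        rcases Nat.lt_succ_iff_lt_or_eq.1 hj with hj | rfl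
        exacts [hp j hj hjn, not_lt.1 h3]
  · rintro p m' t' ⟨rfl, hp⟩ ht
    refine ⟨⟨rfl, ?_⟩, ?_⟩
    · rcases hp with ⟨rfl, hp⟩ | ⟨hpk, hpn, hp⟩
      · refine Or.inl ⟨rfl, fun x hx => ?_⟩
        obtain ⟨j, hj, rfl⟩ := exists_getD_of_mem hx
        exact hp j hj
      · refine Or.inr ⟨hpk, hpn, fun x hx => ?_⟩
        obtain ⟨j, hj, rfl⟩ := exists_getD_of_mem hx
        exact hp j hj
    · have : (X σ).length * (40 * D.n + 1) ≤ D.n * (41 * D.n) := by gcongr; omega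
      nlinarith

/-- New entries of `mate` do not spoil earlier pairs: an earlier partner w ≠ u of v would be
branching with the same edges as u, contradicting `Branching.eq_of_E_eq`. -/
theorem UState.tr_recordPair (h : UState D I m lt X) (hp : PairsOk D I m) {u : ℕ}
    (hu : u ∈ X σ) (hb : D.Branching σ I u)
    (hmax : deg D I σ (X σ.other) u = 1 →
      ∀ y ∈ X σ.other, D.n ≤ y → deg D I σ.other (X σ) y ≤ 1) :
    Tr (2 * D.n) (recordPair σ u) m (60 * D.n)
      (fun _ m' => Fr [.mate σ, .mate σ.other, .inM] m m' ∧ PairsOk D I m') := by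
  intro t
  have hl := h.length_le σ.other
  have hpos := D.pos
  have hu' := ((h.ref σ).vert u hu).1
  simp only [recordPair, wps]
  refine (h.tr_degree hu').use ?_
  rintro d m₁ t₁ ⟨rfl, rfl⟩ ht₁
  split_ifs with h1
  · refine ⟨by omega, by omega, ?_⟩
    rw [(h.lst σ.other).1]
    refine Tr.use (tr_lastSuch _ (h.test_adjacent_at hu')) ?_
    rintro k m₂ t₂ ⟨rfl, hk⟩ ht₂
    obtain ⟨k', hk', hsub⟩ := deg_eq_one (h.ref σ.other) h1
    have hne : (D.E σ I u ∩ D.E σ.other I ((X σ.other).getD k' 0)).Nonempty := by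
      obtain ⟨i, hi⟩ := hb.2.2 true
      have hi := E_ch_subset hb.1 hb.2.1 hi
      exact ⟨i, Finset.mem_inter.2 ⟨hi, hsub hi⟩⟩
    rcases hk with ⟨-, hk⟩ | ⟨hk, ⟨i, hi⟩, -⟩
    · exact absurd hne (hk k' hk')
    rw [Finset.mem_inter] at hi
    obtain rfl : k = k' := (h.ref σ.other).pos_unique h.order hk hk' hi.2 (hsub hi.1)
    obtain ⟨hbv, hE⟩ := neighbour_of_deg_one h.order (h.ref σ) (h.ref σ.other) hu hb (hmax h1)
      hk hsub
    rw [(h.lst σ.other).2 k hk]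
    set v := (X σ.other).getD k 0
    have hv := hbv.2.1
    refine ⟨by omega, by omega, by omega, by omega, by omega, by omega, ?_⟩
    cases σ
    · refine ⟨by omega, by omega, ⟨?_, ?_⟩, by omega⟩
      · exact (((Fr.refl _ _).upd (by simp)).upd (by simp)).upd (by simp)
      · intro w hw hwM
        by_cases hwu : w = u
        · subst hwu
          simpa [upd, Side.other] using ⟨hb, hbv, hE.symm⟩
        · simp only [upd, Side.other, reduceCtorEq, false_and, if_false, hwu, and_false,
            Arr.mate.injEq] at hwM ⊢
          obtain ⟨p1, p2, p3, p4⟩ := hp w hw hwM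
          refine ⟨p1, p2, p3, ?_⟩
          rw [if_neg, p4]
          rintro ⟨-, hh, -⟩
          refine hwu (Branching.eq_of_E_eq p1 hb ?_)
          rw [p3, hh]; exact hE
    · refine ⟨by omega, by omega, ⟨?_, ?_⟩, by omega⟩
      · exact (((Fr.refl _ _).upd (by simp)).upd (by simp)).upd (by simp)
      · intro w hw hwM
        by_cases hwu : w = v
        · subst hwu
          simpa [upd, Side.other] using ⟨hbv, hb, hE⟩
        · simp only [upd, Side.other, reduceCtorEq, false_and, if_false, hwu, and_false,
            Arr.mate.injEq] at hwM ⊢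
          obtain ⟨p1, p2, p3, p4⟩ := hp w hw hwM
          refine ⟨p1, p2, p3, ?_⟩
          rw [if_neg, p4]
          rintro ⟨-, hh, -⟩
          refine hwu (Branching.eq_of_E_eq p1 hbv ?_)
          rw [p3, hh]; exact hE.symm
  · exact ⟨⟨Fr.refl _ _, hp⟩, by omega⟩

theorem UState.tr_refine (h : UState D I m lt X) {p : ℕ} (hp : p < (X σ).length)
    (hb : D.n ≤ (X σ).getD p 0)
    (hmax : deg D I σ (X σ.other) ((X σ).getD p 0) = 1 →
      ∀ y ∈ X σ.other, D.n ≤ y → deg D I σ.other (X σ) y ≤ 1) :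
    Tr (2 * D.n) (refine σ p) m (200 * D.n)
      (fun _ m' => Fr [.lay σ, .len σ, .tmp] m m' ∧ ∃ lt' X', UState D I m' lt' X' ∧
        (X' σ).length = (X σ).length + 1 ∧ X' σ.other = X σ.other) := by
  intro t
  have hl := h.length_le σ.other
  have hlX := h.length_le σ
  have hpos := D.pos
  obtain ⟨A, B, hAB, hA⟩ := split_at hp
  have hu := (h.ref σ).vert _ (getD_mem hp)
  set u := (X σ).getD p 0 with hu_def
  have hbr : D.Branching σ I u := hu.2.2.resolve_left (by omega)
  have hr : ∀ b, m (.red σ) (D.ch σ b u) 0 < 2 * D.n - 1 ∧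
      D.E σ I (m (.red σ) (D.ch σ b u) 0) = D.E σ I (D.ch σ b u) ∧
      (m (.red σ) (D.ch σ b u) 0 < D.n ∨ D.Branching σ I (m (.red σ) (D.ch σ b u) 0)) := by
    intro b
    have hc : D.ch σ b u < 2 * D.n - 1 := ch_lt' hbr.1 hbr.2.1
    obtain ⟨h1, h2⟩ := h.red σ _ hc
    exact ⟨by omega, h2 (hbr.2.2 b)⟩
  have hcf : D.ch σ false u < 2 * D.n - 1 := ch_lt' hbr.1 hbr.2.1
  have hct : D.ch σ true u < 2 * D.n - 1 := ch_lt' hbr.1 hbr.2.1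
  simp only [refine, wps, (h.lst σ.other).1]
  rw [(h.lst σ).2 p hp, ← hu_def, h.static.child σ _ u hbr.1 hbr.2.1,
    h.static.child σ _ u hbr.1 hbr.2.1]
  set u₁ := m (.red σ) (D.ch σ false u) 0 with hu₁
  set u₂ := m (.red σ) (D.ch σ true u) 0 with hu₂
  refine ⟨by omega, by omega, by omega, by omega, by omega, by omega, by omega, by omega,
    by omega, by omega, by omega, by omega, ?_⟩
  refine Tr.use (tr_lastSuch _ (h.test_adjacent_at (hr false).1)) ?_
  rintro k m₁ t₁ ⟨rfl, hk⟩ ht₁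
  have hk' : k < (X σ.other).length ∧
      (D.E σ I u₁ ∩ D.E σ.other I ((X σ.other).getD k 0)).Nonempty ∧
      ∀ j < (X σ.other).length, k < j →
        ¬ (D.E σ I u₁ ∩ D.E σ.other I ((X σ.other).getD j 0)).Nonempty := by
    rcases hk with ⟨-, hk⟩ | hk
    · obtain ⟨i, hi⟩ := hbr.2.2 false
      rw [← (hr false).2.1] at hi
      obtain ⟨y, hy, hiy⟩ := (h.ref σ.other).cover i (E_subset hi)
      obtain ⟨j, hj, rfl⟩ := exists_getD_of_mem hy
      exact absurd ⟨i, Finset.mem_inter.2 ⟨hi, hiy⟩⟩ (hk j hj)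
    · exact hk
  refine Tr.use (test_count (c := 8) (fun j => j < k ∧
    (D.E σ I u₂ ∩ D.E σ.other I ((X σ.other).getD j 0)).Nonempty) fun j hj => ?_) ?_
  · exact Test.both (test_lt _ _ _ _) fun _ => h.test_adjacent_at (hr true).1 j hj
  rintro b m₂ t₂ ⟨rfl, hbad⟩ ht₂
  have hbad' : b ≠ 0 ↔ ∃ j < k,
      (D.E σ I u₂ ∩ D.E σ.other I ((X σ.other).getD j 0)).Nonempty := by
    rw [hbad]
    exact ⟨fun ⟨j, _, h⟩ => ⟨j, h⟩, fun ⟨j, h⟩ => ⟨j, by omega, h⟩⟩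
  have hXr := h.ref σ
  rw [hAB] at hXr
  have hmax' := hmax
  rw [hAB] at hmax'
  obtain ⟨lt', ho', hY', hX'⟩ := exists_refined h.order hXr (h.ref σ.other) hbr
    ⟨(hr false).1, (hr false).2.2⟩ ⟨(hr true).1, (hr true).2.2⟩ (hr false).2.1 (hr true).2.1
    hmax' hk'.1 hk'.2.1 hk'.2.2
  have hLst := h.lst σ
  rw [hAB] at hLst
  have hlen : A.length + B.length + 1 = (X σ).length := by rw [hAB]; simp; omega
  have fin : ∀ a b : ℕ, Refined D I lt' σ (A ++ a :: b :: B) →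
      Tr (2 * D.n) (splice σ p a b) m₂ (50 * D.n) (fun _ m' =>
        Fr [.lay σ, .len σ, .tmp] m₂ m' ∧ ∃ lt' X', UState D I m' lt' X' ∧
        (X' σ).length = (X σ).length + 1 ∧ X' σ.other = X σ.other) := by
    intro a b hX'
    rw [← hA]
    refine Tr.mono (tr_splice hLst (by omega)) (by omega) ?_
    rintro _ m₃ ⟨hf, hl'⟩
    refine ⟨hf, lt', fun τ => if τ = σ then A ++ a :: b :: B else X τ,
      ⟨h.static.frame hf, fun σ => (h.red σ).frame hf, ?_, ho', ?_, ?_⟩, ?_, ?_⟩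
    · intro u v hu hv
      unfold AdjOk; rw [hf _ (by simp)]; exact h.adj u v hu hv
    · intro τ
      by_cases hτ : τ = σ
      · subst hτ; simpa using hl'
      · simp only [hτ, if_false]
        exact (h.lst τ).frame hf ⟨by simpa using hτ, by simpa using hτ⟩
    · intro τ
      by_cases hτ : τ = σ
      · subst hτ; simpa using hX'
      · simp only [hτ, if_false]
        obtain rfl := eq_other hτ
        exact hY'
    · simp; omega
    · have : σ.other ≠ σ := by cases σ <;> simp [Side.other]
      simp [this]
  split_ifs with h1
  · rw [if_neg (hbad'.not.1 (by simpa using h1))] at hX'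
    refine (fin _ _ hX').use ?_
    rintro _ m₃ t₃ h₃ ht₃
    exact ⟨h₃, by omega⟩
  · rw [if_pos (hbad'.1 h1)] at hX'
    refine (fin _ _ hX').use ?_
    rintro _ m₃ t₃ h₃ ht₃
    exact ⟨h₃, by omega⟩

theorem PairsOk.frame (h : PairsOk D I m) {m' : Mem} {l : List Arr} (hf : Fr l m m')
    (hl : .inM ∉ l ∧ .mate .T ∉ l ∧ .mate .S ∉ l := by simp) : PairsOk D I m' := by
  unfold PairsOk; rw [hf _ hl.1, hf _ hl.2.1, hf _ hl.2.2]; exact h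

/-- The arrays that are changed in the untangling phase. -/
def untangleArrs : List Arr :=
  [.lay .T, .len .T, .lay .S, .len .S, .tmp, .mate .T, .mate .S, .inM]

theorem UState.tr_untangleAt (h : UState D I m lt X) (hp : PairsOk D I m) {p : ℕ}
    (hpl : p < (X σ).length) (hb : D.n ≤ (X σ).getD p 0)
    (hmax : deg D I σ (X σ.other) ((X σ).getD p 0) = 1 →
      ∀ y ∈ X σ.other, D.n ≤ y → deg D I σ.other (X σ) y ≤ 1) :
    Tr (2 * D.n) (untangleAt σ p) m (300 * D.n)
      (fun _ m' => Fr untangleArrs m m' ∧ PairsOk D I m' ∧ ∃ lt' X', UState D I m' lt' X' ∧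
        (X' .T).length + (X' .S).length = (X .T).length + (X .S).length + 1) := by
  intro t
  have hl := h.length_le σ
  have hpos := D.pos
  simp only [untangleAt, wps]
  rw [(h.lst σ).2 p hpl]
  refine ⟨by omega, by omega, ?_⟩
  have hu := (h.ref σ).vert _ (getD_mem hpl)
  refine (h.tr_recordPair hp (getD_mem hpl) (hu.2.2.resolve_left (by omega)) hmax).use ?_
  rintro _ m₁ t₁ ⟨hf₁, hp₁⟩ ht₁
  refine ((h.frame hf₁).tr_refine hpl hb hmax).use ?_
  rintro _ m₂ t₂ ⟨hf₂, lt', X', h', hlen, hX'⟩ ht₂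
  refine ⟨⟨(hf₁.mono ?_).trans (hf₂.mono ?_), hp₁.frame hf₂, lt', X', h', ?_⟩, by omega⟩
  · cases σ <;> simp [untangleArrs, Side.other]
  · cases σ <;> simp [untangleArrs]
  · cases σ <;> simp only [Side.other] at hX' <;> rw [hX'] <;> omega

/-- The refined vertex has the highest degree over both lists, which supplies the maximality needed
for the opposite list. The total length serves as the measure of progress. -/
theorem UState.tr_untangleStep (h : UState D I m lt X) (hp : PairsOk D I m) :
    Tr (2 * D.n) untangleStep m (500 * D.n ^ 2)
      (fun _ m' => Fr untangleArrs m m' ∧ PairsOk D I m' ∧ ∃ lt' X', UState D I m' lt' X' ∧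
        ((∀ σ, ∀ x ∈ X' σ, x < D.n) ∨ ¬ (∀ σ, ∀ x ∈ X σ, x < D.n) ∧
        (X' .T).length + (X' .S).length = (X .T).length + (X .S).length + 1)) := by
  intro t
  have hlT := h.length_le .T
  have hlS := h.length_le .S
  have hpos := D.pos
  have hn2 : D.n ≤ D.n ^ 2 := Nat.le_self_pow (by simp) _
  simp only [untangleStep, wps, (h.lst _).1]
  refine ⟨by omega, by omega, by omega, by omega, ?_⟩
  refine (h.tr_bestPosition (σ := .T)).use ?_
  rintro p m₁ t₁ ⟨rfl, hP⟩ ht₁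
  refine (h.tr_bestPosition (σ := .S)).use ?_
  rintro q m₁ t₂ ⟨rfl, hQ⟩ ht₂
  simp only [Side.other] at hP hQ
  have noneT : p = (X .T).length → ∀ x ∈ X .T, x < D.n := fun e => by
    rcases hP with hP | hP
    exacts [hP.2, by omega]
  have noneS : q = (X .S).length → ∀ x ∈ X .S, x < D.n := fun e => by
    rcases hQ with hQ | hQ
    exacts [hQ.2, by omega]
  split_ifs with h1 h2 h2
  · have hP := hP.resolve_left (by omega)
    have hQ := hQ.resolve_left (by omega)
    rw [(h.lst _).2 p h1, (h.lst _).2 q h2]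
    refine ⟨by omega, by omega, by omega, by omega, ?_⟩
    refine (h.tr_degree ((h.ref _).vert _ (getD_mem h1)).1).use ?_
    rintro d m₁ t₃ ⟨rfl, rfl⟩ ht₃
    refine (h.tr_degree ((h.ref _).vert _ (getD_mem h2)).1).use ?_
    rintro d m₁ t₄ ⟨rfl, rfl⟩ ht₄
    rcases lt_or_ge (deg D I .T (X .S) ((X .T).getD p 0)) (deg D I .S (X .T) ((X .S).getD q 0))
      with h3 | h3
    · rw [if_pos (show deg D I .T (X Side.T.other) ((X .T).getD p 0) <
        deg D I .S (X Side.S.other) ((X .S).getD q 0) from h3)]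
      refine (h.tr_untangleAt hp (σ := .S) h2 hQ.2.1 ?_).use ?_
      · intro h4 y hy hyn
        exact (hP.2.2 y hy hyn).trans (h3.le.trans h4.le)
      · rintro _ m₂ t₅ ⟨hf, hp', lt', X', h', hl⟩ ht₅
        exact ⟨⟨hf, hp', lt', X', h', Or.inr
          ⟨fun hh => absurd (hh .S _ (getD_mem h2)) (not_lt.2 hQ.2.1), hl⟩⟩, by omega⟩
    · rw [if_neg (show ¬ deg D I .T (X Side.T.other) ((X .T).getD p 0) <
        deg D I .S (X Side.S.other) ((X .S).getD q 0) from not_lt.2 h3)]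
      refine (h.tr_untangleAt hp (σ := .T) h1 hP.2.1 ?_).use ?_
      · intro h4 y hy hyn
        exact (hQ.2.2 y hy hyn).trans (h3.trans h4.le)
      · rintro _ m₂ t₅ ⟨hf, hp', lt', X', h', hl⟩ ht₅
        exact ⟨⟨hf, hp', lt', X', h', Or.inr
          ⟨fun hh => absurd (hh .T _ (getD_mem h1)) (not_lt.2 hP.2.1), hl⟩⟩, by omega⟩
  · have hP := hP.resolve_left (by omega)
    refine (h.tr_untangleAt hp (σ := .T) h1 hP.2.1 ?_).use ?_
    · intro h4 y hy hyn
      exact absurd (noneS (by omega) y hy) (by omega)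
    · rintro _ m₂ t₅ ⟨hf, hp', lt', X', h', hl⟩ ht₅
      exact ⟨⟨hf, hp', lt', X', h', Or.inr
          ⟨fun hh => absurd (hh .T _ (getD_mem h1)) (not_lt.2 hP.2.1), hl⟩⟩, by omega⟩
  · have hQ := hQ.resolve_left (by omega)
    refine (h.tr_untangleAt hp (σ := .S) h2 hQ.2.1 ?_).use ?_
    · intro h4 y hy hyn
      exact absurd (noneT (by omega) y hy) (by omega)
    · rintro _ m₂ t₅ ⟨hf, hp', lt', X', h', hl⟩ ht₅
      exact ⟨⟨hf, hp', lt', X', h', Or.inr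
          ⟨fun hh => absurd (hh .S _ (getD_mem h2)) (not_lt.2 hQ.2.1), hl⟩⟩, by omega⟩
  · refine ⟨⟨Fr.refl _ _, hp, lt, X, h, Or.inl fun σ => ?_⟩, by omega⟩
    cases σ
    exacts [noneT (by omega), noneS (by omega)]

end Tangle

/-! ### The complete untangling loop -/

namespace Tangle
open TreePair

variable {D : TreePair} {I J : Finset ℕ} {lt : ℕ → ℕ → Prop} {σ τ : Side} {X : Side → List ℕ}
  {m : Mem}

/-- All arrays that are written by `modifiedUntangle`. -/
def modifiedUntangleArrs : List Arr := [.red .T, .red .S, .adj] ++ untangleArrs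

theorem refined_singleton (hI : I.Nonempty) {x : ℕ}
    (hx : x < 2 * D.n - 1) (hE : D.E σ I x = I) (hr : x < D.n ∨ D.Branching σ I x) :
    Refined D I lt σ [x] :=
  ⟨by simpa [hE, hI] using ⟨hx, hr⟩, by simp, by simp [hE]⟩

theorem tr_modifiedUntangle (hm : Static D m) (hJ : InJ D m I) (hI : I.Nonempty)
    (ho : PlanarOrder D I lt) (h0 : ∀ u v, m .adj u v = 0) (hM : ∀ u, m .inM u 0 = 0) :
    Tr (2 * D.n) modifiedUntangle m (5000 * D.n ^ 3)
      (fun _ m' => Fr modifiedUntangleArrs m m' ∧ PairsOk D I m' ∧ ∃ lt' X', UState D I m' lt' X' ∧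
        ∀ σ, ∀ x ∈ X' σ, x < D.n) := by
  intro t
  have hpos := D.pos
  have hn2 : D.n ≤ D.n ^ 2 := Nat.le_self_pow (by simp) _
  have hn3 : D.n ^ 2 ≤ D.n ^ 3 := Nat.pow_le_pow_right hpos (by simp)
  simp only [modifiedUntangle, wps]
  refine (tr_induceTrees hm hJ ho.bound).use ?_
  rintro _ m₁ t₁ ⟨hf₁, hr₁⟩ ht₁
  have hm₁ := hm.frame hf₁
  have hJ₁ := hJ.frame hf₁
  refine (tr_boolTable hm₁ hJ₁ (by rw [hf₁ _ (by simp)]; exact h0)).use ?_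
  rintro _ m₂ t₂ ⟨hf₂, ha₂⟩ ht₂
  have hm₂ := hm₁.frame hf₂
  have hr₂ : ∀ σ, RedOk D m₂ I σ (2 * D.n - 1) := fun σ => (hr₁ σ).frame hf₂
  rw [hm₂.verts, show 2 * D.n - 1 - 1 = 2 * D.n - 2 by omega]
  have hroot : ∀ σ, D.E σ I (2 * D.n - 2) = I := fun σ => by
    ext i
    rw [mem_E]
    exact ⟨fun h => h.1, fun h => ⟨h, D.root σ _ (D.e_lt (ho.bound i h))⟩⟩
  have hx : ∀ σ, m₂ (.red σ) (2 * D.n - 2) 0 < 2 * D.n - 1 ∧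
      D.E σ I (m₂ (.red σ) (2 * D.n - 2) 0) = I ∧ (m₂ (.red σ) (2 * D.n - 2) 0 < D.n ∨
        D.Branching σ I (m₂ (.red σ) (2 * D.n - 2) 0)) := fun σ => by
    obtain ⟨h1, h2⟩ := hr₂ σ (2 * D.n - 2) (by omega)
    rw [hroot] at h2
    exact ⟨by omega, h2 hI⟩
  refine ⟨by omega, by omega, by omega, by omega, by omega, by omega, by omega, by omega,
    by omega, by omega, by omega, by omega, by omega, by omega, ?_⟩
  generalize hm₃ : upd _ _ _ _ _ = m₃
  have hf₃ : Fr untangleArrs m₂ m₃ := by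
    rw [← hm₃]
    refine ((((Fr.refl _ _).upd ?_).upd ?_).upd ?_).upd ?_ <;> simp [untangleArrs]
  have hs₃ : UState D I m₃ lt (fun σ => [m₂ (.red σ) (2 * D.n - 2) 0]) := by
    refine ⟨hm₂.frame hf₃ (by simp [untangleArrs, Arr.isStatic]),
      fun σ => (hr₂ σ).frame hf₃ (by simp [untangleArrs]), ?_, ho, ?_,
      fun σ => refined_singleton hI (hx σ).1 (hx σ).2.1 (hx σ).2.2⟩
    · intro u v hu hv
      unfold AdjOk; rw [hf₃ _ (by simp [untangleArrs])]; exact ha₂ u v hu hv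
    · intro σ
      rw [← hm₃]
      cases σ <;> simp [Lst, upd]
  have hp₃ : PairsOk D I m₃ := by
    intro u _ hu
    rw [← hm₃] at hu
    simp only [upd, reduceCtorEq, false_and, if_false] at hu
    rw [hf₂ _ (by simp), hf₁ _ (by simp)] at hu
    exact absurd (hM u) hu
  -- Every pass makes two steps, each adding one to a total length that starts at 2. As this length
  -- never exceeds 2n, the 2n - 1 passes must have reached lists of leaves.
  refine (tr_forUp (c := 1000 * D.n ^ 2) (fun k m' => Fr untangleArrs m₃ m' ∧ PairsOk D I m' ∧
    ∃ lt' X', UState D I m' lt' X' ∧ ((∀ σ, ∀ x ∈ X' σ, x < D.n) ∨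
      2 * k + 2 ≤ (X' .T).length + (X' .S).length))
    ⟨Fr.refl _ _, hp₃, _, _, hs₃, Or.inr (by simp)⟩ ?_).use ?_
  · rintro k m₄ hk ⟨hf₄, hp₄, lt₄, X₄, hs₄, hl₄⟩ t
    simp only [wps]
    refine (hs₄.tr_untangleStep hp₄).use ?_
    rintro _ m₅ t₅ ⟨hf₅, hp₅, lt₅, X₅, hs₅, hl₅⟩ ht₅
    refine (hs₅.tr_untangleStep hp₅).use ?_
    rintro _ m₆ t₆ ⟨hf₆, hp₆, lt₆, X₆, hs₆, hl₆⟩ ht₆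
    refine ⟨⟨(hf₄.trans hf₅).trans hf₆, hp₆, lt₆, X₆, hs₆, ?_⟩, by omega⟩
    rcases hl₆ with hl₆ | ⟨h6, hl₆⟩
    · exact Or.inl hl₆
    rcases hl₅ with hl₅ | ⟨h5, hl₅⟩
    · exact absurd hl₅ h6
    rcases hl₄ with hl₄ | hl₄
    · exact absurd hl₄ h5
    · right; omega
  · rintro _ m₄ t₄ ⟨hf₄, hp₄, lt₄, X₄, hs₄, hl₄⟩ ht₄
    refine ⟨⟨?_, hp₄, lt₄, X₄, hs₄, ?_⟩, ?_⟩
    · refine (hf₁.mono ?_).trans ((hf₂.mono ?_).trans ((hf₃.trans hf₄).mono ?_)) <;>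
        simp [modifiedUntangleArrs, untangleArrs]
    · refine hl₄.resolve_right fun h => ?_
      have h1 := hs₄.length_le .T
      have h2 := hs₄.length_le .S
      omega
    · have : (2 * D.n - 1) * (1000 * D.n ^ 2 + 1) ≤ 2 * D.n * (1001 * D.n ^ 2) := by
        gcongr <;> omega
      have e : 2 * D.n * (1001 * D.n ^ 2) = 2002 * D.n ^ 3 := by ring
      omega

/-! ### Layouts -/

/-- The lists `X` form a layout of the subtanglegram induced by `J`. -/
structure Layout (D : TreePair) (J : Finset ℕ) (X : Side → List ℕ) : Prop where
  bound : ∀ j ∈ J, j < D.n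
  nodup : ∀ σ, (X σ).Nodup
  mem : ∀ σ x, x ∈ X σ ↔ ∃ j ∈ J, D.e σ j = x
  convex : ∀ σ, ∀ v < 2 * D.n - 1, Convex (X σ) (D.L σ v)

/-- The endpoint of the edge `i` on side `σ` is above that of `j`. -/
def Before (D : TreePair) (X : Side → List ℕ) (σ : Side) (i j : ℕ) : Prop :=
  (X σ).idxOf (D.e σ i) < (X σ).idxOf (D.e σ j)

instance : DecidableRel (Before D X σ) := fun _ _ => inferInstanceAs (Decidable (_ < _))

/-- The edges `i` and `j` cross. -/
def Cross (D : TreePair) (X : Side → List ℕ) (i j : ℕ) : Prop :=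
  Before D X .T i j ∧ Before D X .S j i ∨ Before D X .T j i ∧ Before D X .S i j

instance : DecidableRel (Cross D X) := fun _ _ => inferInstanceAs (Decidable (_ ∨ _))

/-- Once both lists consist of leaves, both are sorted by the same order `lt`. Convexity of the leaf
sets and absence of crossings are inherited from it. -/
theorem UState.before (h : UState D I m lt X) (hl : ∀ σ, ∀ x ∈ X σ, x < D.n) {i j : ℕ}
    (hi : i ∈ I) (hj : j ∈ I) (hij : Before D X σ i j) : lt i j := by
  have key : ∀ i ∈ I, D.e σ i ∈ X σ ∧ i ∈ D.E σ I (D.e σ i) := by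
    intro i hi
    obtain ⟨x, hx, hix⟩ := (h.ref σ).cover i hi
    have := (E_leaf (hl σ x hx)).1 hix
    rw [this.2]
    exact ⟨hx, hix⟩
  obtain ⟨h1, h2⟩ := key i hi
  obtain ⟨h3, h4⟩ := key j hj
  have g : ∀ {x}, x ∈ X σ → (X σ).getD ((X σ).idxOf x) 0 = x := fun {x} hx => by
    rw [List.getD_eq_getElem _ _ (List.idxOf_lt_length_of_mem hx), List.getElem_idxOf]
  refine (h.ref σ).pos_lt (List.idxOf_lt_length_of_mem h1) (List.idxOf_lt_length_of_mem h3) hij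
    ?_ ?_
  · rwa [g h1]
  · rwa [g h3]

theorem UState.layout (h : UState D I m lt X) (hl : ∀ σ, ∀ x ∈ X σ, x < D.n) :
    Layout D I X := by
  have hmem : ∀ σ x, x ∈ X σ ↔ ∃ j ∈ I, D.e σ j = x := by
    intro σ x
    constructor
    · intro hx
      obtain ⟨i, hi⟩ := ((h.ref σ).vert x hx).2.1
      exact ⟨i, (E_leaf (hl σ x hx)).1 hi⟩
    · rintro ⟨i, hi, rfl⟩
      obtain ⟨x, hx, hix⟩ := (h.ref σ).cover i hi
      rwa [((E_leaf (hl σ x hx)).1 hix).2]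
  refine ⟨h.order.bound, ?_, hmem, ?_⟩
  · intro σ
    refine (h.ref σ).sorted.imp_of_mem fun {x y} hx hy hxy e => ?_
    subst e
    obtain ⟨i, hi⟩ := ((h.ref σ).vert x hx).2.1
    exact h.order.irrefl i (E_subset hi) (hxy i hi i hi)
  · intro σ v hv a ha b hb c hc hab hbc haS hcS
    rw [hmem] at ha hb hc
    obtain ⟨i, hi, rfl⟩ := ha
    obtain ⟨j, hj, rfl⟩ := hb
    obtain ⟨k, hk, rfl⟩ := hc
    exact (D.mem_E.1 (h.order.convex σ v hv i hi j hj k hk (h.before hl hi hj hab)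
      (h.before hl hj hk hbc) (D.mem_E.2 ⟨hi, haS⟩) (D.mem_E.2 ⟨hk, hcS⟩))).2

theorem UState.not_cross (h : UState D I m lt X) (hl : ∀ σ, ∀ x ∈ X σ, x < D.n) {i j : ℕ}
    (hi : i ∈ I) (hj : j ∈ I) : ¬ Cross D X i j := by
  have key : ∀ {i j}, i ∈ I → j ∈ I → ∀ {σ τ}, Before D X σ i j → Before D X τ j i → False :=
    fun {i j} hi hj {σ τ} h1 h2 => h.order.irrefl i hi (h.order.trans i hi j hj i hi
      (h.before hl hi hj h1) (h.before hl hj hi h2))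
  rintro (⟨h1, h2⟩ | ⟨h1, h2⟩)
  exacts [key hi hj h1 h2, key hj hi h1 h2]

end Tangle

/-! ### Flips, paired flips and subtree switches as toggles of crossings -/

namespace Tangle
open TreePair

variable {D : TreePair} {I J : Finset ℕ} {σ τ : Side} {X : Side → List ℕ} {m : Mem} {i : ℕ}

/-- The layout `X` of the subtanglegram induced by `J` is in memory. -/
structure LState (D : TreePair) (m : Mem) (J : Finset ℕ) (X : Side → List ℕ) : Prop where
  static : Static D m
  layout : Layout D J X
  lst : ∀ σ, Lst m σ (X σ)

theorem LState.frame (h : LState D m J X) {m' : Mem} {l : List Arr} (hf : Fr l m m')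
    (hl : (∀ a ∈ l, a.isStatic = false) ∧ (∀ σ, .len σ ∉ l ∧ .lay σ ∉ l) :=
      by simp [Arr.isStatic]) : LState D m' J X :=
  ⟨h.static.frame hf hl.1, h.layout, fun σ => (h.lst σ).frame hf (hl.2 σ)⟩

theorem Layout.lt (h : Layout D J X) {x : ℕ} (hx : x ∈ X σ) : x < D.n := by
  obtain ⟨j, hj, rfl⟩ := (h.mem σ x).1 hx
  exact D.e_lt (h.bound j hj)

theorem Layout.length_le (h : Layout D J X) (σ : Side) : (X σ).length ≤ D.n := by
  have h1 : (X σ).toFinset ⊆ Finset.range D.n := fun x hx => by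
    simpa using h.lt (List.mem_toFinset.1 hx)
  have := Finset.card_le_card h1
  rwa [List.toFinset_card_of_nodup (h.nodup σ), Finset.card_range] at this

theorem Layout.e_mem (h : Layout D J X) {j : ℕ} (hj : j ∈ J) : D.e σ j ∈ X σ :=
  (h.mem σ _).2 ⟨j, hj, rfl⟩

theorem Layout.before_total (h : Layout D J X) {a b : ℕ} (ha : a ∈ J) (hb : b ∈ J)
    (hab : a ≠ b) : Before D X σ b a ↔ ¬ Before D X σ a b := by
  have hne : (X σ).idxOf (D.e σ a) ≠ (X σ).idxOf (D.e σ b) := fun he =>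
    hab (D.e_inj (h.bound a ha) (h.bound b hb) ((List.idxOf_inj (h.e_mem ha)).1 he))
  unfold Before
  omega

theorem cross_comm {a b : ℕ} : Cross D X a b ↔ Cross D X b a := by
  unfold Cross; tauto

theorem not_cross_self {a : ℕ} : ¬ Cross D X a a := by
  unfold Cross Before; omega

theorem Layout.cross_iff (h : Layout D J X) {a b : ℕ} (ha : a ∈ J) (hb : b ∈ J)
    (hab : a ≠ b) : Cross D X a b ↔ ¬ (Before D X .T a b ↔ Before D X .S a b) := by
  unfold Cross
  rw [h.before_total ha hb hab, h.before_total ha hb hab]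
  tauto

theorem not_iff_not_iff_iff (p q : Prop) : ¬ (¬ (p ↔ q) ↔ q) ↔ p := by
  by_cases p <;> by_cases q <;> simp [*]

/-- The layout `X'` arises from `X` by reversing the order of the edges with the property `P` on
one side. -/
def FlipRel (D : TreePair) (J : Finset ℕ) (P : ℕ → Prop) (X X' : Side → List ℕ) : Prop :=
  ∀ a ∈ J, ∀ b ∈ J, a ≠ b → (Cross D X' a b ↔ ¬ (Cross D X a b ↔ P a ∧ P b))

/-- The relative order on one side is reversed for exactly the pairs of edges both ending below v.
Writing the effect as an exclusive or makes successive flips easy to compose. -/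
theorem LState.tr_flip (h : LState D m J X) {v : ℕ} (hv : v < 2 * D.n - 1) :
    Tr (2 * D.n) (flip σ v) m (50 * D.n) (fun _ m' => Fr [.lay σ, .tmp] m m' ∧
      ∃ X', LState D m' J X' ∧ FlipRel D J (fun a => D.e σ a ∈ D.L σ v) X X') := by
  have hnd := h.layout.nodup σ
  obtain ⟨A, B, C, hX, hA, hB, hC⟩ := (h.layout.convex σ v hv).split hnd
  have hl := h.lst σ
  have hlen := h.layout.length_le σ
  rw [hX] at hl hnd hlen
  refine Tr.mono (tr_flip_list h.static hl hlen (fun x hx => h.layout.lt (σ := σ) (hX ▸ hx)) hv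
    hA hB hC) le_rfl ?_
  rintro _ m' ⟨hf, hl'⟩
  have hL : LState D m' J (fun τ => if τ = σ then A ++ B.reverse ++ C else X τ) := by
    have hmem : ∀ a, a ∈ A ++ B.reverse ++ C ↔ a ∈ A ++ B ++ C := by simp
    refine ⟨h.static.frame hf, ⟨h.layout.bound, ?_, ?_, ?_⟩, ?_⟩
    · intro τ
      by_cases hτ : τ = σ
      · simp only [hτ, if_true]
        refine (List.Perm.nodup_iff ?_).2 hnd
        exact ((List.reverse_perm B).append_left A).append_right C
      · simp only [hτ, if_false]; exact h.layout.nodup τ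
    · intro τ x
      by_cases hτ : τ = σ
      · simp only [hτ, if_true]
        rw [hmem, ← hX]; exact h.layout.mem σ x
      · simp only [hτ, if_false]; exact h.layout.mem τ x
    · intro τ w hw
      by_cases hτ : τ = σ
      · simp only [hτ, if_true]
        have c := h.layout.convex σ
        rw [hX] at c
        refine (c v hv).flip (c w hw) (L_laminar D σ hv hw) hmem
          (fun a ha b hb e => (List.idxOf_inj ha).1 e) fun a ha b hb => ?_
        exact idxOf_flip hnd hA hB hC ha hb
      · simp only [hτ, if_false]; exact h.layout.convex τ w hw
    · intro τ
      by_cases hτ : τ = σ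
      · subst hτ; simpa using hl'
      · simp only [hτ, if_false]
        exact (h.lst τ).frame hf ⟨by simp, by simpa using hτ⟩
  refine ⟨hf, _, hL, fun a ha b hb hab => ?_⟩
  have key := idxOf_flip hnd hA hB hC (hX ▸ h.layout.e_mem (σ := σ) ha)
    (hX ▸ h.layout.e_mem (σ := σ) hb)
  rw [← hX] at key
  have k₁ : Before D (fun τ => if τ = σ then A ++ B.reverse ++ C else X τ) σ a b ↔
      ¬ (Before D X σ a b ↔ D.e σ a ∈ D.L σ v ∧ D.e σ b ∈ D.L σ v) := by
    have := h.layout.before_total (σ := σ) ha hb hab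
    unfold Before at this ⊢
    beta_reduce
    rw [if_pos rfl, key]
    split_ifs with h' <;> simp [h', this]
  have k₂ : ∀ τ, τ ≠ σ → (Before D (fun τ => if τ = σ then A ++ B.reverse ++ C else X τ) τ a b ↔
      Before D X τ a b) := by
    intro τ hτ
    unfold Before
    beta_reduce
    rw [if_neg hτ]
  rw [hL.layout.cross_iff ha hb hab, h.layout.cross_iff ha hb hab]
  cases σ
  · rw [k₁, k₂ .S (by simp)]
    by_cases h1 : Before D X .T a b <;> by_cases h2 : Before D X .S a b <;> simp [h1, h2]
  · rw [k₁, k₂ .T (by simp)]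
    by_cases h1 : Before D X .T a b <;> by_cases h2 : Before D X .S a b <;> simp [h1, h2]

/-- The changes of the layout do not affect the crossings among the edges in `J`, and toggle those
of the edge `i` with the edges with the property `P`. -/
def Toggle (D : TreePair) (J : Finset ℕ) (i : ℕ) (P : ℕ → Prop) (X X' : Side → List ℕ) : Prop :=
  (∀ a ∈ J, ∀ b ∈ J, Cross D X' a b ↔ Cross D X a b) ∧
  ∀ b ∈ J, (Cross D X' i b ↔ ¬ (Cross D X i b ↔ P b))

/-- The arrays that are changed by operations on layouts. -/
def layoutArrs : List Arr := [.lay .T, .lay .S, .tmp, .pos .T, .pos .S]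

theorem flip_subset_layoutArrs : [Arr.lay σ, .tmp] ⊆ layoutArrs := by
  cases σ <;> simp [layoutArrs]

/-- The vertices `v` on side `σ` and `u` on the opposite side are above the same edges in `J`, and
of these two only `v` is above the edge `i`. -/
structure ChainPair (D : TreePair) (J : Finset ℕ) (i : ℕ) (σ : Side) (v u : ℕ) : Prop where
  v_lt : v < 2 * D.n - 1
  u_lt : u < 2 * D.n - 1
  same : D.E σ J v = D.E σ.other J u
  above : D.e σ i ∈ D.L σ v
  not_above : D.e σ.other i ∉ D.L σ.other u
  branching : D.Branching σ J v

/-- On pairs in J the two flips cancel, as v and its mate are above the same edges. The edge i is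
below v but not below the mate, so only the first flip concerns it. -/
theorem LState.tr_pairedFlip (h : LState D m (insert i J) X) (hi : i ∉ J) {v : ℕ}
    (hc : ChainPair D J i σ v (m (.mate σ) v 0)) :
    Tr (2 * D.n) (pairedFlip σ v) m (110 * D.n) (fun _ m' => Fr layoutArrs m m' ∧
      ∃ X', LState D m' (insert i J) X' ∧ Toggle D J i (fun b => D.e σ b ∈ D.L σ v) X X') := by
  intro t
  have hpos := D.pos
  have hv := hc.v_lt
  simp only [pairedFlip, wps]
  refine (h.tr_flip hv).use ?_
  rintro _ m₁ t₁ ⟨hf₁, X₁, h₁, hX₁⟩ ht₁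
  refine ⟨by omega, by omega, ?_⟩
  rw [hf₁ _ (by simp)]
  refine (h₁.tr_flip hc.u_lt).use ?_
  rintro _ m₂ t₂ ⟨hf₂, X₂, h₂, hX₂⟩ ht₂
  refine ⟨⟨(hf₁.mono flip_subset_layoutArrs).trans (hf₂.mono flip_subset_layoutArrs), X₂, h₂,
    ?_, ?_⟩, by omega⟩
  · intro a ha b hb
    by_cases hab : a = b
    · subst hab; exact iff_of_false not_cross_self not_cross_self
    rw [hX₂ a (by simp [ha]) b (by simp [hb]) hab, hX₁ a (by simp [ha]) b (by simp [hb]) hab]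
    have ea := Finset.ext_iff.1 hc.same a
    have eb := Finset.ext_iff.1 hc.same b
    simp only [mem_E, ha, hb, true_and] at ea eb
    beta_reduce
    rw [ea, eb]
    exact not_iff_not_iff_iff _ _
  · intro b hb
    have hib : i ≠ b := by rintro rfl; exact hi hb
    rw [hX₂ i (by simp) b (by simp [hb]) hib, hX₁ i (by simp) b (by simp [hb]) hib]
    simp [hc.above, hc.not_above]

/-- The vertex `w` is the parent of the endpoint of `i` on side `σ` in the tree induced by
`insert i J`. -/
structure IsParent (D : TreePair) (J : Finset ℕ) (i : ℕ) (σ : Side) (w : ℕ) : Prop where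
  le : D.n ≤ w
  lt : w < 2 * D.n - 1
  above : D.e σ i ∈ D.L σ w
  nonempty : (D.E σ J w).Nonempty
  lowest : ∀ v < w, D.e σ i ∈ D.L σ v → D.E σ J v = ∅

/-- The child of w above the endpoint of i has a smaller number than w, so by minimality of w it has
no edge in J below it. All edges of J below w are thus below the other child. -/
theorem IsParent.child {w : ℕ} (h : IsParent D J i σ w) : ∃ b,
    D.e σ i ∈ D.L σ (D.ch σ b w) ∧ D.e σ i ∉ D.L σ (D.ch σ (!b) w) ∧
    ∀ j ∈ J, D.e σ j ∉ D.L σ (D.ch σ b w) ∧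
      (D.e σ j ∈ D.L σ (D.ch σ (!b) w) ↔ D.e σ j ∈ D.L σ w) := by
  have key : ∀ b, D.e σ i ∈ D.L σ (D.ch σ b w) → ∀ j ∈ J, D.e σ j ∉ D.L σ (D.ch σ b w) := by
    intro b hb j hj hjb
    have := h.lowest _ (D.ch_lt σ b w h.le h.lt) hb
    exact Finset.notMem_empty j (this ▸ D.mem_E.2 ⟨hj, hjb⟩)
  have hn := fun x => D.L_node σ w x h.le h.lt
  rcases (hn _).1 h.above with hb | hb
  · refine ⟨false, hb, D.disj σ w _ h.le h.lt hb, fun j hj => ⟨key _ hb j hj, ?_⟩⟩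
    have := key _ hb j hj
    rw [hn]; simp [this]
  · refine ⟨true, hb, fun hb' => D.disj σ w _ h.le h.lt hb' hb, fun j hj => ⟨key _ hb j hj, ?_⟩⟩
    have := key _ hb j hj
    rw [hn]; simp [this]

/-- One child of w is above i and no edge in J, and the other is above all edges of J below w. The
flip at the latter undoes the flip at w on J, so only the crossings of i remain toggled. -/
theorem LState.tr_subtreeSwitch (h : LState D m (insert i J) X) (hi : i ∉ J) {w : ℕ}
    (hw : IsParent D J i σ w) :
    Tr (2 * D.n) (subtreeSwitch σ w) m (160 * D.n) (fun _ m' => Fr layoutArrs m m' ∧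
      ∃ X', LState D m' (insert i J) X' ∧ Toggle D J i (fun b => D.e σ b ∈ D.L σ w) X X') := by
  intro t
  have hpos := D.pos
  have hwlt := hw.lt
  have hcl : ∀ b, D.ch σ b w < 2 * D.n - 1 := fun b => ch_lt' hw.le hw.lt
  simp only [subtreeSwitch, wps]
  refine (h.tr_flip hw.lt).use ?_
  rintro _ m₁ t₁ ⟨hf₁, X₁, h₁, hX₁⟩ ht₁
  rw [h₁.static.child σ _ w hw.le hw.lt, h₁.static.child σ _ w hw.le hw.lt]
  refine ⟨by omega, by omega, by omega, by omega, ?_⟩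
  refine (h₁.tr_flip (hcl false)).use ?_
  rintro _ m₂ t₂ ⟨hf₂, X₂, h₂, hX₂⟩ ht₂
  refine (h₂.tr_flip (hcl true)).use ?_
  rintro _ m₃ t₃ ⟨hf₃, X₃, h₃, hX₃⟩ ht₃
  refine ⟨⟨((hf₁.trans hf₂).trans hf₃).mono flip_subset_layoutArrs, X₃, h₃, ?_, ?_⟩, by omega⟩
  · intro a ha b hb
    by_cases hab : a = b
    · subst hab; exact iff_of_false not_cross_self not_cross_self
    rw [hX₃ a (by simp [ha]) b (by simp [hb]) hab, hX₂ a (by simp [ha]) b (by simp [hb]) hab,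
      hX₁ a (by simp [ha]) b (by simp [hb]) hab]
    obtain ⟨c, -, -, hc⟩ := hw.child
    obtain ⟨ha1, ha2⟩ := hc a ha
    obtain ⟨hb1, hb2⟩ := hc b hb
    beta_reduce
    rw [← ha2, ← hb2]
    cases c <;> simp only [ha1, false_and, iff_false, not_not, Bool.not_false, Bool.not_true]
    · exact not_iff_not_iff_iff _ _
    · exact not_iff_not_iff_iff _ _
  · intro b hb
    have hib : i ≠ b := by rintro rfl; exact hi hb
    rw [hX₃ i (by simp) b (by simp [hb]) hib, hX₂ i (by simp) b (by simp [hb]) hib,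
      hX₁ i (by simp) b (by simp [hb]) hib]
    obtain ⟨c, hc1, hc2, hc⟩ := hw.child
    obtain ⟨hb1, hb2⟩ := hc b hb
    cases c <;> simp only [Bool.not_false, Bool.not_true] at hc1 hc2 hb1 hb2 <;>
      simp [hc1, hc2, hb1, hw.above]

/-! ### Positions and crossings -/

/-- The arrays `pos` hold the positions of the leaves. -/
def PosOk (m : Mem) (X : Side → List ℕ) : Prop :=
  ∀ σ, ∀ x ∈ X σ, m (.pos σ) x 0 = (X σ).idxOf x

theorem LState.tr_positions (h : LState D m J X) :
    Tr (2 * D.n) (do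
      let l ← rdVar (.len σ)
      forUp l (fun k => do
        let x ← rd (.lay σ) k
        wr (.pos σ) x k)) m (10 * D.n) (fun _ m' => Fr [.pos σ] m m' ∧
      ∀ x ∈ X σ, m' (.pos σ) x 0 = (X σ).idxOf x) := by
  intro t
  have hpos := D.pos
  have hl := h.layout.length_le σ
  simp only [wps]
  rw [(h.lst σ).1]
  refine ⟨by omega, by omega, ?_⟩
  refine (tr_forUp (c := 4) (fun k m' => Fr [.pos σ] m m' ∧
    ∀ j < k, m' (.pos σ) ((X σ).getD j 0) 0 = j) ⟨Fr.refl _ _, by simp⟩ ?_).use ?_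
  · rintro k m₁ hk ⟨hf, hk'⟩ t
    have hx := h.layout.lt (getD_mem hk)
    simp only [wps]
    rw [hf _ (by simp), (h.lst σ).2 k hk]
    refine ⟨by omega, by omega, by omega, by omega, ⟨hf.upd (by simp), ?_⟩, by omega⟩
    intro j hj
    rw [upd_zero]
    split_ifs with hjk
    · rw [List.getD_eq_getElem _ _ (by omega), List.getD_eq_getElem _ _ hk,
        (h.layout.nodup σ).getElem_inj_iff] at hjk
      exact hjk.symm
    · refine hk' j ?_
      rcases Nat.lt_succ_iff_lt_or_eq.1 hj with h' | rfl
      exacts [h', absurd rfl hjk]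
  · rintro _ m₁ t₁ ⟨hf, hk⟩ ht₁
    refine ⟨⟨hf, fun x hx => ?_⟩, by omega⟩
    have hlt := List.idxOf_lt_length_of_mem hx
    have := hk _ hlt
    rwa [List.getD_eq_getElem _ _ hlt, List.getElem_idxOf] at this

theorem LState.tr_findPositions (h : LState D m J X) :
    Tr (2 * D.n) findPositions m (20 * D.n)
      (fun _ m' => Fr [.pos .T, .pos .S] m m' ∧ PosOk m' X) := by
  intro t
  unfold findPositions
  rw [(wps _ _ _).1]
  refine (h.tr_positions (σ := .T)).use ?_
  rintro _ m₁ t₁ ⟨hf₁, hT⟩ ht₁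
  refine ((h.frame hf₁).tr_positions (σ := .S)).use ?_
  rintro _ m₂ t₂ ⟨hf₂, hS⟩ ht₂
  refine ⟨⟨(hf₁.mono (by simp)).trans (hf₂.mono (by simp)), fun σ => ?_⟩, by omega⟩
  cases σ
  · rw [hf₂ _ (by simp)]; exact hT
  · exact hS

theorem LState.test_cross (h : LState D m J X) (hp : PosOk m X) {a b : ℕ} (ha : a ∈ J)
    (hb : b ∈ J) : Test (2 * D.n) (cross a b) m 50 (Cross D X a b) := by
  intro t
  have ha' := h.layout.bound a ha
  have hb' := h.layout.bound b hb
  have eb : ∀ σ, ∀ c ∈ J, D.e σ c < 2 * D.n := fun σ c hc => by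
    have := D.e_lt (σ := σ) (h.layout.bound c hc); omega
  have ea1 := eb .T a ha
  have ea2 := eb .S a ha
  have eb1 := eb .T b hb
  have eb2 := eb .S b hb
  simp only [cross, wps, h.static.edge _ a ha', h.static.edge _ b hb',
    hp _ _ (h.layout.e_mem ha), hp _ _ (h.layout.e_mem hb)]
  refine ⟨by omega, by omega, by omega, by omega, by omega, by omega, by omega, by omega,
    by omega, by omega, by omega, by omega, by omega, by omega, by omega, by omega, ?_⟩
  refine Tr.use (Test.either (Test.both (test_lt _ _ _ _) fun _ => test_lt _ _ _ _)
    (Test.both (test_lt _ _ _ _) fun _ => test_lt _ _ _ _)) ?_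
  rintro x m' t' ⟨rfl, hx⟩ ht
  exact ⟨⟨rfl, hx⟩, by omega⟩

end Tangle

namespace Tangle
open TreePair

/-! ### Optimized operations -/

variable {D : TreePair} {I J : Finset ℕ} {σ τ : Side} {X X' : Side → List ℕ} {m : Mem} {i : ℕ}

/-- The edges in `J` with an endpoint in `leaf(a) ∖ leaf(b)` on side `σ`. -/
def TreePair.between (D : TreePair) (σ : Side) (J : Finset ℕ) (a b : ℕ) : Finset ℕ :=
  J.filter fun j => D.e σ j ∈ D.L σ a ∧ D.e σ j ∉ D.L σ b

theorem TreePair.mem_between {a b j : ℕ} :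
    j ∈ D.between σ J a b ↔ j ∈ J ∧ D.e σ j ∈ D.L σ a ∧ D.e σ j ∉ D.L σ b := by simp [between]

theorem test_inE (hm : Static D m) (hJ : InJ D m J) {a b j : ℕ} (ha : a < 2 * D.n - 1)
    (hb : b < 2 * D.n - 1) (hj : j < D.n) :
    Test (2 * D.n) (inE σ a b j) m 15 (j ∈ D.between σ J a b) := by
  refine Test.congr (Test.both (c := 2) (d := 10)
    ((test_rd (by omega)).congr le_rfl (hJ j hj)) fun _ t => ?_) le_rfl mem_between.symm
  simp only [wps, hm.edge σ j hj]
  refine ⟨by omega, by omega, ?_⟩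
  refine Tr.use (Test.both (test_leq hm ha (D.e_lt hj))
    fun _ => Test.negate (test_leq hm hb (D.e_lt hj))) ?_
  rintro a m' t' ⟨rfl, h⟩ ht
  exact ⟨⟨rfl, h⟩, by omega⟩

/-- "More than half" is tested without arithmetic, by comparing the numbers of crossed and of
uncrossed edges. -/
theorem LState.tr_crossesMost (h : LState D m (insert i J) X) (hJ : InJ D m J) {a b : ℕ}
    (ha : a < 2 * D.n - 1) (hb : b < 2 * D.n - 1) :
    Tr (2 * D.n) (crossesMost i σ a b) m (180 * D.n) (fun r m' => Fr [.pos .T, .pos .S] m m' ∧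
      (r ≠ 0 ↔ ((D.between σ J a b).filter fun j => ¬ Cross D X i j).card <
        ((D.between σ J a b).filter fun j => Cross D X i j).card)) := by
  intro t
  have hpos := D.pos
  simp only [crossesMost, wps]
  refine h.tr_findPositions.use ?_
  rintro _ m₁ t₁ ⟨hf, hp⟩ ht₁
  have h₁ := h.frame hf
  have hJ₁ : InJ D m₁ J := hJ.frame hf 
  have hE : ∀ j < D.n, Test (2 * D.n) (inE σ a b j) m₁ 15 (j ∈ D.between σ J a b) :=
    fun j hj => test_inE h₁.static hJ₁ ha hb hj
  have hC : ∀ j ∈ D.between σ J a b, Test (2 * D.n) (cross i j) m₁ 50 (Cross D X i j) :=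
    fun j hj => h₁.test_cross hp (by simp) (by simp [(mem_between.1 hj).1])
  have hsub : ∀ j ∈ D.between σ J a b, j < D.n := fun j hj =>
    h.layout.bound j (by simp [(mem_between.1 hj).1])
  have hcard : ∀ (p : ℕ → Prop) [DecidablePred p],
      ((Finset.range D.n).filter fun j => j ∈ D.between σ J a b ∧ p j) =
        (D.between σ J a b).filter p := by
    intro p _
    ext j
    simp only [Finset.mem_filter, Finset.mem_range]
    exact ⟨fun h => h.2, fun h => ⟨hsub j h.1, h⟩⟩
  rw [h₁.static.size]
  refine ⟨by omega, by omega, ?_⟩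
  refine (tr_count _ fun j hj => Test.both (hE j hj) (hC j)).use ?_
  rintro c m₂ t₂ ⟨rfl, rfl⟩ ht₂
  refine (tr_count _ fun j hj => Test.both (hE j hj) fun hj => (hC j hj).negate).use ?_
  rintro d m₃ t₃ ⟨rfl, rfl⟩ ht₃
  refine (test_lt _ _ _ _).use ?_
  rintro r m₄ t₄ ⟨rfl, hr⟩ ht₄
  rw [hcard, hcard] at hr
  exact ⟨⟨hf, hr⟩, by omega⟩

/-- The layouts agree in the crossings among the edges in `J`. -/
def SameOn (D : TreePair) (J : Finset ℕ) (X X' : Side → List ℕ) : Prop :=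
  ∀ a ∈ J, ∀ b ∈ J, Cross D X' a b ↔ Cross D X a b

theorem SameOn.refl (X : Side → List ℕ) : SameOn D J X X := fun _ _ _ _ => Iff.rfl

theorem SameOn.trans {X'' : Side → List ℕ} (h : SameOn D J X X') (h' : SameOn D J X' X'') :
    SameOn D J X X'' := fun a ha b hb => (h' a ha b hb).trans (h a ha b hb)

theorem Toggle.sameOn {P : ℕ → Prop} (h : Toggle D J i P X X') : SameOn D J X X' := h.1

/-- Among the edges in a nonempty set `S`, at least one is not crossed by `i` after an
optimization with respect to `S`. -/
theorem exists_not_cross {S : Finset ℕ} {P : ℕ → Prop} (hS : S ⊆ J) (hP : ∀ b ∈ S, P b)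
    (hne : S.Nonempty)
    (h : (Toggle D J i P X X' ∧
        (S.filter fun j => ¬ Cross D X i j).card < (S.filter fun j => Cross D X i j).card) ∨
      (X' = X ∧
        ¬ (S.filter fun j => ¬ Cross D X i j).card < (S.filter fun j => Cross D X i j).card)) :
    ∃ b ∈ S, ¬ Cross D X' i b := by
  -- If the operation was performed, the crossed edges, a strict majority, have become uncrossed. If
  -- not, at least half of a nonempty set was uncrossed already.
  rcases h with ⟨h, hlt⟩ | ⟨rfl, hlt⟩
  · obtain ⟨b, hb⟩ := Finset.card_pos.1 (by omega : 0 < (S.filter fun j => Cross D X i j).card)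
    rw [Finset.mem_filter] at hb
    exact ⟨b, hb.1, by simp [h.2 b (hS hb.1), hP b hb.1, hb.2]⟩
  · by_contra! hall
    rw [Finset.filter_false_of_mem (by simpa using hall), Finset.filter_true_of_mem hall] at hlt
    exact hlt (by simpa using hne)

theorem between_subset {a b : ℕ} : D.between σ J a b ⊆ J := Finset.filter_subset _ _

/-- That edges not below w are unaffected is recorded so that uncrossed edges found earlier stay
uncrossed. -/
theorem LState.tr_switchIf (h : LState D m (insert i J) X) (hJ : InJ D m J) (hi : i ∉ J) {w x : ℕ}
    (hw : IsParent D J i σ w) (hx : x < 2 * D.n - 1) :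
    Tr (2 * D.n) (switchIf i σ w x) m (350 * D.n) (fun _ m' => Fr layoutArrs m m' ∧
      ∃ X', LState D m' (insert i J) X' ∧ SameOn D J X X' ∧
        (∀ b ∈ J, D.e σ b ∉ D.L σ w → (Cross D X' i b ↔ Cross D X i b)) ∧
        ((D.between σ J w x).Nonempty → ∃ b ∈ D.between σ J w x, ¬ Cross D X' i b)) := by
  intro t
  have hpos := D.pos
  simp only [switchIf, wps]
  refine (h.tr_crossesMost hJ hw.lt hx).use ?_
  rintro r m₁ t₁ ⟨hf, hr⟩ ht₁
  have hf' : Fr layoutArrs m m₁ := hf.mono (by simp [layoutArrs])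
  split_ifs with h0
  · refine ⟨⟨hf', X, h.frame hf, SameOn.refl _, fun _ _ _ => Iff.rfl, fun hne => ?_⟩, by omega⟩
    exact exists_not_cross (P := fun _ => True) between_subset (by simp) hne
      (Or.inr ⟨rfl, by simpa [h0] using hr⟩)
  · refine ((h.frame hf).tr_subtreeSwitch hi hw).use ?_
    rintro _ m₂ t₂ ⟨hf₂, X', h', hX'⟩ ht₂
    refine ⟨⟨hf'.trans hf₂, X', h', hX'.1, fun b hb hbw => ?_, fun hne => ?_⟩, by omega⟩
    · rw [hX'.2 b hb]; simp [hbw]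
    · exact exists_not_cross between_subset (fun b hb => (mem_between.1 hb).2.1) hne
        (Or.inl ⟨hX', hr.1 h0⟩)

/-- A branching vertex v above i is properly above w: minimality of w excludes v < w, and v = w
fails because one child of w misses J. So w is below one child of v, and the other child supplies an
edge. -/
theorem IsParent.between_of_lt {w v : ℕ} (hw : IsParent D J i σ w) (hv : v < 2 * D.n - 1)
    (hi : D.e σ i ∈ D.L σ v) (hb : D.Branching σ J v) : (D.between σ J v w).Nonempty := by
  have hch : ∀ b, D.L σ (D.ch σ b v) ⊆ D.L σ v := fun b x hx => by
    rw [D.L_node σ v x hb.1 hv]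
    cases b
    exacts [Or.inl hx, Or.inr hx]
  have hwv : w < v := by
    rcases Nat.lt_trichotomy v w with h | rfl | h
    · have he := hw.lowest v h hi
      obtain ⟨j, hj⟩ := hb.2.2 true
      rw [mem_E] at hj
      exact absurd (D.mem_E.2 ⟨hj.1, hch _ hj.2⟩) (he ▸ Finset.notMem_empty j)
    · obtain ⟨b, -, -, h⟩ := hw.child
      obtain ⟨j, hj⟩ := hb.2.2 b
      rw [mem_E] at hj
      exact absurd hj.2 (h j hj.1).1
    · exact h
  rcases D.lam σ w v hwv hb.1 hv with ⟨b, hs⟩ | hd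
  · obtain ⟨j, hj⟩ := hb.2.2 (!b)
    rw [mem_E] at hj
    refine ⟨j, mem_between.2 ⟨hj.1, hch _ hj.2, fun hjw => ?_⟩⟩
    have := hs hjw
    cases b
    exacts [D.disj σ v _ hb.1 hv this hj.2, D.disj σ v _ hb.1 hv hj.2 this]
  · exact absurd hi (Finset.disjoint_left.1 hd hw.above)

/-- The array `chain` on side `σ` describes one of the chains for the insertion of the edge `i`. -/
def ChainOk (D : TreePair) (J : Finset ℕ) (i : ℕ) (m : Mem) (σ : Side) : Prop :=
  ∀ v < 2 * D.n - 1, m (.chain σ) v 0 ≠ 0 → ChainPair D J i σ v (m (.mate σ) v 0)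

theorem ChainOk.frame (h : ChainOk D J i m σ) {m' : Mem} {l : List Arr} (hf : Fr l m m')
    (hl : .chain σ ∉ l ∧ .mate σ ∉ l := by simp [layoutArrs]) : ChainOk D J i m' σ := by
  unfold ChainOk; rw [hf _ hl.1, hf _ hl.2]; exact h

/-- Later flips may destroy what earlier ones achieved, but the least vertex of the chain comes
last, so the edge gained there remains uncrossed. It lies outside the leaves below w, since the set
for the least vertex excludes these. -/
theorem LState.tr_flipChain (h : LState D m (insert i J) X) (hJ : InJ D m J) (hi : i ∉ J) {w : ℕ}
    (hw : IsParent D J i σ w) (hc : ChainOk D J i m σ) :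
    Tr (2 * D.n) (flipChain i σ w) m (700 * D.n ^ 2) (fun _ m' => Fr layoutArrs m m' ∧
      ∃ X', LState D m' (insert i J) X' ∧ SameOn D J X X' ∧
        ((∃ v < 2 * D.n - 1, m (.chain σ) v 0 ≠ 0) →
          ∃ b ∈ J, D.e σ b ∉ D.L σ w ∧ ¬ Cross D X' i b)) := by
  intro t
  have hpos := D.pos
  have hn2 : D.n ≤ D.n ^ 2 := Nat.le_self_pow (by simp) _
  simp only [flipChain, wps, h.static.verts]
  refine ⟨by omega, by omega, ?_⟩
  refine (tr_forDown (c := 310 * D.n) (fun k m' => Fr layoutArrs m m' ∧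
      ∃ X', LState D m' (insert i J) X' ∧ SameOn D J X X' ∧
        ∀ v < 2 * D.n - 1, k ≤ v → m (.chain σ) v 0 ≠ 0 →
          (∀ v' < v, m (.chain σ) v' 0 = 0) →
          ∃ b ∈ J, D.e σ b ∉ D.L σ w ∧ ¬ Cross D X' i b)
    ⟨Fr.refl _ _, X, h, SameOn.refl _, fun v hv hv' => by omega⟩ ?_).use ?_
  · rintro v m₁ hv ⟨hf, X₁, h₁, hs₁, hk⟩ t
    have hJ₁ : InJ D m₁ J := hJ.frame hf (by simp [layoutArrs])
    have hc₁ := hc.frame hf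
    simp only [wps]
    rw [hf (.chain σ) (by simp [layoutArrs])]
    refine ⟨by omega, by omega, ?_⟩
    split_ifs with h0
    · refine ⟨⟨hf, X₁, h₁, hs₁, fun v' hv' hle => ?_⟩, by omega⟩
      rcases Nat.eq_or_lt_of_le hle with rfl | hlt
      · exact fun hne => absurd h0 hne
      · exact hk v' hv' hlt
    · refine (tr_lastSuch (c := 2) (fun x => m (.chain σ) x 0 ≠ 0) fun x hx => ?_).use ?_
      · refine (test_rd (by omega)).congr le_rfl ?_
        rw [hf (.chain σ) (by simp [layoutArrs])]
      rintro v' m₂ t₂ ⟨rfl, hv'⟩ ht₂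
      have hv'lt : v' < 2 * D.n - 1 := by
        rcases hv' with ⟨rfl, -⟩ | ⟨hlt, -⟩
        exacts [hw.lt, by omega]
      refine (h₁.tr_crossesMost hJ₁ hv hv'lt).use ?_
      rintro r m₃ t₃ ⟨hf₃, hr⟩ ht₃
      have hf₃' : Fr layoutArrs m m₃ := hf.trans (hf₃.mono (by simp [layoutArrs]))
      have h₃ := h₁.frame hf₃
      have hcv : ChainPair D J i σ v (m₃ (.mate σ) v 0) := (hc₁.frame hf₃ :) v hv (by
        rw [hf₃ (.chain σ) (by simp), hf (.chain σ) (by simp [layoutArrs])]; exact h0)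
      have key : ∀ X₂, (Toggle D J i (fun b => D.e σ b ∈ D.L σ v) X₁ X₂ ∧ r ≠ 0) ∨
            (X₂ = X₁ ∧ r = 0) → (∀ v' < v, m (.chain σ) v' 0 = 0) →
          ∃ b ∈ J, D.e σ b ∉ D.L σ w ∧ ¬ Cross D X₂ i b := by
        intro X₂ hX₂ hleast
        -- For the least vertex of the chain, the search for a smaller one returns its default value
        -- w.
        have hvw : v' = w := by
          rcases hv' with ⟨h, -⟩ | ⟨hlt, hne, -⟩
          exacts [h, absurd (hleast v' hlt) hne]
        subst hvw
        obtain ⟨b, hb, hbc⟩ := exists_not_cross (P := fun b => D.e σ b ∈ D.L σ v)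
          between_subset (fun b hb => (mem_between.1 hb).2.1)
          (hw.between_of_lt hv hcv.above hcv.branching)
          (hX₂.imp (fun h => ⟨h.1, hr.1 h.2⟩) fun h => ⟨h.1, by rw [← hr]; simpa using h.2⟩)
        exact ⟨b, (mem_between.1 hb).1, (mem_between.1 hb).2.2, hbc⟩
      have done : ∀ X₂, (Toggle D J i (fun b => D.e σ b ∈ D.L σ v) X₁ X₂ ∧ r ≠ 0) ∨
            (X₂ = X₁ ∧ r = 0) → ∀ v₁ < 2 * D.n - 1, v ≤ v₁ → m (.chain σ) v₁ 0 ≠ 0 →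
          (∀ v' < v₁, m (.chain σ) v' 0 = 0) →
          ∃ b ∈ J, D.e σ b ∉ D.L σ w ∧ ¬ Cross D X₂ i b := by
        intro X₂ hX₂ v₁ _ hle _ hleast
        rcases Nat.eq_or_lt_of_le hle with rfl | hlt
        · exact key X₂ hX₂ hleast
        · exact absurd (hleast v hlt) h0
      have h5 : v * (2 + 3) ≤ 2 * D.n * 5 := by gcongr; omega
      split_ifs with hr0
      · exact ⟨⟨hf₃', X₁, h₃, hs₁, done X₁ (Or.inr ⟨rfl, hr0⟩)⟩, by omega⟩
      · refine (h₃.tr_pairedFlip hi hcv).use ?_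
        rintro _ m₄ t₄ ⟨hf₄, X₄, h₄, hX₄⟩ ht₄
        exact ⟨⟨hf₃'.trans hf₄, X₄, h₄, hs₁.trans hX₄.1, done X₄ (Or.inl ⟨hX₄, hr0⟩)⟩, by omega⟩
  · rintro _ m₁ t₁ ⟨hf, X₁, h₁, hs₁, hk⟩ ht₁
    refine ⟨⟨hf, X₁, h₁, hs₁, fun ⟨v, hv, hv0⟩ => ?_⟩, ?_⟩
    · classical
      have hex : ∃ v, v < 2 * D.n - 1 ∧ m (.chain σ) v 0 ≠ 0 := ⟨v, hv, hv0⟩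
      obtain ⟨h1, h2⟩ := Nat.find_spec hex
      refine hk _ h1 (by omega) h2 fun v' hv' => ?_
      by_contra hne
      exact Nat.find_min hex hv' ⟨by omega, hne⟩
    · have : (2 * D.n - 1) * (310 * D.n + 2) ≤ 2 * D.n * (312 * D.n) := by
        gcongr <;> omega
      nlinarith

end Tangle

namespace Tangle
open TreePair

variable {D : TreePair} {I J : Finset ℕ} {σ τ : Side} {X X' : Side → List ℕ} {m : Mem} {i : ℕ}

/-! ### Counting crossings -/

/-- The number of ordered pairs of crossing edges in `J`. -/
def crossSum (D : TreePair) (J : Finset ℕ) (X : Side → List ℕ) : ℕ :=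
  ∑ j ∈ J, (J.filter fun k => Cross D X j k).card

theorem crossSum_insert (hi : i ∉ J) : crossSum D (insert i J) X =
    crossSum D J X + 2 * (J.filter fun k => Cross D X i k).card := by
  have h1 : ∀ j, j ∈ J → ((insert i J).filter fun k => Cross D X j k).card =
      (J.filter fun k => Cross D X j k).card + if Cross D X i j then 1 else 0 := by
    intro j _
    rw [Finset.filter_insert]
    simp only [cross_comm (a := j) (b := i)]
    split_ifs with h
    · rw [Finset.card_insert_of_notMem (by simp [hi])]
    · rfl
  rw [crossSum, Finset.sum_insert hi, Finset.sum_congr rfl h1, Finset.sum_add_distrib,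
    ← Finset.card_filter, Finset.filter_insert, if_neg not_cross_self, crossSum]
  ring

theorem crossSum_congr (h : SameOn D J X X') : crossSum D J X' = crossSum D J X := by
  refine Finset.sum_congr rfl fun j hj => ?_
  rw [Finset.filter_congr fun k hk => h j hj k hk]

theorem LState.tr_countCrossings (h : LState D m (insert i J) X) (hJ : InJ D m J) :
    Tr (2 * D.n) (countCrossings i) m (110 * D.n ^ 2) (fun r m' => Fr [.pos .T, .pos .S] m m' ∧
      r = crossSum D (insert i J) X) := by
  intro t
  have hpos := D.pos
  have hn2 : D.n ≤ D.n ^ 2 := Nat.le_self_pow (by simp) _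
  simp only [countCrossings, wps]
  refine h.tr_findPositions.use ?_
  rintro _ m₁ t₁ ⟨hf, hp⟩ ht₁
  have h₁ := h.frame hf
  have hJ₁ := hJ.frame hf
  rw [h₁.static.size]
  refine ⟨by omega, by omega, ?_⟩
  have hin : ∀ j < D.n, Test (2 * D.n) (either (rd .inJ j) (testEq j i)) m₁ 7
      (j ∈ insert i J) := fun j hj =>
    (Test.either (test_rd (by omega)) (test_eq _ _ _ _)).congr le_rfl (by
      rw [hJ₁ j hj, Finset.mem_insert, or_comm])
  refine (wp_loop (c := 75 * D.n) (fun j a m' => m' = m₁ ∧ a = ∑ j ∈ Finset.range j,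
    ((Finset.range D.n).filter fun k => j ∈ insert i J ∧ k ∈ insert i J ∧ Cross D X j k).card)
    ⟨rfl, by simp⟩ ?_).use ?_
  · rintro j acc m' hj ⟨rfl, rfl⟩
    refine Tr.mono (wp_loop (c := 73) (fun k a m'' => m'' = m' ∧ a = ∑ j ∈ Finset.range j,
      ((Finset.range D.n).filter fun k => j ∈ insert i J ∧ k ∈ insert i J ∧ Cross D X j k).card +
      ((Finset.range k).filter fun k => j ∈ insert i J ∧ k ∈ insert i J ∧ Cross D X j k).card)
      ⟨rfl, by simp⟩ ?_) (by omega) fun a m'' h => ⟨h.1, ?_⟩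
    · rintro k acc m'' hk ⟨rfl, rfl⟩ t
      simp only [wps]
      refine Tr.use (Test.both (hin j hj) fun hj' => Test.both (hin k hk)
        fun hk' => h₁.test_cross hp hj' hk') ?_
      rintro a m' t' ⟨rfl, ha⟩ ht
      rw [Finset.range_add_one, Finset.filter_insert]
      split_ifs with h0 h1 h1
      · exact absurd h0 (ha.2 h1)
      · exact ⟨⟨rfl, rfl⟩, by omega⟩
      · exact ⟨⟨rfl, by rw [Finset.card_insert_of_notMem (by simp)]; rfl⟩, by omega⟩
      · exact absurd (ha.1 h0) h1
    · rw [h.2, Finset.sum_range_succ]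
  · rintro a m' t' ⟨rfl, rfl⟩ ht
    refine ⟨⟨hf, ?_⟩, by nlinarith⟩
    have hsub : insert i J ⊆ Finset.range D.n := fun j hj => by simpa using h.layout.bound j hj
    rw [crossSum, ← Finset.sum_subset hsub fun j _ hj => by simp [hj]]
    refine Finset.sum_congr rfl fun j hj => congrArg _ ?_
    ext k
    simp only [Finset.mem_filter, hj, true_and]
    exact ⟨fun h => h.2, fun h => ⟨hsub h.1, h⟩⟩

/-! ### The case of a vertex above the top of a chain -/

theorem between_leaf (hJ : ∀ j ∈ J, j < D.n) (hi : i < D.n) (hiJ : i ∉ J) {w : ℕ} :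
    D.between σ J w (D.e σ i) = D.E σ J w := by
  ext j
  rw [mem_between, mem_E, D.L_leaf σ _ (D.e_lt hi), Finset.mem_singleton]
  refine ⟨fun h => ⟨h.1, h.2.1⟩, fun h => ⟨h.1, h.2, fun he => hiJ ?_⟩⟩
  rw [← D.e_inj (hJ j h.1) hi he]
  exact h.1

theorem two_le_card_of_ne {S : Finset ℕ} {P : ℕ → Prop} [DecidablePred P] {a b : ℕ} (ha : a ∈ S)
    (hb : b ∈ S) (hab : a ≠ b) (hPa : P a) (hPb : P b) : 2 ≤ (S.filter P).card :=
  Finset.one_lt_card.2 ⟨a, by simp [ha, hPa], b, by simp [hb, hPb], hab⟩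

theorem tr_topOfChain (hm : Static D m) : Tr (2 * D.n) (topOfChain σ) m (10 * D.n)
    (fun v m' => m' = m ∧ ((v = 0 ∧ ∀ v < 2 * D.n - 1, m (.chain σ) v 0 = 0) ∨
      (v < 2 * D.n - 1 ∧ m (.chain σ) v 0 ≠ 0))) := by
  intro t
  have hpos := D.pos
  simp only [topOfChain, wps, hm.verts]
  refine ⟨by omega, by omega, ?_⟩
  refine (tr_lastSuch (c := 2) (fun x => m (.chain σ) x 0 ≠ 0)
    fun x hx => test_rd (by omega)).use ?_
  rintro v m' t' ⟨rfl, hv⟩ ht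
  refine ⟨⟨rfl, ?_⟩, by omega⟩
  rcases hv with ⟨rfl, hv⟩ | ⟨h1, h2, -⟩
  exacts [Or.inl ⟨rfl, fun v h => by simpa using hv v h⟩, Or.inr ⟨h1, h2⟩]

/-- The crossing bound needs no more from this test than that the chain is nonempty. -/
theorem tr_isCaseAbove (hm : Static D m) (hc : ChainOk D J i m σ) {w : Side → ℕ}
    (hw : w σ.other < 2 * D.n - 1) : Tr (2 * D.n) (isCaseAbove w σ) m (40 * D.n)
    (fun r m' => m' = m ∧ (r ≠ 0 → ∃ v < 2 * D.n - 1, m (.chain σ) v 0 ≠ 0)) := by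
  intro t
  have hpos := D.pos
  simp only [isCaseAbove, wps]
  refine (tr_topOfChain hm).use ?_
  rintro v m' t' ⟨rfl, hv⟩ ht
  split_ifs with h0
  · exact ⟨⟨rfl, by simp⟩, by omega⟩
  · have hv' : v < 2 * D.n - 1 ∧ m' (.chain σ) v 0 ≠ 0 := hv.resolve_left fun h => h0 h.1
    have hu := (hc v hv'.1 hv'.2).u_lt
    refine ⟨by omega, by omega, ?_⟩
    refine (Test.both (test_read (by omega) (by omega))
      fun _ => Test.negate (test_eq _ _ _ _)).use ?_
    rintro r m'' t'' ⟨rfl, -⟩ ht''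
    exact ⟨⟨rfl, fun _ => ⟨v, hv'⟩⟩, by omega⟩

/-- The chain provides an uncrossed edge not below w, and the last switch one below w. As this
switch only concerns edges below w, both remain. -/
theorem LState.tr_insertionCaseAbove (h : LState D m (insert i J) X) (hJ : InJ D m J) (hi : i ∉ J)
    {w : Side → ℕ} (hw : ∀ σ, IsParent D J i σ (w σ)) (hc : ChainOk D J i m σ)
    (hne : ∃ v < 2 * D.n - 1, m (.chain σ) v 0 ≠ 0) :
    Tr (2 * D.n) (insertionCaseAbove i w σ) m (1500 * D.n ^ 2) (fun _ m' => Fr layoutArrs m m' ∧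
      ∃ X', LState D m' (insert i J) X' ∧ SameOn D J X X' ∧
        2 ≤ (J.filter fun b => ¬ Cross D X' i b).card) := by
  intro t
  have hpos := D.pos
  have hn2 : D.n ≤ D.n ^ 2 := Nat.le_self_pow (by simp) _
  have hin : i < D.n := h.layout.bound i (by simp)
  have hJn : ∀ j ∈ J, j < D.n := fun j hj => h.layout.bound j (by simp [hj])
  simp only [insertionCaseAbove, wps]
  refine (tr_topOfChain h.static).use ?_
  rintro v m₀ t₀ ⟨rfl, hv⟩ ht₀
  have hv' : v < 2 * D.n - 1 ∧ m₀ (.chain σ) v 0 ≠ 0 := by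
    refine hv.resolve_left fun ⟨_, h⟩ => ?_
    obtain ⟨v, h1, h2⟩ := hne
    exact h2 (h v h1)
  refine ⟨by omega, by omega, ?_⟩
  refine (h.tr_switchIf hJ hi (hw _) (hc v hv'.1 hv'.2).u_lt).use ?_
  rintro _ m₁ t₁ ⟨hf₁, X₁, h₁, hs₁, -, -⟩ ht₁
  have hJ₁ : InJ D m₁ J := hJ.frame hf₁ (by simp [layoutArrs])
  have hc₁ : ChainOk D J i m₁ σ := hc.frame hf₁
  refine (h₁.tr_flipChain hJ₁ hi (hw σ) hc₁).use ?_
  rintro _ m₂ t₂ ⟨hf₂, X₂, h₂, hs₂, hX₂⟩ ht₂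
  have hJ₂ : InJ D m₂ J := hJ₁.frame hf₂ (by simp [layoutArrs])
  obtain ⟨b, hbJ, hbw, hb⟩ := hX₂ (by rwa [hf₁ _ (by simp [layoutArrs])])
  rw [h₂.static.edge σ i hin]
  refine ⟨by omega, by omega, ?_⟩
  have hei := D.e_lt (σ := σ) hin
  refine (h₂.tr_switchIf hJ₂ hi (hw σ) (by omega)).use ?_
  rintro _ m₃ t₃ ⟨hf₃, X₃, h₃, hs₃, hout, hX₃⟩ ht₃
  rw [between_leaf hJn hin hi] at hX₃
  obtain ⟨a, ha, hac⟩ := hX₃ (hw σ).nonempty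
  rw [mem_E] at ha
  refine ⟨⟨(hf₁.trans hf₂).trans hf₃, X₃, h₃, (hs₁.trans hs₂).trans hs₃, ?_⟩, by omega⟩
  refine two_le_card_of_ne ha.1 hbJ ?_ hac ((hout b hbJ hbw).not.2 hb)
  rintro rfl
  exact hbw ha.2

/-! ### The remaining case -/

/-- Every edge in `J` has another one by which it is not crossed. -/
def Partnered (D : TreePair) (J : Finset ℕ) (X : Side → List ℕ) : Prop :=
  ∀ a ∈ J, ∃ b ∈ J, b ≠ a ∧ ¬ Cross D X a b

theorem Partnered.congr (h : Partnered D J X) (hs : SameOn D J X X') : Partnered D J X' := by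
  intro a ha
  obtain ⟨b, hb, hba, hc⟩ := h a ha
  exact ⟨b, hb, hba, (hs a ha b hb).not.2 hc⟩

/-- The elements of a convex set are on the same side of each further element. -/
theorem Layout.before_congr (h : Layout D J X) {v a b c : ℕ} (hv : v < 2 * D.n - 1) (ha : a ∈ J)
    (hb : b ∈ J) (hc : c ∈ J) (hav : D.e σ a ∈ D.L σ v) (hbv : D.e σ b ∈ D.L σ v)
    (hcv : D.e σ c ∉ D.L σ v) : Before D X σ a c ↔ Before D X σ b c := by
  have hac : a ≠ c := by rintro rfl; exact hcv hav
  have hbc : b ≠ c := by rintro rfl; exact hcv hbv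
  have k1 := h.convex σ v hv _ (h.e_mem ha) _ (h.e_mem hc) _ (h.e_mem hb)
  have k2 := h.convex σ v hv _ (h.e_mem hb) _ (h.e_mem hc) _ (h.e_mem ha)
  have t1 := h.before_total (σ := σ) ha hc hac
  have t2 := h.before_total (σ := σ) hb hc hbc
  unfold Before at *
  constructor
  · intro h1
    by_contra h2
    exact hcv (k1 h1 (t2.2 h2) hav hbv)
  · intro h1
    by_contra h2
    exact hcv (k2 h1 (t1.2 h2) hbv hav)

/-- The edges of J below w all lie below one child of w, and i does not, so convexity puts them on
the same side of i. -/
theorem IsParent.before_congr {w : ℕ} (hw : IsParent D J i σ w) (h : Layout D (insert i J) X)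
    (hi : i ∉ J) {a b : ℕ} (ha : a ∈ D.E σ J w) (hb : b ∈ D.E σ J w) :
    Before D X σ i a ↔ Before D X σ i b := by
  rw [mem_E] at ha hb
  obtain ⟨c, -, hc, hcJ⟩ := hw.child
  have h1 := (hcJ a ha.1).2.2 ha.2
  have h2 := (hcJ b hb.1).2.2 hb.2
  have hia : i ≠ a := by rintro rfl; exact hi ha.1
  have hib : i ≠ b := by rintro rfl; exact hi hb.1
  have hiJ : i ∈ insert i J := by simp
  have ha' : a ∈ insert i J := by simp [ha.1]
  have hb' : b ∈ insert i J := by simp [hb.1]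
  rw [h.before_total ha' hiJ hia.symm, h.before_total hb' hiJ hib.symm, not_iff_not]
  exact h.before_congr (ch_lt' hw.le hw.lt) ha' hb' hiJ h1 h2 hc

/-- Two edges in `J` are not crossed by `i` for one of the four layouts that arise from subtree
switches at the parents of its endpoints. -/
theorem exists_two_not_cross {w : Side → ℕ} (hw : ∀ σ, IsParent D J i σ (w σ))
    (h : Layout D (insert i J) X) (hi : i ∉ J) (hp : Partnered D J X)
    (hE : ∃ c ∈ D.E .T J (w .T), c ∈ D.E .S J (w .S)) :
    ∃ x y : Prop, ∃ a ∈ J, ∃ b ∈ J, a ≠ b ∧ ∀ c, c = a ∨ c = b →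
      (¬ (Cross D X i c ↔ x ∧ D.e .T c ∈ D.L .T (w .T)) ↔ y ∧ D.e .S c ∈ D.L .S (w .S)) := by
  -- The propositions x and y tell whether the switches in T and in S are made. Two successive
  -- toggles turn "not crossed by i in the end" into the equivalence of the statement.
  obtain ⟨c, hcT, hcS⟩ := hE
  have hcT' := D.mem_E.1 hcT
  have hcS' := D.mem_E.1 hcS
  have hcJ := hcT'.1
  -- Only the switch in T affects such an edge d. So x can be chosen to uncross d, and afterwards y
  -- to uncross c.
  by_cases hd : ∃ d ∈ J, D.e .T d ∈ D.L .T (w .T) ∧ D.e .S d ∉ D.L .S (w .S)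
  · obtain ⟨d, hd, hdT, hdS⟩ := hd
    refine ⟨Cross D X i d, ¬ (Cross D X i c ↔ Cross D X i d), c, hcJ, d, hd, ?_, ?_⟩
    · rintro rfl; exact hdS hcS'.2
    · rintro _ (rfl | rfl)
      · simp [hcT'.2, hcS'.2]
      · simp [hdT, hdS]
  by_cases hd' : ∃ d ∈ J, D.e .T d ∉ D.L .T (w .T) ∧ D.e .S d ∈ D.L .S (w .S)
  · obtain ⟨d, hd, hdT, hdS⟩ := hd'
    refine ⟨¬ (Cross D X i c ↔ Cross D X i d), Cross D X i d, c, hcJ, d, hd, ?_, ?_⟩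
    · rintro rfl; exact hdT hcT'.2
    · rintro _ (rfl | rfl)
      · simp only [hcT'.2, hcS'.2, and_true]
        by_cases h2 : Cross D X i d <;> simp [h2]
      · simp [hdT, hdS]
  have hiJ : i ∈ insert i J := by simp
  have hne : ∀ a ∈ J, i ≠ a := by rintro a ha rfl; exact hi ha
  have hsub : ∀ a ∈ J, a ∈ insert i J := fun a ha => by simp [ha]
  -- Now the two sets coincide. If they have a second element d, then c and d are on the same side
  -- of i in both trees, so i crosses both or neither, and one switch serves both.
  by_cases hd₂ : ∃ d ∈ J, d ≠ c ∧ D.e .T d ∈ D.L .T (w .T)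
  · obtain ⟨d, hd₂, hdc, hdT⟩ := hd₂
    have hdS : D.e .S d ∈ D.L .S (w .S) := by
      by_contra hdS; exact hd ⟨d, hd₂, hdT, hdS⟩
    refine ⟨Cross D X i c, False, c, hcJ, d, hd₂, hdc.symm, ?_⟩
    have e : Cross D X i d ↔ Cross D X i c := by
      rw [h.cross_iff hiJ (hsub _ hd₂) (hne _ hd₂), h.cross_iff hiJ (hsub _ hcJ) (hne _ hcJ),
        (hw .T).before_congr h hi (D.mem_E.2 ⟨hd₂, hdT⟩) hcT,
        (hw .S).before_congr h hi (D.mem_E.2 ⟨hd₂, hdS⟩) hcS]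
    rintro _ (rfl | rfl)
    · simp [hcT'.2]
    · simp [hdT, e]
  -- Now c is the only element of both sets. Its partner d is outside, where i and c are on the same
  -- side of d in both trees. So i does not cross d, whatever is switched, and a switch can uncross
  -- c.
  · obtain ⟨d, hdJ, hdc, hcd⟩ := hp c hcJ
    have hdT : D.e .T d ∉ D.L .T (w .T) := fun hdT => hd₂ ⟨d, hdJ, hdc, hdT⟩
    have hdS : D.e .S d ∉ D.L .S (w .S) := fun hdS => hd' ⟨d, hdJ, hdT, hdS⟩
    refine ⟨Cross D X i c, False, c, hcJ, d, hdJ, hdc.symm, ?_⟩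
    have e : Cross D X i d ↔ Cross D X c d := by
      rw [h.cross_iff hiJ (hsub _ hdJ) (hne _ hdJ), h.cross_iff (hsub _ hcJ) (hsub _ hdJ) hdc.symm,
        h.before_congr (hw .T).lt hiJ (hsub _ hcJ) (hsub _ hdJ) (hw .T).above hcT'.2 hdT,
        h.before_congr (hw .S).lt hiJ (hsub _ hcJ) (hsub _ hdJ) (hw .S).above hcS'.2 hdS]
    rintro _ (rfl | rfl)
    · simp [hcT'.2]
    · simp [hdT, e, hcd]

theorem two_le_card_not {P : ℕ → Prop} [DecidablePred P] {Q : ℕ → Prop} [DecidablePred Q]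
    (h : (J.filter P).card ≤ (J.filter Q).card) (h2 : 2 ≤ (J.filter fun b => ¬ Q b).card) :
    2 ≤ (J.filter fun b => ¬ P b).card := by
  have h3 := Finset.card_filter_add_card_filter_not (s := J) P
  have h4 := Finset.card_filter_add_card_filter_not (s := J) Q
  omega

theorem test_leMin (N x y y' y'' : ℕ) (m : Mem) :
    Test N (both (negate (testLt y x)) (both (negate (testLt y' x)) (negate (testLt y'' x)))) m 30
      (x ≤ y ∧ x ≤ y' ∧ x ≤ y'') := by
  refine (Test.both (test_lt _ _ _ _).negate fun _ => Test.both (test_lt _ _ _ _).negate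
    fun _ => (test_lt _ _ _ _).negate).congr (by norm_num) ?_
  simp only [not_lt]

end Tangle

namespace Tangle
open TreePair

variable {D : TreePair} {I J : Finset ℕ} {σ τ : Side} {X X' : Side → List ℕ} {m : Mem} {i : ℕ}

theorem crossSum_insert_congr (hi : i ∉ J) (hs : SameOn D J X X')
    (h : ∀ b ∈ J, Cross D X' i b ↔ Cross D X i b) :
    crossSum D (insert i J) X' = crossSum D (insert i J) X := by
  rw [crossSum_insert hi, crossSum_insert hi, crossSum_congr hs, Finset.filter_congr h]

/-- Toggles commute and are involutions: performing p, r, p amounts to r. -/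
theorem toggle_three (q p r : Prop) : ¬ (¬ (¬ (q ↔ p) ↔ r) ↔ p) ↔ ¬ (q ↔ r) := by
  by_cases p <;> by_cases q <;> by_cases r <;> simp [*]

/-- One switch at a time, in the order T, S, T, visits all four layouts. The return to the selected
one is justified at the level of crossings: the toggles cancel, so the counts agree. -/
theorem LState.tr_tryFour (h : LState D m (insert i J) X) (hJ : InJ D m J) (hi : i ∉ J)
    {w : Side → ℕ} (hw : ∀ σ, IsParent D J i σ (w σ))
    (hE : ∃ c ∈ D.E .T J (w .T), c ∈ D.E .S J (w .S)) :
    Tr (2 * D.n) (do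
      let c₁ ← countCrossings i
      subtreeSwitch .T (w .T)
      let c₂ ← countCrossings i
      subtreeSwitch .S (w .S)
      let c₃ ← countCrossings i
      subtreeSwitch .T (w .T)
      let c₄ ← countCrossings i
      let leMin (x y y' y'' : ℕ) : Prog ℕ ℕ :=
        both (negate (testLt y x)) (both (negate (testLt y' x)) (negate (testLt y'' x)))
      let b₁ ← leMin c₁ c₂ c₃ c₄
      let b₂ ← leMin c₂ c₁ c₃ c₄
      let b₃ ← leMin c₃ c₁ c₂ c₄
      ifNZ b₁ (subtreeSwitch .S (w .S))
        (ifNZ b₂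
          (do
            subtreeSwitch .T (w .T)
            subtreeSwitch .S (w .S))
          (ifNZ b₃ (subtreeSwitch .T (w .T)) skip))) m (1400 * D.n ^ 2)
      (fun _ m' => Fr layoutArrs m m' ∧
        ∃ X', LState D m' (insert i J) X' ∧ SameOn D J X X' ∧
          (Partnered D J X → 2 ≤ (J.filter fun b => ¬ Cross D X' i b).card)) := by
  intro t
  have hpos := D.pos
  have hn2 : D.n ≤ D.n ^ 2 := Nat.le_self_pow (by simp) _
  have hcount : ∀ {m' X'}, Fr layoutArrs m m' → LState D m' (insert i J) X' →
      Tr (2 * D.n) (countCrossings i) m' (110 * D.n ^ 2) (fun r m'' => Fr layoutArrs m m'' ∧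
        LState D m'' (insert i J) X' ∧ r = crossSum D (insert i J) X') := fun {m' X'} hf h' =>
    Tr.mono (h'.tr_countCrossings (hJ.frame hf (by simp [layoutArrs]))) le_rfl fun r m'' hr =>
      ⟨hf.trans (hr.1.mono (by simp [layoutArrs])), h'.frame hr.1, hr.2⟩
  have hsw : ∀ {m' X'} σ, Fr layoutArrs m m' → LState D m' (insert i J) X' →
      Tr (2 * D.n) (subtreeSwitch σ (w σ)) m' (160 * D.n) (fun _ m'' => Fr layoutArrs m m'' ∧
        ∃ X'', LState D m'' (insert i J) X'' ∧
          Toggle D J i (fun b => D.e σ b ∈ D.L σ (w σ)) X' X'') := fun {m' X'} σ hf h' =>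
    Tr.mono (h'.tr_subtreeSwitch hi (hw σ)) le_rfl fun r m'' hr => ⟨hf.trans hr.1, hr.2⟩
  simp only [wps]
  refine (hcount (Fr.refl _ _) h).use ?_
  rintro c₁ m₁ t₁ ⟨hf₁, h₁, hc₁⟩ ht₁
  refine (hsw .T hf₁ h₁).use ?_
  rintro _ m₂ t₂ ⟨hf₂, X₂, h₂, hX₂⟩ ht₂
  refine (hcount hf₂ h₂).use ?_
  rintro c₂ m₃ t₃ ⟨hf₃, h₃, hc₂⟩ ht₃
  refine (hsw .S hf₃ h₃).use ?_
  rintro _ m₄ t₄ ⟨hf₄, X₃, h₄, hX₃⟩ ht₄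
  refine (hcount hf₄ h₄).use ?_
  rintro c₃ m₅ t₅ ⟨hf₅, h₅, hc₃⟩ ht₅
  refine (hsw .T hf₅ h₅).use ?_
  rintro _ m₆ t₆ ⟨hf₆, X₄, h₆, hX₄⟩ ht₆
  refine (hcount hf₆ h₆).use ?_
  rintro c₄ m₇ t₇ ⟨hf₇, h₇, hc₄⟩ ht₇
  refine (test_leMin _ _ _ _ _ _).use ?_
  rintro b₁ m₈ t₈ ⟨rfl, hb₁⟩ ht₈
  refine (test_leMin _ _ _ _ _ _).use ?_
  rintro b₂ m₈ t₉ ⟨rfl, hb₂⟩ ht₉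
  refine (test_leMin _ _ _ _ _ _).use ?_
  rintro b₃ m₈ t₁₀ ⟨rfl, hb₃⟩ ht₁₀
  have s₃ := hX₂.sameOn.trans hX₃.sameOn
  have s₄ := s₃.trans hX₄.sameOn
  -- All layouts considered agree on J, so fewest crossings in total means fewest crossings with i.
  -- Hence the selected layout has at least as many uncrossed edges as the one from
  -- `exists_two_not_cross`.
  have fin : ∀ X', SameOn D J X X' → crossSum D (insert i J) X' ≤ c₁ →
      crossSum D (insert i J) X' ≤ c₂ → crossSum D (insert i J) X' ≤ c₃ →
      crossSum D (insert i J) X' ≤ c₄ → SameOn D J X X' ∧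
        (Partnered D J X → 2 ≤ (J.filter fun b => ¬ Cross D X' i b).card) := by
    intro X' hs k₁ k₂ k₃ k₄
    refine ⟨hs, fun hp => ?_⟩
    obtain ⟨Y, hYs, hYc, hY⟩ : ∃ Y, SameOn D J X Y ∧
        (crossSum D (insert i J) Y = c₁ ∨ crossSum D (insert i J) Y = c₂ ∨
          crossSum D (insert i J) Y = c₃ ∨ crossSum D (insert i J) Y = c₄) ∧
        2 ≤ (J.filter fun b => ¬ Cross D Y i b).card := by
      obtain ⟨x, y, a, ha, b, hb, hab, hxy⟩ := exists_two_not_cross hw h.layout hi hp hE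
      have ka := hxy a (by simp)
      have kb := hxy b (by simp)
      -- Both switches give X₃, the one in T gives X₂, the one in S gives X₄, and none gives X.
      by_cases hx : x <;> by_cases hy : y <;> simp only [hx, hy, true_and, false_and,
        iff_false, not_not] at ka kb
      · refine ⟨X₃, s₃, by simp [hc₃], two_le_card_of_ne ha hb hab ?_ ?_⟩ <;>
          simp only [hX₃.2, hX₂.2, ha, hb] <;> simpa
      · refine ⟨X₂, hX₂.sameOn, by simp [hc₂], two_le_card_of_ne ha hb hab ?_ ?_⟩ <;>
          simp only [hX₂.2, ha, hb] <;> simpa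
      · refine ⟨X₄, s₄, by simp [hc₄], two_le_card_of_ne ha hb hab ?_ ?_⟩ <;>
          simp only [hX₄.2, hX₃.2, hX₂.2, ha, hb, toggle_three] <;> simpa
      · refine ⟨X, SameOn.refl _, by simp [hc₁], two_le_card_of_ne ha hb hab ?_ ?_⟩ <;> simpa
    refine two_le_card_not (Q := fun k => Cross D Y i k) ?_ hY
    have e₁ : crossSum D (insert i J) X' ≤ crossSum D (insert i J) Y := by
      rcases hYc with h | h | h | h <;> rw [h] <;> assumption
    rw [crossSum_insert hi, crossSum_insert hi, crossSum_congr hs, crossSum_congr hYs] at e₁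
    exact Nat.le_of_mul_le_mul_left (Nat.le_of_add_le_add_left e₁) (by norm_num)
  -- If none of the first three counts is minimal, the fourth is, and its layout is the current one.
  -- The remaining branches return to the third, second and first layout.
  split_ifs with z₁ z₂ z₃
  · rw [hc₄] at *
    exact ⟨⟨hf₇, X₄, h₇, fin X₄ s₄ (by omega) (by omega) (by omega) le_rfl⟩, by omega⟩
  · refine (hsw .T hf₇ h₇).use ?_
    rintro _ m₉ t₁₁ ⟨hf₉, X₅, h₉, hX₅⟩ ht₁₁
    have e := crossSum_insert_congr (X := X₃) (X' := X₅) hi (hX₄.sameOn.trans hX₅.sameOn)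
      fun b hb => by
        rw [hX₅.2 b hb, hX₄.2 b hb, not_iff_not_iff_iff]
    exact ⟨⟨hf₉, X₅, h₉, fin X₅ (s₄.trans hX₅.sameOn) (by omega) (by omega) (by omega) (by omega)⟩,
      by omega⟩
  · refine (hsw .T hf₇ h₇).use ?_
    rintro _ m₉ t₁₁ ⟨hf₉, X₅, h₉, hX₅⟩ ht₁₁
    refine (hsw .S hf₉ h₉).use ?_
    rintro _ m₁₀ t₁₂ ⟨hf₁₀, X₆, h₁₀, hX₆⟩ ht₁₂
    have e := crossSum_insert_congr (X := X₂) (X' := X₆) hi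
      ((hX₃.sameOn.trans hX₄.sameOn).trans (hX₅.sameOn.trans hX₆.sameOn)) fun b hb => by
        rw [hX₆.2 b hb, hX₅.2 b hb, hX₄.2 b hb, not_iff_not_iff_iff, hX₃.2 b hb,
          not_iff_not_iff_iff]
    exact ⟨⟨hf₁₀, X₆, h₁₀, fin X₆ (s₄.trans (hX₅.sameOn.trans hX₆.sameOn)) (by omega) (by omega)
      (by omega) (by omega)⟩, by omega⟩
  · refine (hsw .S hf₇ h₇).use ?_
    rintro _ m₉ t₁₁ ⟨hf₉, X₅, h₉, hX₅⟩ ht₁₁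
    have e := crossSum_insert_congr (X := X) (X' := X₅) hi (s₄.trans hX₅.sameOn) fun b hb => by
      rw [hX₅.2 b hb, hX₄.2 b hb, hX₃.2 b hb, hX₂.2 b hb, toggle_three,
        not_iff_not_iff_iff]
    exact ⟨⟨hf₉, X₅, h₉, fin X₅ (s₄.trans hX₅.sameOn) (by omega) (by omega) (by omega) (by omega)⟩,
      by omega⟩

theorem LState.tr_insertionCaseOther (h : LState D m (insert i J) X) (hJ : InJ D m J) (hi : i ∉ J)
    {w : Side → ℕ} (hw : ∀ σ, IsParent D J i σ (w σ)) (hc : ∀ σ, ChainOk D J i m σ) :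
    Tr (2 * D.n) (insertionCaseOther i w) m (3700 * D.n ^ 2) (fun _ m' => Fr layoutArrs m m' ∧
      ∃ X', LState D m' (insert i J) X' ∧ SameOn D J X X' ∧
        (Partnered D J X → 2 ≤ (J.filter fun b => ¬ Cross D X' i b).card)) := by
  intro t
  have hpos := D.pos
  have hn2 : D.n ≤ D.n ^ 2 := Nat.le_self_pow (by simp) _
  have hin : i < D.n := h.layout.bound i (by simp)
  have hJn : ∀ j ∈ J, j < D.n := fun j hj => h.layout.bound j (by simp [hj])
  have hwT := (hw .T).lt
  have hwS := (hw .S).lt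
  have heT := D.e_lt (σ := .T) hin
  have heS := D.e_lt (σ := .S) hin
  simp only [insertionCaseOther, wps]
  refine (h.tr_flipChain hJ hi (hw .T) (hc .T)).use ?_
  rintro _ m₁ t₁ ⟨hf₁, X₁, h₁, hs₁, -⟩ ht₁
  have hJ₁ : InJ D m₁ J := hJ.frame hf₁ (by simp [layoutArrs])
  refine (h₁.tr_flipChain hJ₁ hi (hw .S) ((hc .S).frame hf₁)).use ?_
  rintro _ m₂ t₂ ⟨hf₂, X₂, h₂, hs₂, -⟩ ht₂
  have hJ₂ : InJ D m₂ J := hJ₁.frame hf₂ (by simp [layoutArrs])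
  have hf₁₂ := hf₁.trans hf₂
  have hs := hs₁.trans hs₂
  rw [h₂.static.edge _ i hin, h₂.static.edge _ i hin, h₂.static.size]
  refine ⟨by omega, by omega, by omega, by omega, by omega, by omega, ?_⟩
  refine (test_count _ fun j hj => Test.both
    (test_inE h₂.static hJ₂ hwT (b := D.e .T i) (by omega) hj)
    fun _ => test_inE h₂.static hJ₂ hwS (b := D.e .S i) (by omega) hj).use ?_
  rintro c m₃ t₃ ⟨rfl, hc⟩ ht₃
  simp only [between_leaf hJn hin hi] at hc
  split_ifs with h0
  -- The edge a gained by the switch in T is not below the parent in S, so the second switch neither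
  -- affects it nor yields it again.
  · have hdis := hc.not.1 (by simpa using h0)
    have fin : ∀ σ, (D.between σ J (w σ) (D.e σ i)).Nonempty := fun σ => by
      rw [between_leaf hJn hin hi]; exact (hw σ).nonempty
    refine (h₂.tr_switchIf hJ₂ hi (hw .T) (x := D.e .T i) (by omega)).use ?_
    rintro _ m₄ t₄ ⟨hf₄, X₄, h₄, hs₄, -, hX₄⟩ ht₄
    have hJ₄ : InJ D m₄ J := hJ₂.frame hf₄ (by simp [layoutArrs])
    refine (h₄.tr_switchIf hJ₄ hi (hw .S) (x := D.e .S i) (by omega)).use ?_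
    rintro _ m₅ t₅ ⟨hf₅, X₅, h₅, hs₅, hout, hX₅⟩ ht₅
    obtain ⟨a, ha, hac⟩ := hX₄ (fin .T)
    obtain ⟨b, hb, hbc⟩ := hX₅ (fin .S)
    rw [between_leaf hJn hin hi] at ha hb
    have ha' := D.mem_E.1 ha
    have hb' := D.mem_E.1 hb
    have haS : a ∉ D.E .S J (w .S) := fun h => hdis ⟨a, hJn a ha'.1, ha, h⟩
    refine ⟨⟨(hf₁₂.trans hf₄).trans hf₅, X₅, h₅, (hs.trans hs₄).trans hs₅,
      fun _ => two_le_card_of_ne ha'.1 hb'.1 ?_ ((hout a ha'.1 ?_).not.2 hac) hbc⟩, by omega⟩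
    · rintro rfl; exact haS hb
    · exact fun h => haS (D.mem_E.2 ⟨ha'.1, h⟩)
  · obtain ⟨a, -, ha⟩ := hc.1 h0
    -- The branching itself has taken two units of time, whence t₃ + 2.
    have key := (h₂.tr_tryFour hJ₂ hi hw ⟨a, ha⟩).use (t := t₃ + 2)
      (Q := fun _ m' t' => (Fr layoutArrs m m' ∧ ∃ X', LState D m' (insert i J) X' ∧
        SameOn D J X X' ∧ (Partnered D J X → 2 ≤ (J.filter fun b => ¬ Cross D X' i b).card)) ∧
          t' ≤ t + 3700 * D.n ^ 2) (by
        rintro _ m₄ t₄ ⟨hf₄, X₄, h₄, hs₄, hX₄⟩ ht₄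
        exact ⟨⟨hf₁₂.trans hf₄, X₄, h₄, hs.trans hs₄, fun hp => hX₄ (hp.congr hs)⟩, by omega⟩)
    simp only [wps] at key
    exact key

end Tangle

namespace Tangle
open TreePair

variable {D : TreePair} {I J : Finset ℕ} {σ τ : Side} {X X' : Side → List ℕ} {m : Mem} {i : ℕ}

/-! ### Insertion of an edge -/

/-- Ancestors have larger numbers, so the first hit of an upward scan is the lowest one, and the
root guarantees a hit. The value 0 can stand for "not found", as internal vertices have positive
numbers. -/
theorem tr_findParent (hm : Static D m) (hJ : InJ D m J) (hJn : ∀ j ∈ J, j < D.n)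
    (hJne : J.Nonempty) (hin : i < D.n) (hi : i ∉ J) :
    Tr (2 * D.n) (findParent σ i) m (90 * D.n ^ 2)
      (fun w m' => m' = m ∧ IsParent D J i σ w) := by
  intro t
  have hpos := D.pos
  have hn2 : D.n ≤ D.n ^ 2 := Nat.le_self_pow (by simp) _
  have hei := D.e_lt (σ := σ) hin
  simp only [findParent, wps]
  rw [hm.verts, hm.edge σ i hin]
  refine ⟨by omega, by omega, by omega, by omega, ?_⟩
  have test : ∀ v < 2 * D.n - 1, Test (2 * D.n) (both (lt σ (D.e σ i) v) (meetsJ σ v)) m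
      (16 * D.n + 12) ((D.e σ i ∈ D.L σ v ∧ ¬ D.e σ i = v) ∧ (D.E σ J v).Nonempty) := fun v hv =>
    (Test.both (Test.both (test_leq hm hv hei) fun _ => (test_eq _ _ _ _).negate)
      fun _ => test_meetsJ hm hJ hJn hv).congr (by omega) Iff.rfl
  have hle : ∀ v < 2 * D.n - 1, (D.e σ i ∈ D.L σ v ∧ ¬ D.e σ i = v) → D.n ≤ v := by
    intro v hv h
    by_contra hlt
    rw [D.L_leaf σ v (by omega), Finset.mem_singleton] at h
    exact h.2 h.1
  refine (wp_loop (c := 16 * D.n + 16) (fun k a m' => m' = m ∧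
    ((a = 0 ∧ ∀ v < k, ¬ ((D.e σ i ∈ D.L σ v ∧ ¬ D.e σ i = v) ∧ (D.E σ J v).Nonempty)) ∨
      IsParent D J i σ a)) ⟨rfl, Or.inl ⟨rfl, by simp⟩⟩ ?_).use ?_
  · rintro v a m' hv ⟨rfl, ha⟩ t
    simp only [wps]
    split_ifs with h0
    · obtain ⟨-, ha⟩ := ha.resolve_right fun h => by have := h.le; omega
      refine (test v hv).use ?_
      rintro b m'' t' ⟨rfl, hb⟩ ht
      split_ifs with hb0
      · refine ⟨⟨rfl, Or.inl ⟨h0, fun v' hv' => ?_⟩⟩, by omega⟩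
        rcases Nat.lt_succ_iff_lt_or_eq.1 hv' with hv' | rfl
        exacts [ha v' hv', hb.not.1 (by simpa using hb0)]
      · have hb := hb.1 hb0
        refine ⟨⟨rfl, Or.inr ⟨hle v hv hb.1, hv, hb.1.1, hb.2, fun v' hv' hv'i => ?_⟩⟩, by omega⟩
        -- The scan skips the leaf of i itself, which belongs to no edge in J.
        by_cases hev : D.e σ i = v'
        · by_contra hne
          obtain ⟨j, hj⟩ := Finset.nonempty_iff_ne_empty.2 hne
          rw [← hev, E_leaf hei] at hj
          exact hi (D.e_inj (hJn j hj.1) hin hj.2 ▸ hj.1)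
        · have := ha v' hv'
          by_contra hne
          exact this ⟨⟨hv'i, hev⟩, Finset.nonempty_iff_ne_empty.2 hne⟩
    · exact ⟨⟨trivial, Or.inr (ha.resolve_left fun h => h0 h.1)⟩, by omega⟩
  · rintro a m' t' ⟨rfl, ha⟩ ht
    refine ⟨⟨rfl, ha.resolve_left fun h => ?_⟩, ?_⟩
    · obtain ⟨j, hj⟩ := hJne
      have hjn := hJn j hj
      have hij : i ≠ j := by rintro rfl; exact hi hj
      refine h.2 (2 * D.n - 2) (by omega) ⟨⟨D.root σ _ hei, by omega⟩, j, ?_⟩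
      exact D.mem_E.2 ⟨hj, D.root σ _ (D.e_lt hjn)⟩
    · have : (2 * D.n - 1) * (16 * D.n + 16 + 1) ≤ 2 * D.n * (33 * D.n) := by gcongr <;> omega
      nlinarith

/-- The list `A` is a layout of the tree on side `σ` that is induced by `J`. -/
structure SideLayout (D : TreePair) (J : Finset ℕ) (σ : Side) (A : List ℕ) : Prop where
  nodup : A.Nodup
  mem : ∀ x, x ∈ A ↔ ∃ j ∈ J, D.e σ j = x
  convex : ∀ v < 2 * D.n - 1, Convex A (D.L σ v)

theorem idxOf_insert {A B : List ℕ} {x y a b : ℕ} (ha : a ≠ x) (hb : b ≠ x) :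
    (A ++ x :: y :: B).idxOf a < (A ++ x :: y :: B).idxOf b ↔
      (A ++ y :: B).idxOf a < (A ++ y :: B).idxOf b := by
  have key : ∀ c, c ≠ x → (A ++ x :: y :: B).idxOf c =
      if c ∈ A then (A ++ y :: B).idxOf c else (A ++ y :: B).idxOf c + 1 := by
    intro c hc
    rw [List.idxOf_append, List.idxOf_append, List.idxOf_cons_ne _ hc.symm]
    split_ifs
    · rfl
    · omega
  have key' : ∀ c, c ∈ A ↔ (A ++ y :: B).idxOf c < A.length := by
    intro c
    rw [List.idxOf_append]
    split_ifs with h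
    · simp [h, List.idxOf_lt_length_of_mem h]
    · simp [h]
  rw [key a ha, key b hb]
  have h1 := key' a
  have h2 := key' b
  split_ifs with h3 h4 h4
  · rfl
  · rw [h1] at h3; rw [h2] at h4; omega
  · rw [h1] at h3; rw [h2] at h4; omega
  · omega

/-- Here y is the first listed leaf below w. A set containing the new leaf either belongs to a
vertex numbered below w and has no old leaf, or it contains all leaves below w and hence y. A set
containing y but not the new leaf is contained in the leaves below w, so it has no leaf before y. -/
theorem SideLayout.insert {A B : List ℕ} {y w : ℕ} (h : SideLayout D J σ (A ++ y :: B))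
    (hJn : ∀ j ∈ J, j < D.n) (hin : i < D.n) (hi : i ∉ J) (hw : IsParent D J i σ w)
    (hA : ∀ a ∈ A, a ∉ D.L σ w) (hy : y ∈ D.L σ w) :
    SideLayout D (insert i J) σ (A ++ D.e σ i :: y :: B) ∧
    ∀ a ∈ J, ∀ b ∈ J, ((A ++ D.e σ i :: y :: B).idxOf (D.e σ a) <
        (A ++ D.e σ i :: y :: B).idxOf (D.e σ b) ↔
      (A ++ y :: B).idxOf (D.e σ a) < (A ++ y :: B).idxOf (D.e σ b)) := by
  have hne : ∀ j ∈ J, D.e σ j ≠ D.e σ i := fun j hj he =>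
    hi (D.e_inj (hJn j hj) hin he ▸ hj)
  have hx : D.e σ i ∉ A ++ y :: B := fun hx => by
    obtain ⟨j, hj, he⟩ := (h.mem _).1 hx
    exact hne j hj he
  have hnd : (A ++ D.e σ i :: y :: B).Nodup :=
    (List.perm_middle.nodup_iff).2 (List.nodup_cons.2 ⟨hx, h.nodup⟩)
  have hmem : ∀ x, x ∈ A ++ D.e σ i :: y :: B ↔ x = D.e σ i ∨ x ∈ A ++ y :: B := fun x => by
    simp only [List.mem_append, List.mem_cons]; tauto
  refine ⟨⟨hnd, fun x => ?_, fun v hv => ?_⟩, fun a ha b hb => ?_⟩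
  · rw [hmem, h.mem]
    simp only [Finset.exists_mem_insert, eq_comm]
  · refine (h.convex v hv).insert hnd (fun hxv => ?_) fun hxv hyv a ha hav => ?_
    · rcases Nat.lt_trichotomy v w with hvw | rfl | hvw
      · refine Or.inr fun a ha hav => ?_
        obtain ⟨j, hj, rfl⟩ := (h.mem a).1 ha
        exact Finset.notMem_empty j (hw.lowest v hvw hxv ▸ D.mem_E.2 ⟨hj, hav⟩)
      · exact Or.inl hy
      · have hnv : D.n ≤ v := hw.le.trans hvw.le
        rcases D.lam σ w v hvw hnv hv with ⟨b, hb⟩ | hd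
        · refine Or.inl ((D.L_node σ v y hnv hv).2 ?_)
          cases b
          exacts [Or.inl (hb hy), Or.inr (hb hy)]
        · exact absurd hxv (Finset.disjoint_left.1 hd hw.above)
    · rcases L_laminar D σ hv hw.lt with hl | hl | hl
      · exact hA a ha (hl hav)
      · exact hxv (hl hw.above)
      · exact Finset.disjoint_left.1 hl hyv hy
  · exact idxOf_insert (hne a ha) (hne b hb)

theorem tr_extendLayout (hm : Static D m) {A : List ℕ} (hl : Lst m σ A)
    (hA : SideLayout D J σ A) (hlen : A.length ≤ D.n) (hJn : ∀ j ∈ J, j < D.n) (hin : i < D.n)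
    (hi : i ∉ J) {w : ℕ} (hw : IsParent D J i σ w) :
    Tr (2 * D.n) (extendLayout σ w i) m (80 * D.n) (fun _ m' => Fr [.lay σ, .len σ, .tmp] m m' ∧
      ∃ A', Lst m' σ A' ∧ SideLayout D (insert i J) σ A' ∧ ∀ a ∈ J, ∀ b ∈ J,
        (A'.idxOf (D.e σ a) < A'.idxOf (D.e σ b) ↔ A.idxOf (D.e σ a) < A.idxOf (D.e σ b))) := by
  intro t
  have hpos := D.pos
  have hwlt := hw.lt
  simp only [extendLayout, wps]
  rw [hl.1, hm.edge σ i hin]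
  refine ⟨by omega, by omega, by omega, by omega, ?_⟩
  refine (wp_loop (c := 6) (fun k p m' => m' = m ∧
    ((p = A.length ∧ ∀ k' < k, A.getD k' 0 ∉ D.L σ w) ∨
      (p < A.length ∧ A.getD p 0 ∈ D.L σ w ∧ ∀ k' < p, A.getD k' 0 ∉ D.L σ w)))
    ⟨rfl, Or.inl ⟨rfl, by simp⟩⟩ ?_).use ?_
  · rintro k p m' hk ⟨rfl, hp⟩ t
    simp only [wps]
    split_ifs with h0
    · exact ⟨⟨trivial, Or.inr (hp.resolve_left fun h => by omega)⟩, by omega⟩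
    · obtain ⟨h1, h2⟩ := hp.resolve_right fun h => h0 h.1
      rw [hl.2 k hk]
      refine ⟨by omega, by omega, ?_⟩
      obtain ⟨j, hj, he⟩ := (hA.mem _).1 (getD_mem hk)
      refine (test_leq hm hw.lt (he ▸ D.e_lt (hJn j hj))).use ?_
      rintro b m'' t' ⟨rfl, hb⟩ ht
      split_ifs with hb0
      · refine ⟨⟨rfl, Or.inl ⟨h1, fun k' hk' => ?_⟩⟩, by omega⟩
        rcases Nat.lt_succ_iff_lt_or_eq.1 hk' with hk' | rfl
        exacts [h2 k' hk', hb.not.1 (by simpa using hb0)]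
      · exact ⟨⟨rfl, Or.inr ⟨hk, hb.1 hb0, h2⟩⟩, by omega⟩
  · rintro p m' t' ⟨rfl, hp⟩ ht
    obtain ⟨hp, hpw, hlow⟩ := hp.resolve_left fun h => by
      obtain ⟨j, hj⟩ := hw.nonempty
      rw [mem_E] at hj
      obtain ⟨k, hk, he⟩ := exists_getD_of_mem ((hA.mem _).2 ⟨j, hj.1, rfl⟩)
      exact h.2 k hk (he ▸ hj.2)
    refine ⟨by omega, by omega, ?_⟩
    rw [hl.2 p hp]
    obtain ⟨A₁, B, hAB, rfl⟩ := split_at hp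
    generalize A.getD A₁.length 0 = y at *
    subst hAB
    simp only [List.length_append, List.length_cons] at hlen ht
    refine (tr_splice hl (by omega)).use ?_
    rintro _ m₂ t₂ ⟨hf, hl₂⟩ ht₂
    have hA₁ : ∀ a ∈ A₁, a ∉ D.L σ w := fun a ha => by
      obtain ⟨k, hk, rfl⟩ := exists_getD_of_mem ha
      have := hlow k hk
      rwa [List.getD_append _ _ _ _ hk] at this
    exact ⟨⟨hf, _, hl₂, hA.insert hJn hin hi hw hA₁ hpw⟩, by omega⟩

/-- The set `M` consists of pairs of branching vertices that are incident to the same edges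
in `J`. -/
def PairsOn (D : TreePair) (I J : Finset ℕ) (m : Mem) : Prop :=
  ∀ u < 2 * D.n - 1, m .inM u 0 ≠ 0 →
    D.Branching .T I u ∧ D.Branching .S I (m (.mate .T) u 0) ∧
    D.E .T J u = D.E .S J (m (.mate .T) u 0) ∧ m (.mate .S) (m (.mate .T) u 0) 0 = u

theorem PairsOn.frame (h : PairsOn D I J m) {m' : Mem} {l : List Arr} (hf : Fr l m m')
    (hl : .inM ∉ l ∧ ∀ σ, .mate σ ∉ l) : PairsOn D I J m' := by
  unfold PairsOn; rw [hf _ hl.1, hf _ (hl.2 _), hf _ (hl.2 _)]; exact h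

theorem TreePair.Branching.mono {v : ℕ} (h : D.Branching σ I v) (hIJ : I ⊆ J) :
    D.Branching σ J v :=
  ⟨h.1, h.2.1, fun b => (h.2.2 b).mono fun _ hi => D.mem_E.2
    ⟨hIJ (D.mem_E.1 hi).1, (D.mem_E.1 hi).2⟩⟩

theorem test_lt_vertex (hm : Static D m) {x v : ℕ} (hv : v < 2 * D.n - 1) (hx : x < D.n)
    (hnv : D.n ≤ v) : Test (2 * D.n) (lt σ x v) m 9 (x ∈ D.L σ v) :=
  (Test.both (test_leq hm hv hx) fun _ => (test_eq _ _ _ _).negate).congr le_rfl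
    ⟨fun h => h.1, fun h => ⟨h, by omega⟩⟩

/-- A pair stays in M only if i is below both of its vertices or below neither, so these still carry
the same edges after i joins J. The removed pairs are those required by `ChainPair`. Branching is
kept relative to the fixed set I and passes to any larger J. -/
theorem tr_selectPairs (hm : Static D m) (hin : i < D.n) (hIJ : I ⊆ J) (hM : PairsOn D I J m) :
    Tr (2 * D.n) (selectPairs i) m (90 * D.n)
      (fun _ m' => Fr [.chain .T, .chain .S, .inM] m m' ∧ PairsOn D I (insert i J) m' ∧
        ∀ σ, ChainOk D J i m' σ) := by
  intro t
  have hpos := D.pos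
  have heT := D.e_lt (σ := .T) hin
  have heS := D.e_lt (σ := .S) hin
  simp only [selectPairs, wps]
  rw [hm.verts, hm.edge _ i hin, hm.edge _ i hin]
  refine ⟨by omega, by omega, by omega, by omega, by omega, by omega, ?_⟩
  refine (tr_forUp (c := 4) (fun k m' => Fr [.chain .T, .chain .S] m m' ∧
    ∀ v < k, ∀ σ, m' (.chain σ) v 0 = 0) ⟨Fr.refl _ _, by simp⟩ ?_).use ?_
  · rintro k m₁ hk ⟨hf, h0⟩ t
    simp only [wps]
    refine ⟨by omega, by omega, by omega, by omega,
      ⟨(hf.upd (by simp)).upd (by simp), fun v hv σ => ?_⟩, by omega⟩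
    rcases Nat.lt_succ_iff_lt_or_eq.1 hv with hv | rfl
    · have := h0 v hv σ
      cases σ
      · rw [upd_ne _ _ _ _ (by simp), upd_zero, if_neg (by omega)]; exact this
      · rw [upd_zero, if_neg (by omega), upd_ne _ _ _ _ (by simp)]; exact this
    · cases σ
      · rw [upd_ne _ _ _ _ (by simp), upd_self]
      · rw [upd_self]
  rintro _ m₁ t₁ ⟨hf₁, h0⟩ ht₁
  refine (tr_forUp (c := 32) (fun k m' => Fr [.chain .T, .chain .S, .inM] m m' ∧
    (∀ u < 2 * D.n - 1, k ≤ u → m' .inM u 0 = m .inM u 0) ∧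
    (∀ u < k, m' .inM u 0 ≠ 0 → m .inM u 0 ≠ 0 ∧
      (D.e .T i ∈ D.L .T u ↔ D.e .S i ∈ D.L .S (m (.mate .T) u 0))) ∧
    (∀ u < 2 * D.n - 1, m' (.chain .T) u 0 ≠ 0 → m .inM u 0 ≠ 0 ∧ D.e .T i ∈ D.L .T u ∧
      D.e .S i ∉ D.L .S (m (.mate .T) u 0)) ∧
    (∀ v < 2 * D.n - 1, m' (.chain .S) v 0 ≠ 0 → ∃ u < 2 * D.n - 1, m .inM u 0 ≠ 0 ∧
      v = m (.mate .T) u 0 ∧ D.e .T i ∉ D.L .T u ∧ D.e .S i ∈ D.L .S v))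
    ⟨hf₁.mono (by simp), fun u _ _ => by rw [hf₁ _ (by simp)], by simp,
      fun u hu h => absurd (h0 u hu _) h, fun u hu h => absurd (h0 u hu _) h⟩ ?_).use ?_
  · rintro u m₂ hu ⟨hf, hge, hlt, hT, hS⟩ t
    have hm₂ := hm.frame hf
    simp only [wps]
    refine ⟨by omega, by omega, ?_⟩
    have keep : (m₂ .inM u 0 ≠ 0 → m .inM u 0 ≠ 0 ∧
          (D.e .T i ∈ D.L .T u ↔ D.e .S i ∈ D.L .S (m (.mate .T) u 0))) →
        (∀ v < 2 * D.n - 1, u + 1 ≤ v → m₂ .inM v 0 = m .inM v 0) ∧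
        ∀ v < u + 1, m₂ .inM v 0 ≠ 0 → m .inM v 0 ≠ 0 ∧
          (D.e .T i ∈ D.L .T v ↔ D.e .S i ∈ D.L .S (m (.mate .T) v 0)) := fun h =>
      ⟨fun v hv hv' => hge v hv (by omega), fun v hv => by
        rcases Nat.lt_succ_iff_lt_or_eq.1 hv with hv | rfl
        exacts [hlt v hv, h]⟩
    have drop : ∀ m₃ : Mem, (m₃ .inM = upd m₂ .inM u 0 0 .inM) →
        (∀ v < 2 * D.n - 1, u + 1 ≤ v → m₃ .inM v 0 = m .inM v 0) ∧
        ∀ v < u + 1, m₃ .inM v 0 ≠ 0 → m .inM v 0 ≠ 0 ∧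
          (D.e .T i ∈ D.L .T v ↔ D.e .S i ∈ D.L .S (m (.mate .T) v 0)) := fun m₃ e => by
      rw [e]
      refine ⟨fun v hv hv' => ?_, fun v hv => ?_⟩
      · rw [upd_zero, if_neg (by omega)]; exact hge v hv (by omega)
      · rw [upd_zero]
        split_ifs with hvu
        · exact fun h => absurd rfl h
        · exact hlt v (by omega)
    split_ifs with hu0
    · obtain ⟨k1, k2⟩ := keep fun h => absurd hu0 h
      exact ⟨⟨hf, k1, k2, hT, hS⟩, by omega⟩
    · rw [hf (.mate .T) (by simp)]
      have hu1 : m .inM u 0 ≠ 0 := by rw [← hge u hu le_rfl]; exact hu0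
      obtain ⟨hbT, hbS, -, -⟩ := hM u hu hu1
      have hv := hbS.2.1
      generalize hve : m (.mate .T) u 0 = v at *
      refine ⟨by omega, by omega, ?_⟩
      refine (test_lt_vertex hm₂ hu heT hbT.1).use ?_
      rintro a m₃ t₃ ⟨rfl, ha⟩ ht₃
      refine (test_lt_vertex hm₂ hv heS hbS.1).use ?_
      rintro b m₃ t₄ ⟨rfl, hb⟩ ht₄
      split_ifs with ha0 hb0 hb0
      · obtain ⟨k1, k2⟩ := keep fun _ => ⟨hu1, by
          exact iff_of_false (ha.not.1 (by simpa using ha0)) (hb.not.1 (by simpa using hb0))⟩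
        exact ⟨⟨hf, k1, k2, hT, hS⟩, by omega⟩
      · obtain ⟨k1, k2⟩ := drop (upd (upd m₃ (.chain .S) v 0 1) .inM u 0 0) (by
          funext x y; simp only [upd]; simp)
        refine ⟨by omega, by omega, by omega, by omega, ⟨(hf.upd (by simp)).upd (by simp), k1, k2,
          ?_, ?_⟩, by omega⟩
        · intro w hw
          rw [upd_ne _ _ _ _ (by simp), upd_ne _ _ _ _ (by simp)]
          exact hT w hw
        · intro w hw
          rw [upd_ne _ _ _ _ (by simp), upd_zero]
          split_ifs with hwv
          · exact fun _ => ⟨u, hu, hu1, hwv.trans hve.symm, ha.not.1 (by simpa using ha0),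
              hwv ▸ hb.1 hb0⟩
          · exact hS w hw
      · obtain ⟨k1, k2⟩ := drop (upd (upd m₃ (.chain .T) u 0 1) .inM u 0 0) (by
          funext x y; simp only [upd]; simp)
        refine ⟨by omega, by omega, by omega, by omega, ⟨(hf.upd (by simp)).upd (by simp), k1, k2,
          ?_, ?_⟩, by omega⟩
        · intro w hw
          rw [upd_ne _ _ _ _ (by simp), upd_zero]
          split_ifs with hwv
          · subst hwv
            exact fun _ => ⟨hu1, ha.1 ha0, by rw [hve]; exact hb.not.1 (by simpa using hb0)⟩
          · exact hT w hw
        · intro w hw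
          rw [upd_ne _ _ _ _ (by simp), upd_ne _ _ _ _ (by simp)]
          exact hS w hw
      · obtain ⟨k1, k2⟩ := keep fun _ => ⟨hu1, by
          exact iff_of_true (ha.1 ha0) (hb.1 hb0)⟩
        exact ⟨⟨hf, k1, k2, hT, hS⟩, by omega⟩
  · rintro _ m₂ t₂ ⟨hf, -, hlt, hT, hS⟩ ht₂
    have hE : ∀ u v, D.E .T J u = D.E .S J v → (D.e .T i ∈ D.L .T u ↔ D.e .S i ∈ D.L .S v) →
        D.E .T (insert i J) u = D.E .S (insert i J) v := by
      intro u v he h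
      ext j
      have := Finset.ext_iff.1 he j
      simp only [mem_E, Finset.mem_insert] at this ⊢
      by_cases hj : j = i
      · subst hj; simp [h]
      · simpa [hj] using this
    refine ⟨⟨hf, fun u hu h => ?_, fun σ v hv h => ?_⟩, by omega⟩
    · obtain ⟨h1, h2⟩ := hlt u hu h
      rw [hf _ (by simp), hf _ (by simp)]
      obtain ⟨k1, k2, k3, k4⟩ := hM u hu h1
      exact ⟨k1, k2, hE _ _ k3 h2, k4⟩
    · rw [hf _ (by simp)]
      cases σ
      · obtain ⟨h1, h2, h3⟩ := hT v hv h
        obtain ⟨k1, k2, k3, k4⟩ := hM v hv h1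
        exact ⟨hv, k2.2.1, k3, h2, h3, k1.mono hIJ⟩
      · obtain ⟨u, hu, h1, rfl, h2, h3⟩ := hS v hv h
        obtain ⟨k1, k2, k3, k4⟩ := hM u hu h1
        rw [k4]
        exact ⟨hv, hu, k3.symm, h3, h2, k2.mono hIJ⟩

end Tangle

namespace Tangle
open TreePair

variable {D : TreePair} {I J : Finset ℕ} {σ τ : Side} {X X' : Side → List ℕ} {m : Mem} {i : ℕ}

theorem Layout.side (h : Layout D J X) (σ : Side) : SideLayout D J σ (X σ) :=
  ⟨h.nodup σ, h.mem σ, h.convex σ⟩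

theorem tr_insertEdge (h : LState D m J X) (hJ : InJ D m J) (hIJ : I ⊆ J) (hJne : J.Nonempty)
    (hin : i < D.n) (hi : i ∉ J) (hM : PairsOn D I J m) :
    Tr (2 * D.n) (insertEdge i) m (5000 * D.n ^ 2) (fun _ m' => InJ D m' (insert i J) ∧
      PairsOn D I (insert i J) m' ∧ ∃ X', LState D m' (insert i J) X' ∧ SameOn D J X X' ∧
        (Partnered D J X → 2 ≤ (J.filter fun b => ¬ Cross D X' i b).card)) := by
  intro t
  have hpos := D.pos
  have hn2 : D.n ≤ D.n ^ 2 := Nat.le_self_pow (by simp) _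
  have hJn := h.layout.bound
  simp only [insertEdge, wps]
  refine (tr_findParent h.static hJ hJn hJne hin hi).use ?_
  rintro u m₀ t₁ ⟨rfl, hu⟩ ht₁
  refine (tr_findParent h.static hJ hJn hJne hin hi).use ?_
  rintro v m₀ t₂ ⟨rfl, hv⟩ ht₂
  refine (tr_extendLayout h.static (h.lst .T) (h.layout.side .T) (h.layout.length_le .T) hJn hin hi
    hu).use ?_
  rintro _ m₁ t₃ ⟨hf₁, A, hlA, hA, hA'⟩ ht₃
  have hm₁ := h.static.frame hf₁
  refine (tr_extendLayout hm₁ ((h.lst .S).frame hf₁) (h.layout.side .S) (h.layout.length_le .S) hJn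
    hin hi hv).use ?_
  rintro _ m₂ t₄ ⟨hf₂, B, hlB, hB, hB'⟩ ht₄
  obtain ⟨X₁, rfl, rfl⟩ : ∃ X : Side → List ℕ, A = X .T ∧ B = X .S :=
    ⟨fun σ => match σ with | .T => A | .S => B, rfl, rfl⟩
  generalize hw' : (fun σ : Side => (match σ with | .T => u | .S => v : ℕ)) = w
  have hw : ∀ σ, IsParent D J i σ (w σ) := fun σ => by
    subst hw'
    cases σ
    exacts [hu, hv]
  have hs : SameOn D J X X₁ := fun a ha b hb => by
    unfold Cross Before
    rw [hA' a ha b hb, hA' b hb a ha, hB' a ha b hb, hB' b hb a ha]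
  have h₂ : LState D m₂ (insert i J) X₁ := by
    refine ⟨hm₁.frame hf₂, ⟨fun j hj => ?_, fun σ => ?_, fun σ => ?_, fun σ => ?_⟩, fun σ => ?_⟩
    · rcases Finset.mem_insert.1 hj with rfl | hj
      exacts [hin, hJn j hj]
    · cases σ
      exacts [hA.nodup, hB.nodup]
    · cases σ
      exacts [hA.mem, hB.mem]
    · cases σ
      exacts [hA.convex, hB.convex]
    · cases σ
      exacts [hlA.frame hf₂, hlB]
  have hf₁₂ : Fr [.lay .T, .len .T, .lay .S, .len .S, .tmp] m₀ m₂ :=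
    (hf₁.mono (by simp)).trans (hf₂.mono (by simp))
  refine (tr_selectPairs h₂.static hin hIJ (hM.frame hf₁₂ (by simp))).use ?_
  rintro _ m₃ t₅ ⟨hf₃, hM₃, hc⟩ ht₅
  have h₃ := h₂.frame hf₃
  have hJ₃ : InJ D m₃ J := (hJ.frame hf₁₂).frame hf₃
  have fin : ∀ (m' : Mem) (t' : ℕ), (Fr layoutArrs m₃ m' ∧ ∃ X', LState D m' (insert i J) X' ∧
      SameOn D J X₁ X' ∧ (Partnered D J X₁ → 2 ≤ (J.filter fun b => ¬ Cross D X' i b).card)) →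
      t' ≤ t + 4900 * D.n ^ 2 →
      i < 2 * D.n ∧ 0 < 2 * D.n ∧ (InJ D (upd m' .inJ i 0 1) (insert i J) ∧
        PairsOn D I (insert i J) (upd m' .inJ i 0 1) ∧ ∃ X',
          LState D (upd m' .inJ i 0 1) (insert i J) X' ∧ SameOn D J X X' ∧
          (Partnered D J X → 2 ≤ (J.filter fun b => ¬ Cross D X' i b).card)) ∧
        t' + 1 + 2 ≤ t + 5000 * D.n ^ 2 := by
    rintro m' t' ⟨hf, X', h', hs', hX'⟩ ht'
    have hf' : Fr [.inJ] m' (upd m' .inJ i 0 1) := (Fr.refl _ _).upd (by simp)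
    have hJ' : InJ D m' J := hJ₃.frame hf (by simp [layoutArrs])
    refine ⟨by omega, by omega, ⟨fun j hj => ?_,
      (hM₃.frame hf (by simp [layoutArrs])).frame hf' (by simp), X', h'.frame hf', hs.trans hs',
      fun hp => hX' (hp.congr hs)⟩, by omega⟩
    rw [upd_zero, Finset.mem_insert]
    split_ifs with hji
    · simp [hji]
    · simpa [hji] using hJ' j hj
  refine (tr_isCaseAbove h₃.static (hc .S) (hw _).lt).use ?_
  rintro b m₄ t₆ ⟨rfl, hb⟩ ht₆
  refine (tr_isCaseAbove h₃.static (hc .T) (hw _).lt).use ?_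
  rintro b' m₄ t₇ ⟨rfl, hb'⟩ ht₇
  split_ifs with h0 h0'
  · refine (h₃.tr_insertionCaseOther hJ₃ hi hw hc).use ?_
    rintro _ m₅ t₈ h₅ ht₈
    exact fin m₅ t₈ h₅ (by omega)
  · refine (h₃.tr_insertionCaseAbove hJ₃ hi hw (hc .T) (hb' h0')).use ?_
    rintro _ m₅ t₈ ⟨h5, X', h5', h6, h7⟩ ht₈
    exact fin m₅ t₈ ⟨h5, X', h5', h6, fun _ => h7⟩ (by omega)
  · refine (h₃.tr_insertionCaseAbove hJ₃ hi hw (hc .S) (hb h0)).use ?_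
    rintro _ m₅ t₈ ⟨h5, X', h5', h6, h7⟩ ht₈
    exact fin m₅ t₈ ⟨h5, X', h5', h6, fun _ => h7⟩ (by omega)

/-! ### The algorithm -/

/-- The new edge gets an uncrossed edge as its partner; old partners persist because crossings
within J do not change. -/
theorem Partnered.insert (hp : Partnered D J X) (hs : SameOn D J X X') (hi : i ∉ J)
    (h2 : 2 ≤ (J.filter fun b => ¬ Cross D X' i b).card) : Partnered D (insert i J) X' := by
  intro a ha
  rcases Finset.mem_insert.1 ha with rfl | ha
  · obtain ⟨b, hb⟩ := Finset.card_pos.1 (zero_lt_two.trans_le h2)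
    rw [Finset.mem_filter] at hb
    exact ⟨b, by simp [hb.1], by rintro rfl; exact hi hb.1, hb.2⟩
  · obtain ⟨b, hb, hba, hc⟩ := hp.congr hs a ha
    exact ⟨b, by simp [hb], hba, hc⟩

/-- The bound on the number of crossings. -/
def FewCrossings (D : TreePair) (I J : Finset ℕ) (X : Side → List ℕ) : Prop :=
  crossSum D J X + 5 * J.card + I.card ^ 2 ≤ J.card ^ 2 + 5 * I.card

/-- The invariant is 2c ≤ (|J| - |I|)(|J| + |I| - 5), written without subtraction, where c is the
number of crossings. The new edge adds at most |J| - 2 crossings, and the right-hand side grows by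
exactly 2(|J| - 2). -/
theorem FewCrossings.insert (h : FewCrossings D I J X) (hs : SameOn D J X X') (hi : i ∉ J)
    (h2 : 2 ≤ (J.filter fun b => ¬ Cross D X' i b).card) : FewCrossings D I (insert i J) X' := by
  unfold FewCrossings at *
  have := Finset.card_filter_add_card_filter_not (s := J) fun b => Cross D X' i b
  rw [crossSum_insert hi, crossSum_congr hs, Finset.card_insert_of_notMem hi]
  nlinarith

theorem tr_iteratedInsertion {lt : ℕ → ℕ → Prop} (hi : Input D m)
    (hI : ∀ i < D.n, (m .inI i 0 ≠ 0 ↔ i ∈ I)) (hIne : I.Nonempty) (ho : PlanarOrder D I lt)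
    (h0 : ∀ u v, m .adj u v = 0) (hM : ∀ u, m .inM u 0 = 0) :
    Tr (2 * D.n) iteratedInsertion m (12000 * D.n ^ 3) (fun _ m' => ∃ X,
      LState D m' (Finset.range D.n) X ∧ (∀ a ∈ I, ∀ b ∈ I, ¬ Cross D X a b) ∧
      (2 ≤ I.card → FewCrossings D I (Finset.range D.n) X)) := by
  intro t
  have hpos := D.pos
  have hn2 : D.n ≤ D.n ^ 2 := Nat.le_self_pow (by simp) _
  have hn3 : D.n ^ 2 ≤ D.n ^ 3 := Nat.pow_le_pow_right hpos (by norm_num)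
  simp only [iteratedInsertion, wps]
  refine (tr_prepare hi hI).use ?_
  rintro _ m₁ t₁ ⟨hm₁, hJ₁, hf₁⟩ ht₁
  refine (tr_modifiedUntangle hm₁ hJ₁ hIne ho (fun u v => by rw [hf₁ _ (by simp)]; exact h0 u v)
    fun u => by rw [hf₁ _ (by simp)]; exact hM u).use ?_
  rintro _ m₂ t₂ ⟨hf₂, hM₂, lt', X₂, h₂, hX₂⟩ ht₂
  have hL : LState D m₂ I X₂ := ⟨h₂.static, h₂.layout hX₂, h₂.lst⟩
  have hcr : ∀ a ∈ I, ∀ b ∈ I, ¬ Cross D X₂ a b := fun a ha b hb => h₂.not_cross hX₂ ha hb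
  rw [hL.static.size]
  refine ⟨by omega, by omega, ?_⟩
  -- The edges are scanned in increasing order, so before pass k the set J is I together with all
  -- edges below k; an inserted edge is the least one missing.
  refine (tr_forUp (c := 5010 * D.n ^ 2) (fun k m' => InJ D m' (I ∪ Finset.range k) ∧
    PairsOn D I (I ∪ Finset.range k) m' ∧ ∃ X, LState D m' (I ∪ Finset.range k) X ∧
      (∀ a ∈ I, ∀ b ∈ I, ¬ Cross D X a b) ∧ (2 ≤ I.card → Partnered D (I ∪ Finset.range k) X ∧
        FewCrossings D I (I ∪ Finset.range k) X))
    ⟨?_, ?_, X₂, by simpa using hL, hcr, fun h2 => ?_⟩ ?_).use ?_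
  · simpa using hJ₁.frame hf₂ (by simp [modifiedUntangleArrs, untangleArrs])
  · rw [Finset.range_zero, Finset.union_empty]
    exact hM₂
  · refine ⟨fun a ha => ?_, ?_⟩
    · simp only [Finset.range_zero, Finset.union_empty] at ha ⊢
      obtain ⟨b, hb, hba⟩ := Finset.exists_mem_ne h2 a
      exact ⟨b, hb, hba, hcr a ha b hb⟩
    · have : crossSum D I X₂ = 0 := Finset.sum_eq_zero fun a ha => by
        rw [Finset.card_eq_zero, Finset.filter_eq_empty_iff]
        exact fun b hb => hcr a ha b hb
      simp [FewCrossings, this]; omega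
  · rintro k m' hk ⟨hJ, hMk, X, h, hcr, hfew⟩ t
    simp only [wps]
    refine ⟨by omega, by omega, ?_⟩
    have e : I ∪ Finset.range (k + 1) = insert k (I ∪ Finset.range k) := by
      rw [Finset.range_add_one, Finset.union_insert]
    split_ifs with hk0
    · have hkJ : k ∉ I ∪ Finset.range k := (hJ k hk).not.1 (by simpa using hk0)
      refine (tr_insertEdge h hJ Finset.subset_union_left (hIne.mono Finset.subset_union_left) hk
        hkJ hMk).use ?_
      rintro _ m₃ t₃ ⟨hJ₃, hM₃, X', h', hs, h2⟩ ht₃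
      rw [e]
      refine ⟨⟨hJ₃, hM₃, X', h', fun a ha b hb => ?_, fun hI2 => ?_⟩, by omega⟩
      · rw [hs a (by simp [ha]) b (by simp [hb])]; exact hcr a ha b hb
      · obtain ⟨hp, hF⟩ := hfew hI2
        exact ⟨hp.insert hs hkJ (h2 hp), hF.insert hs hkJ (h2 hp)⟩
    · rw [e, Finset.insert_eq_self.2 ((hJ k hk).1 hk0)]
      exact ⟨⟨hJ, hMk, X, h, hcr, hfew⟩, by omega⟩
  · rintro _ m₃ t₃ ⟨-, -, X, h, hcr, hfew⟩ ht₃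
    have e : I ∪ Finset.range D.n = Finset.range D.n :=
      Finset.union_eq_right.2 fun j hj => by simpa using ho.bound j hj
    rw [e] at h hfew
    refine ⟨⟨X, h, hcr, fun h2 => (hfew h2).2⟩, ?_⟩
    have : D.n * (5010 * D.n ^ 2 + 1) = 5010 * D.n ^ 3 + D.n := by ring
    omega

end Tangle

namespace Tangle

/-! ### Vertex numbers -/

namespace BinTree

variable {α : Type} {n : ℕ}

theorem length_leaves (t : BinTree α) : t.leaves.length = t.internals + 1 := by
  induction t with
  | leaf a => rfl
  | node l r hl hr => simp only [leaves, internals, List.length_append]; omega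

/-- The set of the numbers of the leaves. -/
def leafSet (t : BinTree (Fin n)) : Finset ℕ := (t.leaves.map Fin.val).toFinset

theorem mem_leafSet {t : BinTree (Fin n)} {x : ℕ} : x ∈ t.leafSet ↔ ∃ a ∈ t.leaves, a.val = x := by
  simp [leafSet]

theorem val_mem_leafSet {t : BinTree (Fin n)} {a : Fin n} : a.val ∈ t.leafSet ↔ a ∈ t.leaves := by
  rw [mem_leafSet]
  exact ⟨fun ⟨b, hb, h⟩ => Fin.ext h ▸ hb, fun h => ⟨a, h, rfl⟩⟩

theorem leafSet_node (l r : BinTree (Fin n)) : (node l r).leafSet = l.leafSet ∪ r.leafSet := by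
  simp [leafSet, leaves]

theorem leafSet_disjoint {l r : BinTree (Fin n)} (h : (node l r).leaves.Nodup) :
    Disjoint l.leafSet r.leafSet := by
  rw [Finset.disjoint_left]
  intro x hx hx'
  obtain ⟨a, ha, rfl⟩ := mem_leafSet.1 hx
  exact (List.nodup_append.1 h).2.2 a ha a (val_mem_leafSet.1 hx') rfl

/-- The sets of leaves below the internal vertices, in postorder. -/
def leafSets : BinTree (Fin n) → List (Finset ℕ)
  | leaf _ => []
  | node l r => l.leafSets ++ r.leafSets ++ [(node l r).leafSet]

theorem length_leafSets (t : BinTree (Fin n)) : t.leafSets.length = t.internals := by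
  induction t with
  | leaf a => rfl
  | node l r hl hr => simp [leafSets, internals, hl, hr, add_assoc]

theorem length_childPairs (t : BinTree (Fin n)) : ∀ k, (t.childPairs k).length = t.internals := by
  induction t with
  | leaf a => intro k; rfl
  | node l r hl hr => intro k; simp [childPairs, internals, hl, hr, add_assoc]

theorem rootNumber_cases (t : BinTree (Fin n)) (k : ℕ) : t.rootNumber k < n ∧ t.internals = 0 ∨
    k ≤ t.rootNumber k ∧ t.rootNumber k + 1 = k + t.internals := by
  cases t with
  | leaf a => exact Or.inl ⟨a.isLt, rfl⟩
  | node l r => right; simp only [rootNumber, internals]; omega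

theorem getD_append_append {β : Type} {A B : List β} {a b : ℕ} (hA : A.length = a) (hB : B.length = b)
    (c d : β) (j : ℕ) : (j < a → (A ++ B ++ [c]).getD j d = A.getD j d) ∧
    (j < b → (A ++ B ++ [c]).getD (a + j) d = B.getD j d) ∧
    (A ++ B ++ [c]).getD (a + b) d = c := by
  subst hA hB
  refine ⟨fun h => ?_, fun h => ?_, ?_⟩
  · rw [List.getD_append _ _ _ _ (by simp; omega), List.getD_append _ _ _ _ h]
  · rw [List.getD_append _ _ _ _ (by simp; omega), List.getD_append_right _ _ _ _ (by omega),
      Nat.add_sub_cancel_left]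
  · rw [List.getD_append_right _ _ _ _ (by simp)]
    simp

/-- The functions `ch` and `L` give the children and the leaves below the vertices of `t`, the
internal vertices of which are numbered in postorder, beginning with `k`. -/
structure Numbered (t : BinTree (Fin n)) (k : ℕ) (ch : Bool → ℕ → ℕ) (L : ℕ → Finset ℕ) :
    Prop where
  ch_lt : ∀ b v, k ≤ v → v < k + t.internals → ch b v < v ∧ (ch b v < n ∨ k ≤ ch b v)
  node : ∀ v, k ≤ v → v < k + t.internals → L v = L (ch false v) ∪ L (ch true v)
  disj : ∀ v, k ≤ v → v < k + t.internals → Disjoint (L (ch false v)) (L (ch true v))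
  sub : ∀ v, k ≤ v → v < k + t.internals → L v ⊆ t.leafSet
  lam : ∀ v v', v < v' → (v < n ∨ k ≤ v) → k ≤ v' → v' < k + t.internals →
    (∃ b, L v ⊆ L (ch b v')) ∨ Disjoint (L v) (L v')
  root : L (t.rootNumber k) = t.leafSet

/-- In postorder the numbers split into those of the left subtree, those of the right subtree, and
the root. Properties inside a subtree come from induction; vertices of different subtrees have
disjoint leaf sets. -/
theorem numbered {ch : Bool → ℕ → ℕ} {L : ℕ → Finset ℕ} (h0 : ∀ v < n, L v = {v}) :
    ∀ (t : BinTree (Fin n)) (k : ℕ), n ≤ k → t.leaves.Nodup →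
      (∀ j < t.internals, (t.childPairs k).getD j (0, 0) = (ch false (k + j), ch true (k + j))) →
      (∀ j < t.internals, t.leafSets.getD j ∅ = L (k + j)) → Numbered t k ch L := by
  intro t
  induction t with
  | leaf a =>
    intro k _ _ _ _
    have : ∀ v, k ≤ v → ¬ v < k + (leaf a).internals := fun v h => by simp [internals]; omega
    exact ⟨fun b v h h' => absurd h' (this v h), fun v h h' => absurd h' (this v h),
      fun v h h' => absurd h' (this v h), fun v h h' => absurd h' (this v h),
      fun _ v _ _ h h' => absurd h' (this v h), by simp [rootNumber, leafSet, leaves, h0]⟩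
  | node l r ihl ihr =>
    intro k hk hnd hc hL
    have hnd' := List.nodup_append.1 hnd
    simp only [internals] at hc hL
    simp only [childPairs, leafSets] at hc hL
    have gl := length_childPairs l k
    have gr := length_childPairs r (k + l.internals)
    have el := length_leafSets l
    have er := length_leafSets r
    have Nl := ihl k hk hnd'.1 (fun j hj => by
      rw [← hc j (by omega), (getD_append_append gl gr _ _ j).1 hj]) fun j hj => by
      rw [← hL j (by omega), (getD_append_append el er _ _ j).1 hj]
    have Nr := ihr (k + l.internals) (by omega) hnd'.2.1 (fun j hj => by
      rw [add_assoc, ← hc (l.internals + j) (by omega),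
        (getD_append_append gl gr _ _ j).2.1 hj]) fun j hj => by
      rw [add_assoc, ← hL (l.internals + j) (by omega),
        (getD_append_append el er _ _ j).2.1 hj]
    have hroot := hc (l.internals + r.internals) (by omega)
    have hLroot := hL (l.internals + r.internals) (by omega)
    rw [(getD_append_append gl gr _ _ 0).2.2, Prod.mk.injEq, ← add_assoc] at hroot
    rw [(getD_append_append el er _ _ 0).2.2, ← add_assoc] at hLroot
    have hdis := leafSet_disjoint hnd
    -- The root of a subtree is either a leaf, with a number below n, or has the last number of its
    -- interval.
    rcases l.rootNumber_cases k with cl | cl <;>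
      rcases r.rootNumber_cases (k + l.internals) with cr | cr
    all_goals
      have split : ∀ v, k ≤ v → v < k + (l.internals + r.internals + 1) →
          v < k + l.internals ∨ (k + l.internals ≤ v ∧ v < k + l.internals + r.internals) ∨
          v = k + l.internals + r.internals := fun v h h' => by omega
      refine ⟨fun b v h h' => ?_, fun v h h' => ?_, fun v h h' => ?_, fun v h h' => ?_,
        fun v v' hvv' hv h h' => ?_, by rw [rootNumber, ← hLroot]⟩
      · rcases split v h h' with h' | ⟨h1, h2⟩ | rfl
        · exact Nl.ch_lt b v h h'
        · have := Nr.ch_lt b v h1 h2; omega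
        · cases b
          · rw [← hroot.1]; omega
          · rw [← hroot.2]; omega
      · rcases split v h h' with h' | ⟨h1, h2⟩ | rfl
        · exact Nl.node v h h'
        · exact Nr.node v h1 h2
        · rw [← hroot.1, ← hroot.2, Nl.root, Nr.root, ← hLroot, leafSet_node]
      · rcases split v h h' with h' | ⟨h1, h2⟩ | rfl
        · exact Nl.disj v h h'
        · exact Nr.disj v h1 h2
        · rw [← hroot.1, ← hroot.2, Nl.root, Nr.root]; exact hdis
      · rw [leafSet_node]
        rcases split v h h' with h' | ⟨h1, h2⟩ | rfl
        · exact (Nl.sub v h h').trans Finset.subset_union_left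
        · exact (Nr.sub v h1 h2).trans Finset.subset_union_right
        · rw [← hLroot, leafSet_node]
      · rcases split v' h h' with h1 | ⟨h1, h2⟩ | rfl
        · exact Nl.lam v v' hvv' hv h h1
        · rcases hv with hv | hv
          · exact Nr.lam v v' hvv' (Or.inl hv) h1 h2
          · by_cases h3 : k + l.internals ≤ v
            · exact Nr.lam v v' hvv' (Or.inr h3) h1 h2
            · exact Or.inr (hdis.mono (Nl.sub v hv (by omega)) (Nr.sub v' h1 h2))
        · rw [← hLroot, leafSet_node]
          rcases hv with hv | hv
          · by_cases h1 : v ∈ l.leafSet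
            · exact Or.inl ⟨false, by rw [← hroot.1, Nl.root, h0 v hv]; simpa using h1⟩
            by_cases h2 : v ∈ r.leafSet
            · exact Or.inl ⟨true, by rw [← hroot.2, Nr.root, h0 v hv]; simpa using h2⟩
            · exact Or.inr (by rw [h0 v hv]; simp [h1, h2])
          · rcases lt_or_ge v (k + l.internals) with h1 | h1
            · exact Or.inl ⟨false, by rw [← hroot.1, Nl.root]; exact Nl.sub v hv h1⟩
            · exact Or.inl ⟨true, by rw [← hroot.2, Nr.root]; exact Nr.sub v h1 (by omega)⟩

/-! ### Leaf orders and convexity -/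

/-- The leaf orders of the tree induced by the leaves with the property `p`; the empty list if there
are none. -/
def IsInducedOrder (p : α → Prop) [DecidablePred p] : BinTree α → List α → Prop
  | leaf a, X => X = if p a then [a] else []
  | node l r, X => ∃ A B, l.IsInducedOrder p A ∧ r.IsInducedOrder p B ∧ (X = A ++ B ∨ X = B ++ A)

/-- Concatenation with an empty list has the effect of suppressing a vertex with one child, so
inductions can avoid the option type. -/
theorem isInducedOrder_iff (p : α → Prop) [DecidablePred p] (t : BinTree α) : ∀ X,
    t.IsInducedOrder p X ↔ match t.induce p with
      | some t' => t'.IsLeafOrder X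
      | none => X = [] := by
  induction t with
  | leaf a =>
    intro X
    by_cases h : p a <;> simp [IsInducedOrder, induce, h, IsLeafOrder]
  | node l r hl hr =>
    intro X
    simp only [IsInducedOrder, induce, hl, hr]
    cases l.induce p <;> cases r.induce p <;> simp [IsLeafOrder]

theorem IsLeafOrder.filter (p : α → Prop) [DecidablePred p] (t : BinTree α) : ∀ {X : List α},
    t.IsLeafOrder X → t.IsInducedOrder p (X.filter p) := by
  induction t with
  | leaf a =>
    rintro X rfl
    by_cases h : p a <;> simp [IsInducedOrder, h]
  | node l r hl hr =>
    rintro X ⟨A, B, hA, hB, rfl | rfl⟩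
    · exact ⟨_, _, hl hA, hr hB, Or.inl (by simp)⟩
    · exact ⟨_, _, hl hA, hr hB, Or.inr (by simp)⟩

theorem IsInducedOrder.mem {p : α → Prop} [DecidablePred p] (t : BinTree α) : ∀ {X : List α} {a : α},
    t.IsInducedOrder p X → (a ∈ X ↔ a ∈ t.leaves ∧ p a) := by
  induction t with
  | leaf b =>
    rintro X a rfl
    by_cases h : p b <;> simp only [h, if_true, if_false, leaves, List.mem_singleton,
      List.not_mem_nil, false_iff]
    · exact ⟨fun e => ⟨e, e ▸ h⟩, fun e => e.1⟩
    · rintro ⟨rfl, h'⟩; exact h h'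
  | node l r hl hr =>
    rintro X a ⟨A, B, hA, hB, rfl | rfl⟩ <;>
      simp only [List.mem_append, hl hA, hr hB, leaves] <;> tauto

end BinTree
end Tangle

namespace Tangle

/-! ### Convexity and leaf orders -/

theorem idxOf_map_val {n : ℕ} (X : List (Fin n)) (a : Fin n) :
    (X.map Fin.val).idxOf a.val = X.idxOf a := by
  induction X with
  | nil => rfl
  | cons x X ih =>
    by_cases h : x = a
    · subst h; simp
    · rw [List.map_cons, List.idxOf_cons_ne _ h, List.idxOf_cons_ne _ fun e => h (Fin.ext e), ih]

theorem idxOf_append_left {A : List ℕ} (B : List ℕ) {a : ℕ} (ha : a ∈ A) :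
    (A ++ B).idxOf a = A.idxOf a := by rw [List.idxOf_append, if_pos ha]

theorem idxOf_append_right {A B : List ℕ} (h : (A ++ B).Nodup) {b : ℕ} (hb : b ∈ B) :
    (A ++ B).idxOf b = A.length + B.idxOf b := by
  rw [List.idxOf_append, if_neg fun ha => (List.nodup_append.1 h).2.2 b ha b hb rfl, add_comm]

theorem Convex.of_append {A B : List ℕ} {S : Finset ℕ} (h : (A ++ B).Nodup)
    (hc : Convex (A ++ B) S) : Convex A S ∧ Convex B S := by
  refine ⟨fun a ha b hb c hc' h1 h2 => ?_, fun a ha b hb c hc' h1 h2 => ?_⟩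
  · refine hc a (by simp [ha]) b (by simp [hb]) c (by simp [hc']) ?_ ?_
    · rwa [idxOf_append_left B ha, idxOf_append_left B hb]
    · rwa [idxOf_append_left B hb, idxOf_append_left B hc']
  · refine hc a (by simp [ha]) b (by simp [hb]) c (by simp [hc']) ?_ ?_
    · rw [idxOf_append_right h ha, idxOf_append_right h hb]; omega
    · rw [idxOf_append_right h hb, idxOf_append_right h hc']; omega

theorem Convex.append_left {A B : List ℕ} {S : Finset ℕ} (hc : Convex A S)
    (hB : ∀ b ∈ B, b ∉ S) : Convex (A ++ B) S := by
  have key : ∀ c ∈ A ++ B, c ∈ S → c ∈ A := fun c hc' hcS =>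
    (List.mem_append.1 hc').resolve_right fun h => hB c h hcS
  intro a ha b hb c hc' h1 h2 haS hcS
  have haA := key a ha haS
  have hcA := key c hc' hcS
  rw [idxOf_append_left B hcA] at h2
  have hbA : b ∈ A := by
    by_contra hbA
    rw [List.idxOf_append, if_neg hbA] at h2
    have := List.idxOf_le_length (a := c) (l := A)
    omega
  rw [idxOf_append_left B haA, idxOf_append_left B hbA] at h1
  rw [idxOf_append_left B hbA] at h2
  exact hc a haA b hbA c hcA h1 h2 haS hcS

theorem Convex.append_right {A B : List ℕ} {S : Finset ℕ} (h : (A ++ B).Nodup) (hc : Convex B S)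
    (hA : ∀ a ∈ A, a ∉ S) : Convex (A ++ B) S := by
  have key : ∀ c ∈ A ++ B, c ∈ S → c ∈ B := fun c hc' hcS =>
    (List.mem_append.1 hc').resolve_left fun h => hA c h hcS
  intro a ha b hb c hc' h1 h2 haS hcS
  have haB := key a ha haS
  have hcB := key c hc' hcS
  rw [idxOf_append_right h haB] at h1
  have hbB : b ∈ B := by
    by_contra hbB
    have hbA := (List.mem_append.1 hb).resolve_right hbB
    rw [idxOf_append_left B hbA] at h1
    have := List.idxOf_lt_length_of_mem hbA
    omega
  rw [idxOf_append_right h hbB] at h1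
  rw [idxOf_append_right h hbB, idxOf_append_right h hcB] at h2
  exact hc a haB b hbB c hcB (by omega) (by omega) haS hcS

theorem convex_singleton (X : List ℕ) (x : ℕ) : Convex X {x} := by
  intro a _ b _ c _ h1 h2 ha hc
  rw [Finset.mem_singleton] at ha hc
  subst ha hc
  omega

namespace BinTree

variable {n : ℕ}

theorem subset_leafSet {t : BinTree (Fin n)} {S : Finset ℕ} (h : S ∈ t.leafSets) :
    S ⊆ t.leafSet := by
  induction t with
  | leaf a => simp [leafSets] at h
  | node l r hl hr =>
    simp only [leafSets, List.mem_append, List.mem_singleton] at h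
    rcases h with (h | h) | rfl
    · rw [leafSet_node]; exact (hl h).trans Finset.subset_union_left
    · rw [leafSet_node]; exact (hr h).trans Finset.subset_union_right
    · exact subset_rfl

theorem convex_leafSet {t : BinTree (Fin n)} {X : List ℕ} (h : ∀ S ∈ t.leafSets, Convex X S) :
    Convex X t.leafSet := by
  cases t with
  | leaf a => exact convex_singleton X a
  | node l r => exact h _ (by simp [leafSets])

/-- A leaf set inside one child is convex in the part of the list for this child and misses the
other part. -/
theorem IsInducedOrder.convex {p : Fin n → Prop} [DecidablePred p] (t : BinTree (Fin n)) :
    ∀ {X : List (Fin n)}, t.IsInducedOrder p X → X.Nodup → t.leaves.Nodup →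
      ∀ S ∈ t.leafSets, Convex (X.map Fin.val) S := by
  induction t with
  | leaf a => intro X _ _ _ S hS; simp [leafSets] at hS
  | node l r ihl ihr =>
    rintro X h hX hnd S hS
    have hmem : ∀ x ∈ X.map Fin.val, x ∈ (node l r).leafSet := by
      intro x hx
      obtain ⟨a, ha, rfl⟩ := List.mem_map.1 hx
      exact val_mem_leafSet.2 (((IsInducedOrder.mem _ h).1 ha).1)
    obtain ⟨A, B, hA, hB, hX'⟩ := h
    have hnd' := List.nodup_append.1 hnd
    have hdis := leafSet_disjoint hnd
    have mA : ∀ a ∈ A.map Fin.val, a ∈ l.leafSet := by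
      intro x hx
      obtain ⟨a, ha, rfl⟩ := List.mem_map.1 hx
      exact val_mem_leafSet.2 ((IsInducedOrder.mem _ hA).1 ha).1
    have mB : ∀ a ∈ B.map Fin.val, a ∈ r.leafSet := by
      intro x hx
      obtain ⟨a, ha, rfl⟩ := List.mem_map.1 hx
      exact val_mem_leafSet.2 ((IsInducedOrder.mem _ hB).1 ha).1
    have hXn : (X.map Fin.val).Nodup := hX.map Fin.val_injective
    simp only [leafSets, List.mem_append, List.mem_singleton] at hS
    rcases hS with (hS | hS) | rfl
    · have hBS : ∀ b ∈ B.map Fin.val, b ∉ S := fun b hb hbS =>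
        Finset.disjoint_left.1 hdis (subset_leafSet hS hbS) (mB b hb)
      rcases hX' with rfl | rfl <;> rw [List.map_append] at hXn ⊢
      · exact (ihl hA (List.nodup_append.1 hX).1 hnd'.1 S hS).append_left hBS
      · exact (ihl hA (List.nodup_append.1 hX).2.1 hnd'.1 S hS).append_right hXn hBS
    · have hAS : ∀ b ∈ A.map Fin.val, b ∉ S := fun b hb hbS =>
        Finset.disjoint_left.1 hdis (mA b hb) (subset_leafSet hS hbS)
      rcases hX' with rfl | rfl <;> rw [List.map_append] at hXn ⊢
      · exact (ihr hB (List.nodup_append.1 hX).2.1 hnd'.2.1 S hS).append_right hXn hAS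
      · exact (ihr hB (List.nodup_append.1 hX).1 hnd'.2.1 S hS).append_left hAS
    · exact fun a _ b hb c _ _ _ _ _ => hmem b hb

theorem leaves_ne_nil (t : BinTree (Fin n)) : t.leaves ≠ [] := by
  rw [ne_eq, ← List.length_eq_zero_iff, length_leaves]; omega

/-- The leaves of the left child form a block B in X = A ++ B ++ C, and the rest belongs to the
right child. Since the leaves of the right child are consecutive too, A or C is empty, and the order
splits at the root. -/
theorem isLeafOrder_of_convex (t : BinTree (Fin n)) : ∀ {X : List (Fin n)}, X.Nodup →
    (∀ a, a ∈ X ↔ a ∈ t.leaves) → t.leaves.Nodup →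
    (∀ S ∈ t.leafSets, Convex (X.map Fin.val) S) → t.IsLeafOrder X := by
  induction t with
  | leaf a =>
    intro X hX hmem _ _
    simp only [leaves, List.mem_singleton] at hmem
    have : X.Perm [a] := (List.perm_ext_iff_of_nodup hX (by simp)).2 (by simpa using hmem)
    exact List.perm_singleton.1 this
  | node l r ihl ihr =>
    intro X hX hmem hnd hS
    have hXn : (X.map Fin.val).Nodup := hX.map Fin.val_injective
    have hnd' := List.nodup_append.1 hnd
    have hdis := leafSet_disjoint hnd
    simp only [leafSets, List.mem_append, List.mem_singleton] at hS
    have cl := convex_leafSet fun S h => hS S (Or.inl (Or.inl h))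
    have cr := convex_leafSet fun S h => hS S (Or.inl (Or.inr h))
    have fin : ∀ A B, X = A ++ B ∨ X = B ++ A → (∀ a ∈ A, a ∈ l.leaves) →
        (∀ b ∈ B, b ∈ r.leaves) → (node l r).IsLeafOrder X := by
      intro A B hAB hA hB
      refine ⟨A, B, ihl ?_ ?_ hnd'.1 ?_, ihr ?_ ?_ hnd'.2.1 ?_, hAB⟩
      · rcases hAB with rfl | rfl
        exacts [(List.nodup_append.1 hX).1, (List.nodup_append.1 hX).2.1]
      · refine fun a => ⟨hA a, fun ha => ?_⟩
        have hb : a ∉ B := fun hb => hnd'.2.2 a ha a (hB a hb) rfl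
        have := (hmem a).2 (List.mem_append.2 (Or.inl ha))
        rcases hAB with rfl | rfl <;> simpa [hb] using this
      · intro S h
        have := hS S (Or.inl (Or.inl h))
        rcases hAB with rfl | rfl <;> rw [List.map_append] at this hXn
        exacts [(this.of_append hXn).1, (this.of_append hXn).2]
      · rcases hAB with rfl | rfl
        exacts [(List.nodup_append.1 hX).2.1, (List.nodup_append.1 hX).1]
      · refine fun a => ⟨hB a, fun ha => ?_⟩
        have hb : a ∉ A := fun hb => hnd'.2.2 a (hA a hb) a ha rfl
        have := (hmem a).2 (List.mem_append.2 (Or.inr ha))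
        rcases hAB with rfl | rfl <;> simpa [hb] using this
      · intro S h
        have := hS S (Or.inl (Or.inr h))
        rcases hAB with rfl | rfl <;> rw [List.map_append] at this hXn
        exacts [(this.of_append hXn).2, (this.of_append hXn).1]
    obtain ⟨A', B', C', he, hA, hB, hC⟩ := cl.split hXn
    obtain ⟨AB, C, rfl, hAB, rfl⟩ := List.map_eq_append_iff.1 he
    obtain ⟨A, B, rfl, rfl, rfl⟩ := List.map_eq_append_iff.1 hAB
    have toR : ∀ a, a ∈ A ++ B ++ C → a.val ∉ l.leafSet → a ∈ r.leaves := fun a ha h =>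
      (List.mem_append.1 ((hmem a).1 ha)).resolve_left fun h' => h (val_mem_leafSet.2 h')
    have hA' : ∀ a ∈ A, a ∈ r.leaves := fun a ha =>
      toR a (by simp [ha]) (hA _ (List.mem_map_of_mem ha))
    have hC' : ∀ a ∈ C, a ∈ r.leaves := fun a ha =>
      toR a (by simp [ha]) (hC _ (List.mem_map_of_mem ha))
    have hB' : ∀ a ∈ B, a ∈ l.leaves := fun a ha =>
      val_mem_leafSet.1 (hB _ (List.mem_map_of_mem ha))
    rcases A with _ | ⟨a, A⟩
    · exact fin B C (Or.inl (by simp)) hB' hC'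
    rcases C with _ | ⟨c, C⟩
    · exact fin B (a :: A) (Or.inr (by simp)) hB' hA'
    -- If A and C were both nonempty, a leaf of the left child would lie between two leaves of the
    -- right child.
    exfalso
    obtain ⟨x, hx⟩ := List.exists_mem_of_ne_nil _ (leaves_ne_nil l)
    have hxB : x ∈ B := by
      by_contra hxB
      have := (hmem x).2 (List.mem_append.2 (Or.inl hx))
      rw [List.mem_append, List.mem_append] at this
      rcases this with (h | h) | h
      · exact hnd'.2.2 x hx x (hA' x h) rfl
      · exact hxB h
      · exact hnd'.2.2 x hx x (hC' x h) rfl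
    have hxB' := List.mem_map_of_mem (f := Fin.val) hxB
    have hxr := cr a (by simp) x (List.mem_map_of_mem (by simp [hxB])) c (by simp) (by
        rw [List.map_append, hAB] at hXn ⊢
        rw [idxOf_append_left _ (by simp), idxOf_append_left _ (List.mem_append_right _ hxB')]
        exact idxOf_lt_of_append (List.nodup_append.1 hXn).1 (by simp) hxB') (by
        rw [List.map_append, hAB] at hXn ⊢
        exact idxOf_lt_of_append hXn (List.mem_append_right _ hxB') (by simp))
      (val_mem_leafSet.2 (hA' a (by simp))) (val_mem_leafSet.2 (hC' c (by simp)))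
    exact Finset.disjoint_left.1 hdis (val_mem_leafSet.2 hx) hxr

end BinTree
end Tangle

namespace Tangle
open TreePair

/-! ### Tanglegrams as pairs of trees -/

namespace BinTree

variable {α : Type}

theorem IsLeafOrder.perm {t : BinTree α} {X : List α} (h : t.IsLeafOrder X) :
    X.Perm t.leaves := by
  induction t generalizing X with
  | leaf a => rw [h]; rfl
  | node l r hl hr =>
    obtain ⟨A, B, hA, hB, rfl | rfl⟩ := h
    · exact (hl hA).append (hr hB)
    · exact List.perm_append_comm.trans ((hl hA).append (hr hB))

theorem isLeafOrder_get_induce {p : α → Prop} [DecidablePred p] {t : BinTree α}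
    (h : (t.induce p).isSome) {X : List α} :
    ((t.induce p).get h).IsLeafOrder X ↔ t.IsInducedOrder p X := by
  rw [isInducedOrder_iff]
  obtain ⟨t', ht'⟩ := Option.isSome_iff_exists.1 h
  simp [ht']

end BinTree

namespace Tanglegram

variable {n : ℕ} {G : Tanglegram n}

theorem Full.mem_side (hG : G.Full) (σ : Side) (i : Fin n) : i ∈ (G.side σ).leaves := by
  cases σ
  · exact hG i
  · have := (G.matched (G.φ.symm i)).1 (hG _)
    rwa [Equiv.apply_symm_apply] at this

theorem nodup_side (σ : Side) : (G.side σ).leaves.Nodup := by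
  cases σ
  exacts [G.nodup_T, G.nodup_S]

theorem Full.internals_side (hG : G.Full) (σ : Side) : (G.side σ).internals + 1 = n := by
  have h : (G.side σ).leaves.toFinset = Finset.univ := by
    ext i; simp [hG.mem_side σ i]
  rw [← BinTree.length_leaves, ← List.toFinset_card_of_nodup (nodup_side σ), h, Finset.card_univ,
    Fintype.card_fin]

/-- The children of the vertices of the two trees. -/
def childOf (G : Tanglegram n) (σ : Side) (b : Bool) (v : ℕ) : ℕ :=
  let p := ((G.side σ).childPairs n).getD (v - n) (0, 0)
  if b then p.2 else p.1

/-- The leaves below the vertices of the two trees. -/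
def leavesBelow (G : Tanglegram n) (σ : Side) (v : ℕ) : Finset ℕ :=
  if v < n then {v} else (G.side σ).leafSets.getD (v - n) ∅

theorem numbered_side (σ : Side) : (G.side σ).Numbered n (G.childOf σ) (G.leavesBelow σ) :=
  BinTree.numbered (fun v hv => by simp [leavesBelow, hv]) _ _ le_rfl (nodup_side σ)
    (fun j _ => by simp [childOf]) fun j _ => by simp [leavesBelow]

/-- The matching of the leaves, as a function on the natural numbers. -/
def matching (G : Tanglegram n) (i : ℕ) : ℕ := if h : i < n then (G.φ ⟨i, h⟩ : ℕ) else 0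

theorem matching_val (i : Fin n) : G.matching i = G.φ i := by simp [matching]

/-- The two trees of a tanglegram of size `n` and the matching between them. -/
def treePair (G : Tanglegram n) (hG : G.Full) (hn : 1 ≤ n) : TreePair where
  n := n
  ch := G.childOf
  L := G.leavesBelow
  f := G.matching
  pos := hn
  f_lt i hi := by simp [matching, hi]
  f_inj i hi j hj h := by
    rw [matching, matching, dif_pos hi, dif_pos hj] at h
    simpa using G.φ.injective (Fin.ext h)
  ch_lt σ b v h h' := ((numbered_side σ).ch_lt b v h (by have := hG.internals_side σ; omega)).1
  L_leaf σ v hv := by simp [leavesBelow, hv]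
  L_node σ v x h h' := by
    rw [(numbered_side σ).node v h (by have := hG.internals_side σ; omega), Finset.mem_union]
  disj σ v x h h' hx := Finset.disjoint_left.1 ((numbered_side (G := G) σ).disj v h
    (by have := hG.internals_side σ; omega)) hx
  lam σ v v' h h1 h2 := (numbered_side σ).lam v v' h (lt_or_ge v n) h1
    (by have := hG.internals_side σ; omega)
  root σ x hx := by
    have h1 := hG.internals_side σ
    have h2 := (numbered_side (G := G) σ).root
    -- If n = 1, the root is the only leaf, which has the number 0 = 2n - 2.
    rcases (G.side σ).rootNumber_cases n with h | h
    · rw [leavesBelow, if_pos (by omega), Finset.mem_singleton]; omega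
    · rw [show 2 * n - 2 = (G.side σ).rootNumber n by omega, h2]
      exact BinTree.mem_leafSet.2 ⟨⟨x, hx⟩, hG.mem_side σ _, rfl⟩

variable {hG : G.Full} {hn : 1 ≤ n} {I : Finset (Fin n)}

/-- The leaf of the edge `i` on side `σ`. -/
def endpoint (G : Tanglegram n) : Side → Fin n → Fin n
  | .T, i => i
  | .S, i => G.φ i

theorem e_treePair (σ : Side) (i : Fin n) : (G.treePair hG hn).e σ i = G.endpoint σ i := by
  cases σ
  exacts [rfl, matching_val i]

theorem convex_leavesBelow (hG : G.Full) {σ : Side} {X : List ℕ}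
    (h : ∀ S ∈ (G.side σ).leafSets, Convex X S) {v : ℕ} (hv : v < 2 * n - 1) :
    Convex X (G.leavesBelow σ v) := by
  unfold leavesBelow
  split_ifs with hvn
  · exact convex_singleton X v
  · have hlt : v - n < (G.side σ).leafSets.length := by
      rw [BinTree.length_leafSets]
      have := hG.internals_side σ
      omega
    rw [List.getD_eq_getElem _ _ hlt]
    exact h _ (List.getElem_mem hlt)

theorem convex_of_mem_leafSets (hG : G.Full) {σ : Side} {X : List ℕ}
    (h : ∀ v < 2 * n - 1, Convex X (G.leavesBelow σ v)) {S : Finset ℕ}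
    (hS : S ∈ (G.side σ).leafSets) : Convex X S := by
  obtain ⟨j, hj, rfl⟩ := List.getElem_of_mem hS
  have h1 := hj
  rw [BinTree.length_leafSets] at h1
  have h2 := hG.internals_side σ
  have := h (n + j) (by omega)
  rwa [leavesBelow, if_neg (by omega), Nat.add_sub_cancel_left, List.getD_eq_getElem _ _ hj] at this

theorem input (hG : G.Full) (hn : 1 ≤ n) (I : Finset (Fin n)) :
    Input (G.treePair hG hn) (inputState G I).mem where
  size := rfl
  child σ b v h h' := by
    have h : n ≤ v := h
    cases b <;> simp [inputState, treePair, childOf, h]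
  phi i hi := rfl

theorem crossings_eq_zero_iff {X Y : List (Fin n)} : G.crossings X Y = 0 ↔
    ∀ i ∈ G.T.leaves, ∀ j ∈ G.T.leaves, X.idxOf i < X.idxOf j →
      ¬ Y.idxOf (G.φ j) < Y.idxOf (G.φ i) := by
  rw [crossings, Finset.card_eq_zero, Finset.filter_eq_empty_iff]
  constructor
  · exact fun h i hi j hj hij hji => h (Finset.mem_univ (i, j)) ⟨hi, hj, hij, hji⟩
  · rintro h ⟨i, j⟩ - ⟨hi, hj, hij, hji⟩
    exact h i hi j hj hij hji

/-- The edges are ordered by their positions in T. Without crossings this is also their order in S,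
so edge sets are convex for the vertices of both trees. -/
theorem planarOrder {hI : I.Nonempty} (h : (G.induced hG I hI).IsPlanar) :
    ∃ lt, PlanarOrder (G.treePair hG hn) (I.image Fin.val) lt := by
  obtain ⟨X, Y, ⟨hX, hY⟩, hc⟩ := h
  rw [crossings_eq_zero_iff] at hc
  have hXn := hX.perm.nodup_iff.2 (G.induced hG I hI).nodup_T
  have hYn := hY.perm.nodup_iff.2 (G.induced hG I hI).nodup_S
  replace hc : ∀ i ∈ X, ∀ j ∈ X, X.idxOf i < X.idxOf j → ¬ Y.idxOf (G.φ j) < Y.idxOf (G.φ i) :=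
    fun i hi j hj => hc i (hX.perm.mem_iff.1 hi) j (hX.perm.mem_iff.1 hj)
  have hX' := BinTree.isLeafOrder_get_induce _ |>.1 hX
  have hY' := BinTree.isLeafOrder_get_induce _ |>.1 hY
  have memX : ∀ i, i ∈ X ↔ i ∈ I := fun i => by
    rw [BinTree.IsInducedOrder.mem _ hX']; simp [hG i]
  have memY : ∀ i, G.φ i ∈ Y ↔ i ∈ I := fun i => by
    rw [BinTree.IsInducedOrder.mem _ hY']
    simp [← G.matched i, hG i]
  refine ⟨fun a b => (X.map Fin.val).idxOf a < (X.map Fin.val).idxOf b, ?_, ?_, ?_, ?_, ?_⟩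
  · intro i hi
    obtain ⟨a, -, rfl⟩ := Finset.mem_image.1 hi
    exact a.isLt
  · exact fun i _ => lt_irrefl _
  · exact fun i _ j _ k _ => lt_trans
  · intro i hi j hj hij
    obtain ⟨a, ha, rfl⟩ := Finset.mem_image.1 hi
    obtain ⟨b, hb, rfl⟩ := Finset.mem_image.1 hj
    rw [idxOf_map_val, idxOf_map_val]
    refine lt_or_gt_of_ne fun he => hij ?_
    rw [(List.idxOf_inj ((memX a).2 ha)).1 he]
  · intro σ v hv i hi j hj k hk hij hjk hiv hkv
    obtain ⟨a, ha, rfl⟩ := Finset.mem_image.1 hi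
    obtain ⟨b, hb, rfl⟩ := Finset.mem_image.1 hj
    obtain ⟨c, hc', rfl⟩ := Finset.mem_image.1 hk
    rw [mem_E, e_treePair] at hiv hkv ⊢
    refine ⟨hj, ?_⟩
    have key : ∀ {a b : Fin n}, a ∈ I → b ∈ I →
        (X.map Fin.val).idxOf a.val < (X.map Fin.val).idxOf b.val →
        (Y.map Fin.val).idxOf (G.φ a).val < (Y.map Fin.val).idxOf (G.φ b).val := by
      intro a b ha hb hab
      have h1 := hab
      rw [idxOf_map_val, idxOf_map_val] at hab ⊢
      have h2 := hc a ((memX a).2 ha) b ((memX b).2 hb) hab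
      refine lt_of_le_of_ne (not_lt.1 h2) fun he => ?_
      have := G.φ.injective ((List.idxOf_inj ((memY a).2 ha)).1 he)
      subst this
      exact lt_irrefl _ h1
    cases σ
    · exact convex_leavesBelow hG (σ := .T) (hX'.convex G.T hXn G.nodup_T) hv _
        (List.mem_map_of_mem ((memX a).2 ha)) _ (List.mem_map_of_mem ((memX b).2 hb)) _
        (List.mem_map_of_mem ((memX c).2 hc')) hij hjk hiv.2 hkv.2
    · exact convex_leavesBelow hG (σ := .S) (hY'.convex G.S hYn G.nodup_S) hv _
        (List.mem_map_of_mem ((memY a).2 ha)) _ (List.mem_map_of_mem ((memY b).2 hb)) _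
        (List.mem_map_of_mem ((memY c).2 hc')) (key ha hb hij) (key hb hc' hjk) hiv.2 hkv.2

/-! ### Layouts and their crossings -/

theorem cross_iff {X : Side → List ℕ} {Z : Side → List (Fin n)}
    (hZ : ∀ σ, (Z σ).map Fin.val = X σ) (a b : Fin n) :
    Cross (G.treePair hG hn) X a b ↔
      ((Z .T).idxOf a < (Z .T).idxOf b ∧ (Z .S).idxOf (G.φ b) < (Z .S).idxOf (G.φ a)) ∨
      ((Z .T).idxOf b < (Z .T).idxOf a ∧ (Z .S).idxOf (G.φ a) < (Z .S).idxOf (G.φ b)) := by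
  simp only [Cross, Before, e_treePair, ← hZ, idxOf_map_val, endpoint]

/-- `crossSum` counts ordered pairs, whereas `crossings` counts each crossing once, with the edge
that is upper in T as first component. Exchanging the summations identifies the two halves. -/
theorem crossSum_eq {X : Side → List ℕ} {Z : Side → List (Fin n)}
    (hZ : ∀ σ, (Z σ).map Fin.val = X σ) :
    crossSum (G.treePair hG hn) (Finset.range n) X = 2 * G.crossings (Z .T) (Z .S) := by
  have h1 : crossSum (G.treePair hG hn) (Finset.range n) X = ∑ a : Fin n, ∑ b : Fin n,
      if Cross (G.treePair hG hn) X a b then 1 else 0 := by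
    unfold crossSum
    simp only [Finset.card_filter]
    rw [Finset.sum_range]
    exact Finset.sum_congr rfl fun a _ => Finset.sum_range _
  have h2 : ∀ a b : Fin n, (if Cross (G.treePair hG hn) X a b then 1 else 0) =
      (if (Z .T).idxOf a < (Z .T).idxOf b ∧ (Z .S).idxOf (G.φ b) < (Z .S).idxOf (G.φ a)
        then 1 else 0) +
      (if (Z .T).idxOf b < (Z .T).idxOf a ∧ (Z .S).idxOf (G.φ a) < (Z .S).idxOf (G.φ b)
        then 1 else 0) := by
    intro a b
    simp only [cross_iff hZ]
    split_ifs <;> first | rfl | (exfalso; omega)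
  have h3 : G.crossings (Z .T) (Z .S) = ∑ a : Fin n, ∑ b : Fin n,
      if (Z .T).idxOf a < (Z .T).idxOf b ∧ (Z .S).idxOf (G.φ b) < (Z .S).idxOf (G.φ a)
        then 1 else 0 := by
    rw [crossings, Finset.card_filter, Fintype.sum_prod_type]
    simp [hG _]
  simp only [h1, h2, Finset.sum_add_distrib]
  rw [h3, two_mul, Nat.add_left_cancel_iff, Finset.sum_comm]

/-- The hypothesis on b matters: the index of an element that is filtered out would be the length of
the list and say nothing about its place in X. -/
theorem idxOf_filter_lt {p : Fin n → Prop} [DecidablePred p] {X : List (Fin n)} {a b : Fin n}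
    (hb : p b) (h : (X.filter p).idxOf a < (X.filter p).idxOf b) : X.idxOf a < X.idxOf b := by
  induction X with
  | nil => simp at h
  | cons x X ih =>
    by_cases hxb : x = b
    · subst hxb
      simp [hb] at h
    · by_cases hxa : x = a
      · subst hxa
        rw [List.idxOf_cons_self, List.idxOf_cons_ne _ hxb]; omega
      · rw [List.idxOf_cons_ne _ hxb, List.idxOf_cons_ne _ hxa]
        by_cases hp : p x
        · rw [List.filter_cons_of_pos (by simpa using hp), List.idxOf_cons_ne _ hxb,
            List.idxOf_cons_ne _ hxa] at h
          have := ih (by omega)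
          omega
        · rw [List.filter_cons_of_neg (by simpa using hp)] at h
          have := ih h
          omega

end Tanglegram

end Tangle

namespace Tangle
open TreePair

/-! ### The main theorem -/

/-- The names of all arrays. -/
def allArrs : Finset Arr :=
  [Arr.size, .phi, .inI, .verts, .adj, .tmp, .inM, .inJ].toFinset ∪
    [Side.T, .S].toFinset.biUnion fun σ => [Arr.child σ false, .child σ true, .edge σ, .desc σ,
      .red σ, .lay σ, .len σ, .mate σ, .chain σ, .pos σ].toFinset

theorem mem_allArrs (a : Arr) : a ∈ allArrs := by
  rcases a with _ | ⟨_ | _, _ | _⟩ | _ | _ | _ | ⟨_ | _⟩ | ⟨_ | _⟩ | ⟨_ | _⟩ | _ | ⟨_ | _⟩ |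
    ⟨_ | _⟩ | _ | ⟨_ | _⟩ | _ | _ | ⟨_ | _⟩ | ⟨_ | _⟩ <;> decide

/-- There are 28 arrays: 8 single ones and 10 for each of the two sides. -/
theorem card_le_of_inBox {N : ℕ} {u : Finset (Arr × ℕ × ℕ)} (h : InBox N u) :
    u.card ≤ 28 * N ^ 2 := by
  have hsub : u ⊆ allArrs ×ˢ Finset.range N ×ˢ Finset.range N := fun c hc => by
    simpa [mem_allArrs] using h c hc
  refine (Finset.card_le_card hsub).trans ?_
  rw [Finset.card_product, Finset.card_product, Finset.card_range, ← sq]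
  exact Nat.mul_le_mul_right _ (by decide)

theorem exists_map_val {n : ℕ} {X : List ℕ} (h : ∀ x ∈ X, x < n) :
    ∃ Z : List (Fin n), Z.map Fin.val = X :=
  ⟨X.pmap Fin.mk h, by simp [List.map_pmap]⟩

namespace Tanglegram

variable {n : ℕ} {G : Tanglegram n} {hG : G.Full} {hn : 1 ≤ n} {I : Finset (Fin n)}

theorem isLeafOrder_of_layout {X : Side → List ℕ} {Z : Side → List (Fin n)}
    (hZ : ∀ σ, (Z σ).map Fin.val = X σ) (h : Layout (G.treePair hG hn) (Finset.range n) X)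
    (σ : Side) : (G.side σ).IsLeafOrder (Z σ) := by
  refine BinTree.isLeafOrder_of_convex _ ?_ (fun a => iff_of_true ?_ (hG.mem_side σ a))
    (nodup_side σ) fun S hS => ?_
  · exact List.Nodup.of_map Fin.val (hZ σ ▸ h.nodup σ)
  · have : a.val ∈ X σ := by
      obtain ⟨b, rfl⟩ : ∃ b, G.endpoint σ b = a := by
        cases σ
        exacts [⟨a, rfl⟩, ⟨G.φ.symm a, Equiv.apply_symm_apply _ _⟩]
      rw [← e_treePair (hG := hG) (hn := hn)]
      exact h.e_mem (by simp)
    rw [← hZ] at this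
    obtain ⟨b, hb, he⟩ := List.mem_map.1 this
    exact Fin.ext he ▸ hb
  · rw [hZ]
    exact convex_of_mem_leafSets hG (h.convex σ) hS

theorem isPlanarLayout_filter {hI : I.Nonempty} {X : Side → List ℕ} {Z : Side → List (Fin n)}
    (hZ : ∀ σ, (Z σ).map Fin.val = X σ) (h : Layout (G.treePair hG hn) (Finset.range n) X)
    (hc : ∀ a ∈ I.image Fin.val, ∀ b ∈ I.image Fin.val, ¬ Cross (G.treePair hG hn) X a b) :
    (G.induced hG I hI).IsPlanarLayout
      ((Z .T).filter (fun i => i ∈ I)) ((Z .S).filter (fun j => j ∈ I.image G.φ)) := by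
  have hT := (isLeafOrder_of_layout hZ h .T).filter (fun i => i ∈ I)
  have hS := (isLeafOrder_of_layout hZ h .S).filter (fun j => j ∈ I.image G.φ)
  refine ⟨⟨(BinTree.isLeafOrder_get_induce _).2 hT, (BinTree.isLeafOrder_get_induce _).2 hS⟩,
    crossings_eq_zero_iff.2 fun i hi j hj h1 h2 => ?_⟩
  have mem : ∀ i, i ∈ (G.induced hG I hI).T.leaves → i ∈ I := fun i hi => by
    simp only [induced, BinTree.leaves_get_induce] at hi
    simpa using (List.mem_filter.1 hi).2
  have hi := mem i hi
  have hj := mem j hj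
  refine hc i (Finset.mem_image_of_mem _ hi) j (Finset.mem_image_of_mem _ hj)
    ((cross_iff hZ i j).2 (Or.inl ⟨idxOf_filter_lt hj h1, idxOf_filter_lt ?_ h2⟩))
  exact Finset.mem_image_of_mem _ hi

end Tanglegram

theorem output_eq {m : State} {X : List ℕ} {σ : Side} (h : Lst m.mem σ X) : m.output σ = X := by
  rw [State.output, h.1]
  refine List.ext_getElem (by simp) fun k h1 h2 => ?_
  rw [List.getElem_map, List.getElem_range, h.2 k h2, List.getD_eq_getElem _ _ h2]

theorem Tr.run {N c : ℕ} {α : Type} {p : Prog ℕ α} {s : State} {P : α → Mem → Prop}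
    (h : Tr N p s.mem c P) (hu : InBox N s.used) (ht : s.time = 0) :
    InBox N (p.run s).2.used ∧ P (p.run s).1 (p.run s).2.mem ∧ (p.run s).2.time ≤ c := by
  obtain ⟨h1, h2, h3⟩ := wp_sound p s _ hu (h s.time)
  exact ⟨h1, h2, by omega⟩

theorem run_iteratedInsertion {D : TreePair} {n : ℕ} (hn : D.n = n) {s : State} {I : Finset ℕ}
    {lt : ℕ → ℕ → Prop} (hi : Input D s.mem) (hI : ∀ i < n, (s.mem .inI i 0 ≠ 0 ↔ i ∈ I))
    (hIne : I.Nonempty) (ho : PlanarOrder D I lt) (h0 : ∀ u v, s.mem .adj u v = 0)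
    (hM : ∀ u, s.mem .inM u 0 = 0) (hu : s.used = ∅) (ht : s.time = 0) {s' : State}
    (hs : (iteratedInsertion.run s).2 = s') :
    InBox (2 * n) s'.used ∧ (∃ X, LState D s'.mem (Finset.range n) X ∧
      (∀ a ∈ I, ∀ b ∈ I, ¬ Cross D X a b) ∧
      (2 ≤ I.card → FewCrossings D I (Finset.range n) X)) ∧ s'.time ≤ 12000 * n ^ 3 := by
  subst hn hs
  exact (tr_iteratedInsertion hi hI hIne ho h0 hM).run (by simp [InBox, hu]) ht

theorem finalState_spec {n : ℕ} {G : Tanglegram n} {hG : G.Full} {hn : 1 ≤ n} {I : Finset (Fin n)}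
    {lt : ℕ → ℕ → Prop} (hI : I.Nonempty)
    (ho : PlanarOrder (G.treePair hG hn) (I.image Fin.val) lt) :
    InBox (2 * n) (finalState G I).used ∧ (∃ X,
      LState (G.treePair hG hn) (finalState G I).mem (Finset.range n) X ∧
      (∀ a ∈ I.image Fin.val, ∀ b ∈ I.image Fin.val, ¬ Cross (G.treePair hG hn) X a b) ∧
      (2 ≤ (I.image Fin.val).card →
        FewCrossings (G.treePair hG hn) (I.image Fin.val) (Finset.range n) X)) ∧
      (finalState G I).time ≤ 12000 * n ^ 3 := by
  have hinI : ∀ i < n, ((inputState G I).mem .inI i 0 ≠ 0 ↔ i ∈ I.image Fin.val) := by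
    intro i hi
    simp only [inputState]
    simp only [ne_eq, not_true, if_false, dif_pos hi, Finset.mem_image]
    split_ifs with h
    · exact iff_of_true (by simp) ⟨_, h, rfl⟩
    · refine iff_of_false (by simp) ?_
      rintro ⟨a, ha, rfl⟩
      exact h ha
  have hadj : ∀ u v, (inputState G I).mem .adj u v = 0 := fun u v => by simp [inputState]
  have hinM : ∀ u, (inputState G I).mem .inM u 0 = 0 := fun u => by simp [inputState]
  have hused : (inputState G I).used = ∅ := by simp [inputState]
  have htime : (inputState G I).time = 0 := by simp [inputState]
  have hin := Tanglegram.input hG hn I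
  have hs : (iteratedInsertion.run (inputState G I)).2 = finalState G I := by rw [finalState]
  have hn' : (G.treePair hG hn).n = n := by rw [Tanglegram.treePair]
  generalize finalState G I = s' at *
  generalize inputState G I = s at *
  exact run_iteratedInsertion hn' hin hinI (hI.image _) ho hadj hinM hused htime hs

theorem crossings_bound {n c k : ℕ} (h : 2 * c + 5 * n + k ^ 2 ≤ n ^ 2 + 5 * k) :
    (c : ℚ) ≤ ((n : ℚ) - k) * ((n : ℚ) + k - 5) / 2 := by
  have h' : 2 * (c : ℚ) + 5 * n + k ^ 2 ≤ n ^ 2 + 5 * k := by exact_mod_cast h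
  linarith

end Tangle

theorem mainTheorem6 :
    ∃ C : ℕ, ∀ (n : ℕ) (G : Tangle.Tanglegram n) (hG : G.Full)
      (I : Finset (Fin n)) (hI : I.Nonempty),
      (G.induced hG I hI).IsPlanar →
      (∃ X Y : List (Fin n),
        (Tangle.finalState G I).output .T = X.map Fin.val ∧
        (Tangle.finalState G I).output .S = Y.map Fin.val ∧
        G.IsLayout X Y ∧
        (G.induced hG I hI).IsPlanarLayout
          (X.filter (fun i => i ∈ I)) (Y.filter (fun j => j ∈ I.image G.φ)) ∧
        (2 ≤ I.card ∨ I.card = n →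
          (G.crossings X Y : ℚ) ≤ ((n : ℚ) - I.card) * ((n : ℚ) + I.card - 5) / 2)) ∧
      (Tangle.finalState G I).time ≤ C * n ^ 3 ∧
      (Tangle.finalState G I).space ≤ C * n ^ 2 := by
  refine ⟨12000, fun n G hG I hI hp => ?_⟩
  have hn : 1 ≤ n := Fin.pos hI.choose
  obtain ⟨lt, ho⟩ := Tangle.Tanglegram.planarOrder (hn := hn) hp
  have hcard : (I.image Fin.val).card = I.card := Finset.card_image_of_injective _ Fin.val_injective
  obtain ⟨hbox, ⟨X, hL, hcr, hfew⟩, htime⟩ := Tangle.finalState_spec hI ho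
  generalize Tangle.finalState G I = s at *
  have hlt : ∀ σ, ∃ Z : List (Fin n), Z.map Fin.val = X σ := fun σ =>
    Tangle.exists_map_val fun x hx => hL.layout.lt hx
  choose Z hZ using hlt
  have hsum := Tangle.Tanglegram.crossSum_eq (hG := hG) (hn := hn) hZ
  refine ⟨⟨Z .T, Z .S, ?_, ?_, ⟨?_, ?_⟩, ?_, fun h => ?_⟩, ?_, ?_⟩
  · rw [hZ]; exact Tangle.output_eq (hL.lst .T)
  · rw [hZ]; exact Tangle.output_eq (hL.lst .S)
  · exact Tangle.Tanglegram.isLeafOrder_of_layout hZ hL.layout .T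
  · exact Tangle.Tanglegram.isLeafOrder_of_layout hZ hL.layout .S
  · exact Tangle.Tanglegram.isPlanarLayout_filter hZ hL.layout hcr
  · refine Tangle.crossings_bound ?_
    rcases h with h | h
    · have := hfew (hcard.symm ▸ h)
      unfold Tangle.FewCrossings at this
      rw [hcard] at this
      change _ + 5 * (Finset.range n).card + _ ≤ (Finset.range n).card ^ 2 + _ at this
      rw [Finset.card_range] at this
      rw [← hsum]
      exact this
    -- The induced tanglegram is the whole one, so there are no crossings at all. This also covers n
    -- = 1.
    · have hI : I = Finset.univ := Finset.eq_univ_of_card _ (by simpa using h)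
      have h0 : Tangle.crossSum (G.treePair hG hn) (Finset.range n) X = 0 :=
        Finset.sum_eq_zero fun a ha => by
          rw [Finset.card_eq_zero, Finset.filter_eq_empty_iff]
          intro b hb
          rw [Finset.mem_range] at ha hb
          exact hcr a (Finset.mem_image.2 ⟨⟨a, ha⟩, by simp [hI], rfl⟩) b
            (Finset.mem_image.2 ⟨⟨b, hb⟩, by simp [hI], rfl⟩)
      rw [← hsum, h0, h]
      omega
  · exact htime
  -- All indices are below 2n, so at most 28 (2n)² = 112 n² cells are accessed.
  · refine (Tangle.card_le_of_inBox hbox).trans ?_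
    change 28 * (2 * n) ^ 2 ≤ _
    nlinarith [Nat.zero_le (n ^ 2)]
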